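/- Notation. For $m\ge 0$ let $\mathcal P_m=\{\omega P_1\otimes\cdots\otimes P_m:\omega\in\{\pm1,\pm i\},\ P_j\in\{I,X,Y,Z\}\}$ be the $m$-qubit Pauli group and let $\mathcal C_m=\{U\in U(2^m): U\mathcal P_mU^\dagger=\mathcal P_m\}$ be the $m$-qubit Clifford group. For reals $\alpha,\beta$, an instance of the promise problem $(\alpha,\beta)$-PSGI$[\mathcal C_m]$ is a pair of quantum circuits $C_1,C_2$ on $m$ qubits over a fixed finite universal gate set (here $X$, the Hadamard gate, $P=\mathrm{diag}(1,e^{i\pi/8})$, controlled-$X$, controlled-$P$, doubly controlled-$Z$). With $|\psi_j\rangle=C_j|0^m\rangle$, it is a YES instance if $\mathrm{Re}\,\langle\psi_1|U|\psi_2\rangle\ge\beta$ for some $U\in\mathcal C_m$, and a NO instance if $|\langle\psi_1|U|\psi_2\rangle|\le\alpha$ for all $U\in\mathcal C_m$. Let $|R\rangle=(|0\rangle+e^{i\pi/8}|1\rangle)/\sqrt2$, $|R_-\rangle=(|0\rangle-e^{i\pi/8}|1\rangle)/\sqrt2$ and $|R^n\rangle=|R\rangle^{\otimes n}$. For a graph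 $G$ on $n$ vertices let $|G\rangle=\prod_{ij\in E(G)}\mathrm{CZ}_{ij}\,|+\rangle^{\otimes n}$ be its graph state, and let $$|\psi_G\rangle=\tfrac1{\sqrt2}\bigl(|R\rangle|R^n\rangle+|R_-\rangle|G\rangle\bigr),$$ a state on $n+1$ qubits, the first of which is called the control qubit. A qubit permutation is a unitary that permutes the tensor factors. Theorem. There is a constant $n_0$ such that the following hold. 1. There is a deterministic polynomial-time many-one reduction from Graph Isomorphism to PSGI over the Clifford groups that maps every pair $(G_1,G_2)$ of $n$-vertex graphs to an instance of $(0.99999,1)$-PSGI$[\mathcal C_{n+1}]$: isomorphic pairs go to YES instances and non-isomorphic pairs to NO instances. For all $n\ge n_0$ the two circuits of this instance prepare exactly $|\psi_{G_1}\rangle$ and $|\psi_{G_2}\rangle$. 2. Let $n\ge n_0$, let $G_1,G_2$ be $n$-vertex graphs and let $U\in\mathcal C_{n+1}$ satisfy $|\langle\psi_{G_1}|U|\psi_{G_2}\rangle|\ge0.99999$. Then $U$ is, up to a global phase, a qubit permutation that fixes the control qubit, and $G_1\cong G_2$. 3. For every $n$, if $G_1\cong G_2$ are $n$-vertex graphs,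 then some qubit permutation $U\in\mathcal C_{n+1}$ that fixes the control qubit satisfies $U|\psi_{G_2}\rangle=|\psi_{G_1}\rangle$. 4. For every $n$, if $U\in\mathcal C_n$ satisfies $|\langle R^n|U|R^n\rangle|^2\ge0.9999$, then $U$ is, up to a global phase, a qubit permutation. -/

import Mathlib

open Matrix

noncomputable section

/-! ### Qubits, states, Pauli and Clifford groups -/

/-- Vectors on `m` qubits, as amplitude functions on computational basis states
(bit strings `Fin m → Bool`, with `false` for `0` and `true` for `1`). -/
abbrev QState (m : ℕ) : Type := (Fin m → Bool) → ℂ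

/-- Matrices acting on `m` qubits. -/
abbrev QMatrix (m : ℕ) : Type := Matrix (Fin m → Bool) (Fin m → Bool) ℂ

/-- The unitary group `U(2^m)` on `m` qubits. -/
abbrev QUnitary (m : ℕ) : Type := Matrix.unitaryGroup (Fin m → Bool) ℂ

/-- The matrix element `⟨φ| U |ψ⟩`. -/
def overlap {m : ℕ} (φ : QState m) (U : QUnitary m) (ψ : QState m) : ℂ :=
  star φ ⬝ᵥ ((U : QMatrix m) *ᵥ ψ)

/-- Labels of the single-qubit Pauli matrices. -/
inductive Pauli where
  | I | X | Y | Z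

/-- The entry `⟨a| P |b⟩` of a single-qubit Pauli matrix. -/
def Pauli.toMatrix : Pauli → Matrix Bool Bool ℂ
  | .I => fun a b => if a = b then 1 else 0
  | .X => fun a b => if a = b then 0 else 1
  | .Y => fun a b => if a = b then 0 else if a then Complex.I else -Complex.I
  | .Z => fun a b => if a = b then (if a then -1 else 1) else 0

/-- The tensor product `P₁ ⊗ ⋯ ⊗ Pₘ`. -/
def pauliString {m : ℕ} (P : Fin m → Pauli) : QMatrix m :=
  fun x y => ∏ j, (P j).toMatrix (x j) (y j)

/-- The (underlying set of the) `m`-qubit Pauli group: all `ω P₁ ⊗ ⋯ ⊗ Pₘ`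
with `ω ∈ {1, -1, i, -i}`. -/
def pauliGroup (m : ℕ) : Set (QUnitary m) :=
  {U | ∃ ω ∈ ({1, -1, Complex.I, -Complex.I} : Set ℂ), ∃ P : Fin m → Pauli,
    (U : QMatrix m) = ω • pauliString P}

/-- The `m`-qubit Clifford group: the normalizer of the Pauli group in the unitary group. -/
def cliffordGroup (m : ℕ) : Subgroup (QUnitary m) :=
  Subgroup.normalizer (pauliGroup m)

/-- The operator permuting the qubits along `σ`: `(qubitPerm σ ψ) x = ψ (x ∘ σ)`. -/
def qubitPerm {m : ℕ} (σ : Equiv.Perm (Fin m)) : QMatrix m :=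
  fun x y => if y = x ∘ σ then 1 else 0

/-! ### The states of the reduction -/

/-- `|R⟩ = (|0⟩ + e^{iπ/8} |1⟩) / √2`. -/
def ketR (b : Bool) : ℂ :=
  (1 / Real.sqrt 2 : ℝ) * (if b then Complex.exp (Complex.I * Real.pi / 8) else 1)

/-- `|R₋⟩ = (|0⟩ - e^{iπ/8} |1⟩) / √2`. -/
def ketRminus (b : Bool) : ℂ :=
  (1 / Real.sqrt 2 : ℝ) * (if b then -Complex.exp (Complex.I * Real.pi / 8) else 1)

/-- `|R^n⟩ = |R⟩ ⊗ ⋯ ⊗ |R⟩`. -/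
def ketRpow (n : ℕ) : QState n :=
  fun x => ∏ i, ketR (x i)

open Classical in
/-- The graph state `|G⟩ = ∏_{ij ∈ E(G)} CZ_{ij} |+⟩^{⊗ n}`. -/
def graphState {n : ℕ} (G : SimpleGraph (Fin n)) : QState n :=
  fun x => (1 / Real.sqrt 2 : ℝ) ^ n *
    ∏ i, ∏ j, if i < j ∧ G.Adj i j ∧ x i = true ∧ x j = true then -1 else 1

/-- The state `(|R⟩|R^n⟩ + |R₋⟩|G⟩) / √2` on `n + 1` qubits; qubit `0` is the control. -/
def controlledGraphState {n : ℕ} (G : SimpleGraph (Fin n)) : QState (n + 1) :=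
  fun x => (1 / Real.sqrt 2 : ℝ) *
    (ketR (x 0) * ketRpow n (Fin.tail x) + ketRminus (x 0) * graphState G (Fin.tail x))

/-! ### Quantum circuits -/

/-- Gates on `m` qubits from a fixed finite universal gate set: the Pauli gate `X`, the Hadamard
gate, `P = diag(1, e^{iπ/8})`, the controlled `X`, the controlled `P` and the doubly controlled
`Z`. -/
inductive Gate (m : ℕ) where
  | x (i : Fin m)
  | hadamard (i : Fin m)
  | phase (i : Fin m)
  | cnot (c t : Fin m) (h : c ≠ t)
  | cphase (i j : Fin m) (h : i ≠ j)
  | ccz (i j k : Fin m) (hij : i ≠ j) (hik : i ≠ k) (hjk : j ≠ k)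

/-- The action of a gate on states. -/
def Gate.apply {m : ℕ} : Gate m → QState m → QState m
  | .x i, ψ => fun b => ψ (Function.update b i (!b i))
  | .hadamard i, ψ => fun b => (1 / Real.sqrt 2 : ℝ) *
      (ψ (Function.update b i false) +
        (if b i then -1 else 1) * ψ (Function.update b i true))
  | .phase i, ψ => fun b =>
      (if b i then Complex.exp (Complex.I * Real.pi / 8) else 1) * ψ b
  | .cnot c t _, ψ => fun b => ψ (Function.update b t (xor (b t) (b c)))
  | .cphase i j _, ψ => fun b =>
      (if b i && b j then Complex.exp (Complex.I * Real.pi / 8) else 1) * ψ b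
  | .ccz i j k _ _ _, ψ => fun b => (if b i && b j && b k then -1 else 1) * ψ b

/-- A quantum circuit on `m` qubits: its gates in the order in which they are applied. -/
abbrev Circuit (m : ℕ) : Type := List (Gate m)

/-- The state `C |0^m⟩` prepared by a circuit. -/
def Circuit.state {m : ℕ} (C : Circuit m) : QState m :=
  C.foldl (fun ψ g => g.apply ψ) (Pi.single (fun _ => false) 1)

/-! ### Promise problems and polynomial-time reductions -/

/-- A promise problem on instances of type `α`. -/
structure PromiseProblem (α : Type) where
  yes : Set α
  no : Set α

/-- `f` is a deterministic polynomial-time many-one reduction from `A` to `B`, where instances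
are written as bit strings by `ea` and `eb`, and time is the number of steps of a Turing
machine, measured in the length of the bit string of the instance. -/
def IsPolyTimeReduction {α β : Type} (ea : α → List Bool) (eb : β → List Bool)
    (A : PromiseProblem α) (B : PromiseProblem β) (f : α → β) : Prop :=
  Nonempty (Turing.TM2ComputableInPolyTime ea eb f) ∧
    (∀ a ∈ A.yes, f a ∈ B.yes) ∧ (∀ a ∈ A.no, f a ∈ B.no)

/-- Pairs of graphs on a common vertex set `{0, …, n - 1}`. -/
abbrev GraphPair : Type := Σ n : ℕ, SimpleGraph (Fin n) × SimpleGraph (Fin n)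

/-- Graph Isomorphism. -/
def graphIsomorphism : PromiseProblem GraphPair where
  yes := {p | Nonempty (p.2.1 ≃g p.2.2)}
  no := {p | ¬ Nonempty (p.2.1 ≃g p.2.2)}

/-- Pairs of circuits on a common number of qubits. -/
abbrev CircuitPair : Type := Σ m : ℕ, Circuit m × Circuit m

/-- The problem `(α, β)`-PSGI for a family of groups `G m` with unitary representations `R m` on
`m` qubits: given circuits preparing `|ψ₁⟩` and `|ψ₂⟩`, distinguish the case that
`Re ⟨ψ₁| R(g) |ψ₂⟩ ≥ β` for some `g` from the case that `|⟨ψ₁| R(g) |ψ₂⟩| ≤ α` for all `g`. -/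
def PSGI {G : ℕ → Type} [∀ m, Group (G m)] (R : ∀ m, G m →* QUnitary m) (α β : ℝ) :
    PromiseProblem CircuitPair where
  yes := {p | ∃ g : G p.1, β ≤ (overlap p.2.1.state (R p.1 g) p.2.2.state).re}
  no := {p | ∀ g : G p.1, ‖overlap p.2.1.state (R p.1 g) p.2.2.state‖ ≤ α}

/-- `(α, β)`-PSGI over the Clifford groups, acting by their defining representations. -/
def cliffordPSGI (α β : ℝ) : PromiseProblem CircuitPair :=
  PSGI (fun m => (cliffordGroup m).subtype) α β

/-! ### Encodings by bit strings -/

/-- The number `k` in unary, closed by an end marker: `1^k 0`. -/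
def unaryCode (k : ℕ) : List Bool :=
  List.replicate k true ++ [false]

open Classical in
/-- The adjacency matrix, row by row. -/
def encodeGraph {n : ℕ} (G : SimpleGraph (Fin n)) : List Bool :=
  (List.finRange n).flatMap fun i => (List.finRange n).map fun j => decide (G.Adj i j)

/-- The number of vertices in unary, followed by the two adjacency matrices. -/
def encodeGraphPair (p : GraphPair) : List Bool :=
  unaryCode p.1 ++ encodeGraph p.2.1 ++ encodeGraph p.2.2

/-- A gate, as its type (one of `1, …, 6`) followed by the qubits on which it acts. -/
def encodeGate {m : ℕ} : Gate m → List Bool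
  | .x i => unaryCode 1 ++ unaryCode i
  | .hadamard i => unaryCode 2 ++ unaryCode i
  | .phase i => unaryCode 3 ++ unaryCode i
  | .cnot c t _ => unaryCode 4 ++ unaryCode c ++ unaryCode t
  | .cphase i j _ => unaryCode 5 ++ unaryCode i ++ unaryCode j
  | .ccz i j k _ _ _ => unaryCode 6 ++ unaryCode i ++ unaryCode j ++ unaryCode k

/-- The gates of a circuit one after the other, closed by the end marker `0`. -/
def encodeCircuit {m : ℕ} (C : Circuit m) : List Bool :=
  C.flatMap encodeGate ++ unaryCode 0

/-- The number of qubits in unary, followed by the two circuits. -/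
def encodeCircuitPair (p : CircuitPair) : List Bool :=
  unaryCode p.1 ++ encodeCircuit p.2.1 ++ encodeCircuit p.2.2

end

/-! ### Pauli strings as monomial matrices -/

/-! Conjugation by a Clifford unitary permutes the Pauli strings up to phases (`clifford_conj`), so
the absolute expectation values of Pauli strings form a Clifford invariant of a state. The invariant
is stable: when a Clifford maps one state to another up to overlap `t`, matching expectation values
differ by at most √(8(1 - t)) (`norm_expect_sub_le`).

For |R^n⟩ these values are products of the numbers 1, cos(π/8), sin(π/8), 0 for I, X, Y, Z. Among
strings other than the identity the largest value is cos(π/8), it is attained only by an X on one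
qubit, and there is a gap below it. A Clifford that nearly fixes |R^n⟩ therefore permutes the X_j.
The image of Y_j must not commute with the image of X_j and must keep a value near sin(π/8), which
leaves only Y on the same qubit. A unitary that permutes the X_j and Y_j in this way is a qubit
permutation up to phase (`eq_smul_qubitPerm`, `clifford_eq_qubitPerm`).

The overlap of two controlled states is half the sum of four terms. The cross terms compare
|R^{n+1}⟩ with a Clifford image of |R₋⟩|G⟩. Up to the control qubit, the latter has a stabilizer
spectrum: few strings, each of absolute value 1. The spectrum of |R^{n+1}⟩ is spread out, its fourth
moment being (7/4)^{n+1} rather than 2^{n+1}. Two applications of Cauchy–Schwarz make the cross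
terms exponentially small (`norm_braket_pow_le`, `norm_overlap_markedGraphState_le`). Hence a total
overlap of 0.99999 forces both diagonal terms close to 1. The first makes `U` a qubit permutation.
The second makes this permutation nearly match the states |R₋⟩|G⟩. It then fixes the control, since
cos(π/8) is not near 0 or 1, and it carries stabilizer generators of one graph to stabilizers of the
other, from which adjacency is read off (`clifford_rigidity`).

Conversely an isomorphism permutes the target qubits and maps one state exactly to the other
(`exists_qubitPerm_of_iso`). For the reduction, `graphCircuit` prepares the states for large graphs.
The finitely many small instances are answered from a table by a fixed YES pair or a fixed NO pair
of circuits. An explicit stack machine writes the encoded circuits in polynomial time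
(`runsIn_machine`, `polyTime_graphReduction`). -/

instance : DecidableEq Pauli := fun a b => by
  cases a <;> cases b <;> first | exact isTrue rfl | exact isFalse nofun

instance : Fintype Pauli := ⟨{.I, .X, .Y, .Z}, fun a => by cases a <;> simp⟩

theorem Pauli.sum_eq {M : Type*} [AddCommMonoid M] (f : Pauli → M) :
    ∑ a, f a = f .I + f .X + f .Y + f .Z := by
  have h : (Finset.univ : Finset Pauli) = {.I, .X, .Y, .Z} := rfl
  rw [h, Finset.sum_insert (by simp), Finset.sum_insert (by simp), Finset.sum_insert (by simp),
    Finset.sum_singleton]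
  simp only [add_assoc]

/-- Whether a Pauli matrix flips the computational basis. -/
def Pauli.xbit : Pauli → Bool
  | .I => false
  | .X => true
  | .Y => true
  | .Z => false

/-- Whether a Pauli matrix anticommutes with `X`. -/
def Pauli.zbit : Pauli → Bool
  | .I => false
  | .X => false
  | .Y => true
  | .Z => true

/-- The basis state to which a Pauli string sends a basis state, up to a phase. -/
def pauliFlip {m : ℕ} (P : Fin m → Pauli) (x : Fin m → Bool) : Fin m → Bool :=
  fun j => xor (x j) (P j).xbit

/-- The nonzero entry of a Pauli string in a given row. -/
noncomputable def pauliPhase {m : ℕ} (P : Fin m → Pauli) (x : Fin m → Bool) : ℂ :=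
  ∏ j, (P j).toMatrix (x j) (pauliFlip P x j)

theorem Pauli.toMatrix_eq_zero {A : Pauli} {a b : Bool} (h : b ≠ xor a A.xbit) :
    A.toMatrix a b = 0 := by
  cases A <;> cases a <;> cases b <;> simp_all [Pauli.toMatrix, Pauli.xbit]

theorem Pauli.norm_toMatrix_flip (A : Pauli) (a : Bool) :
    ‖A.toMatrix a (xor a A.xbit)‖ = 1 := by
  cases A <;> cases a <;> simp [Pauli.toMatrix, Pauli.xbit]

theorem norm_pauliPhase {m : ℕ} (P : Fin m → Pauli) (x : Fin m → Bool) : ‖pauliPhase P x‖ = 1 := by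
  simp [pauliPhase, pauliFlip, norm_prod, Pauli.norm_toMatrix_flip]

theorem pauliPhase_ne_zero {m : ℕ} (P : Fin m → Pauli) (x : Fin m → Bool) : pauliPhase P x ≠ 0 :=
  norm_ne_zero_iff.1 (by simp [norm_pauliPhase])

theorem pauliString_apply {m : ℕ} (P : Fin m → Pauli) (x y : Fin m → Bool) :
    pauliString P x y = if y = pauliFlip P x then pauliPhase P x else 0 := by
  split_ifs with h
  · subst h; rfl
  · obtain ⟨j, hj⟩ := Function.ne_iff.1 h
    exact Finset.prod_eq_zero (Finset.mem_univ j) (Pauli.toMatrix_eq_zero hj)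

theorem pauliFlip_pauliFlip {m : ℕ} (P : Fin m → Pauli) (x : Fin m → Bool) :
    pauliFlip P (pauliFlip P x) = x := by
  funext j; simp [pauliFlip]

theorem pauliString_mul_apply {m : ℕ} (P : Fin m → Pauli) (M : QMatrix m) (x y : Fin m → Bool) :
    (pauliString P * M) x y = pauliPhase P x * M (pauliFlip P x) y := by
  simp [Matrix.mul_apply, pauliString_apply]

theorem mul_pauliString_apply {m : ℕ} (P : Fin m → Pauli) (M : QMatrix m) (x y : Fin m → Bool) :
    (M * pauliString P) x y = M x (pauliFlip P y) * pauliPhase P (pauliFlip P y) := by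
  rw [Matrix.mul_apply, Finset.sum_eq_single (pauliFlip P y)]
  · simp [pauliString_apply, pauliFlip_pauliFlip]
  · intro z _ hz
    rw [pauliString_apply, if_neg, mul_zero]
    rintro rfl
    exact hz (pauliFlip_pauliFlip P z).symm
  · simp

theorem pauliString_mulVec {m : ℕ} (P : Fin m → Pauli) (φ : QState m) (x : Fin m → Bool) :
    (pauliString P *ᵥ φ) x = pauliPhase P x * φ (pauliFlip P x) := by
  simp [Matrix.mulVec, dotProduct, pauliString_apply]

theorem Pauli.star_toMatrix (A : Pauli) (a b : Bool) :
    star (A.toMatrix b a) = A.toMatrix a b := by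
  cases A <;> cases a <;> cases b <;> simp [Pauli.toMatrix]

theorem Pauli.toMatrix_mul_self (A : Pauli) : A.toMatrix * A.toMatrix = 1 := by
  ext a b
  rw [Matrix.mul_apply, Fintype.sum_bool]
  cases A <;> cases a <;> cases b <;> simp [Pauli.toMatrix]

theorem star_pauliString {m : ℕ} (P : Fin m → Pauli) : star (pauliString P) = pauliString P := by
  ext x y
  simp only [Matrix.star_apply, pauliString, star_prod, Pauli.star_toMatrix]

theorem sum_prod_bits {m : ℕ} (F : Fin m → Bool → ℂ) :
    ∑ x : Fin m → Bool, ∏ j, F j (x j) = ∏ j, ∑ b, F j b := by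
  rw [Finset.prod_univ_sum, Fintype.piFinset_univ]

theorem pauliString_mul_pauliString {m : ℕ} (P Q : Fin m → Pauli) (x y : Fin m → Bool) :
    (pauliString P * pauliString Q) x y
      = ∏ j, ((P j).toMatrix * (Q j).toMatrix) (x j) (y j) := by
  simp only [Matrix.mul_apply, pauliString, ← Finset.prod_mul_distrib]
  exact sum_prod_bits fun j b => (P j).toMatrix (x j) b * (Q j).toMatrix b (y j)

theorem pauliString_mul_self {m : ℕ} (P : Fin m → Pauli) : pauliString P * pauliString P = 1 := by
  ext x y
  rw [pauliString_mul_pauliString]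
  simp only [Pauli.toMatrix_mul_self, Matrix.one_apply, Fintype.prod_ite_zero,
    Finset.prod_const_one, funext_iff]

theorem pauliString_commute {m : ℕ} {P Q : Fin m → Pauli}
    (h : ∀ j, (P j).toMatrix * (Q j).toMatrix = (Q j).toMatrix * (P j).toMatrix) :
    pauliString P * pauliString Q = pauliString Q * pauliString P := by
  ext x y
  simp only [pauliString_mul_pauliString, h]

/-- Pauli strings that are proportional are equal. -/
theorem pauliString_eq_of_smul {m : ℕ} {P Q : Fin m → Pauli} {z : ℂ}
    (h : pauliString P = z • pauliString Q) : P = Q := by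
  -- The positions of the nonzero entries determine the X-parts.
  have hflip : ∀ x, pauliFlip P x = pauliFlip Q x := by
    intro x
    by_contra hne
    have h1 := congrFun (congrFun h x) (pauliFlip P x)
    rw [Matrix.smul_apply, pauliString_apply, pauliString_apply, if_pos rfl, if_neg hne,
      smul_zero] at h1
    exact pauliPhase_ne_zero P x h1
  have hphase : ∀ x, pauliPhase P x = z * pauliPhase Q x := by
    intro x
    have h1 := congrFun (congrFun h x) (pauliFlip P x)
    rwa [Matrix.smul_apply, pauliString_apply, pauliString_apply, if_pos rfl, if_pos (hflip x),
      smul_eq_mul] at h1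
  have hx : ∀ j, (P j).xbit = (Q j).xbit := by
    intro j
    simpa [pauliFlip] using congrFun (hflip fun _ => false) j
  funext j
  -- Varying only bit `j` leaves the other factors as a common constant. The ratio of the two phases
  -- then separates I from Z and X from Y.
  have key : ∀ b, pauliPhase P (Function.update (fun _ => false) j b)
      = (P j).toMatrix b (xor b (P j).xbit) *
        ∏ l ∈ Finset.univ.erase j, (P l).toMatrix false (P l).xbit := by
    intro b
    rw [pauliPhase, ← Finset.mul_prod_erase _ _ (Finset.mem_univ j)]
    congr 1
    · simp [pauliFlip]
    · refine Finset.prod_congr rfl fun l hl => ?_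
      simp [pauliFlip, Function.update_of_ne (Finset.ne_of_mem_erase hl)]
  have key' : ∀ b, pauliPhase Q (Function.update (fun _ => false) j b)
      = (Q j).toMatrix b (xor b (Q j).xbit) *
        ∏ l ∈ Finset.univ.erase j, (Q l).toMatrix false (Q l).xbit := by
    intro b
    rw [pauliPhase, ← Finset.mul_prod_erase _ _ (Finset.mem_univ j)]
    congr 1
    · simp [pauliFlip]
    · refine Finset.prod_congr rfl fun l hl => ?_
      simp [pauliFlip, Function.update_of_ne (Finset.ne_of_mem_erase hl)]
  have h0 := hphase (Function.update (fun _ => false) j false)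
  have h1 := hphase (Function.update (fun _ => false) j true)
  have hP0 := pauliPhase_ne_zero P (Function.update (fun _ => false) j false)
  have hQ0 := pauliPhase_ne_zero Q (Function.update (fun _ => false) j false)
  rw [key] at h0 h1 hP0
  rw [key'] at h0 h1 hQ0
  generalize (∏ l ∈ Finset.univ.erase j, (P l).toMatrix false (P l).xbit) = p at *
  generalize (∏ l ∈ Finset.univ.erase j, (Q l).toMatrix false (Q l).xbit) = q at *
  have hp : p ≠ 0 := right_ne_zero_of_mul hP0
  have hxj := hx j
  revert h0 h1 hxj
  cases P j <;> cases Q j <;> simp [Pauli.toMatrix, Pauli.xbit] <;> intro h0 h1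
  all_goals
    apply hp
    first
    | linear_combination (1 / 2 : ℂ) * h0 + (1 / 2 : ℂ) * h1
    | linear_combination (1 / 2 : ℂ) * h0 - (1 / 2 : ℂ) * h1
    | linear_combination (Complex.I / 2) * h0 - (Complex.I / 2) * h1 + p * Complex.I_sq

/-! ### Matrix elements and expectation values -/

/-- The matrix element `⟨φ| A |ψ⟩`. -/
noncomputable def braket {m : ℕ} (φ : QState m) (A : QMatrix m) (ψ : QState m) : ℂ :=
  star φ ⬝ᵥ (A *ᵥ ψ)

theorem braket_eq_sum {m : ℕ} (φ : QState m) (A : QMatrix m) (ψ : QState m) :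
    braket φ A ψ = ∑ x, ∑ y, star (φ x) * A x y * ψ y := by
  simp only [braket, dotProduct, Matrix.mulVec, Finset.mul_sum, Pi.star_apply, mul_assoc]

theorem braket_pauliString {m : ℕ} (φ ψ : QState m) (P : Fin m → Pauli) :
    braket φ (pauliString P) ψ
      = ∑ x, star (φ x) * (pauliPhase P x * ψ (pauliFlip P x)) := by
  simp only [braket, dotProduct, pauliString_mulVec, Pi.star_apply]

theorem braket_one {m : ℕ} (φ ψ : QState m) : braket φ 1 ψ = ∑ x, star (φ x) * ψ x := by
  simp only [braket, dotProduct, Matrix.one_mulVec, Pi.star_apply]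

theorem braket_one_self {m : ℕ} (φ : QState m) :
    braket φ 1 φ = ((∑ x, ‖φ x‖ ^ 2 : ℝ) : ℂ) := by
  rw [braket_one, Complex.ofReal_sum]
  refine Finset.sum_congr rfl fun x _ => ?_
  rw [Complex.star_def, ← Complex.normSq_eq_conj_mul_self, Complex.normSq_eq_norm_sq]

theorem star_braket {m : ℕ} (φ : QState m) (A : QMatrix m) (ψ : QState m) :
    star (braket φ A ψ) = braket ψ (star A) φ := by
  rw [braket_eq_sum, braket_eq_sum, star_sum, Finset.sum_comm]
  refine Finset.sum_congr rfl fun x _ => ?_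
  rw [star_sum]
  refine Finset.sum_congr rfl fun y _ => ?_
  simp only [star_mul', star_star, Matrix.star_apply]
  ring

theorem braket_mulVec_mulVec {m : ℕ} (M A N : QMatrix m) (φ ψ : QState m) :
    braket (M *ᵥ φ) A (N *ᵥ ψ) = braket φ (star M * A * N) ψ := by
  simp only [braket, Matrix.star_mulVec, ← Matrix.mulVec_mulVec, Matrix.dotProduct_mulVec,
    Matrix.star_eq_conjTranspose, Matrix.vecMul_vecMul]

theorem braket_smul {m : ℕ} (φ ψ : QState m) (z : ℂ) (A : QMatrix m) :
    braket φ (z • A) ψ = z * braket φ A ψ := by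
  simp only [braket, Matrix.smul_mulVec, dotProduct_smul, smul_eq_mul]

/-- Matrix elements of tensor products are products. -/
theorem braket_prod {m : ℕ} (f g : Fin m → Bool → ℂ) (P : Fin m → Pauli) :
    braket (fun x => ∏ j, f j (x j)) (pauliString P) (fun x => ∏ j, g j (x j))
      = ∏ j, ∑ b, star (f j b) * ((P j).toMatrix b (xor b (P j).xbit) * g j (xor b (P j).xbit)) := by
  rw [braket_pauliString, ← sum_prod_bits]
  refine Finset.sum_congr rfl fun x _ => ?_
  simp only [pauliPhase, star_prod, ← Finset.prod_mul_distrib, pauliFlip]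

theorem pauliString_const_I {m : ℕ} : pauliString (fun _ : Fin m => Pauli.I) = 1 := by
  ext x y
  simp only [pauliString, Pauli.toMatrix, Matrix.one_apply, Fintype.prod_ite_zero,
    Finset.prod_const_one, funext_iff]

/-! ### Stability of expectation values -/

/-- Expectation values of a contraction in two nearby states are close. -/
theorem norm_inner_map_sub_sq_le {E : Type*} [NormedAddCommGroup E] [InnerProductSpace ℂ E]
    (T : E →ₗ[ℂ] E) (hT : ∀ v, ‖T v‖ ≤ ‖v‖) {u v : E} (hu : ‖u‖ = 1) (hv : ‖v‖ = 1) :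
    ‖inner ℂ u (T u) - inner ℂ v (T v)‖ ^ 2 ≤ 8 * (1 - ‖inner ℂ u v‖) := by
  -- A global phase does not change the expectation value in `v`. The one chosen here makes the
  -- inner product real and nonnegative, which minimizes the distance to `u`.
  obtain ⟨θ, hθ, hz⟩ : ∃ θ : ℂ, ‖θ‖ = 1 ∧ θ * inner ℂ u v = ‖inner ℂ u v‖ := by
    by_cases h0 : inner ℂ u v = 0
    · exact ⟨1, by simp, by simp [h0]⟩
    · refine ⟨‖inner ℂ u v‖ / inner ℂ u v, ?_, div_mul_cancel₀ _ h0⟩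
      rw [norm_div, Complex.norm_real, norm_norm, div_self (norm_ne_zero_iff.2 h0)]
  set w := θ • v with hw
  have hθ' : star θ * θ = 1 := by
    rw [Complex.star_def, ← Complex.normSq_eq_conj_mul_self, Complex.normSq_eq_norm_sq, hθ]; simp
  have hwn : ‖w‖ = 1 := by rw [hw, norm_smul, hθ, hv, one_mul]
  have hEw : inner ℂ w (T w) = inner ℂ v (T v) := by
    rw [hw, map_smul, inner_smul_left, inner_smul_right, ← mul_assoc, ← Complex.star_def, hθ',
      one_mul]
  have huw : inner ℂ u w = (‖inner ℂ u v‖ : ℂ) := by rw [hw, inner_smul_right, hz]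
  have hdist : ‖u - w‖ ^ 2 = 2 - 2 * ‖inner ℂ u v‖ := by
    rw [@norm_sub_sq ℂ, huw, hu, hwn]
    simp
    ring
  -- Each summand is at most ‖u - w‖, and ‖u - w‖² = 2 - 2|⟨u,v⟩|; this gives the constant 8 = 2² ·
  -- 2.
  have hsplit : inner ℂ u (T u) - inner ℂ v (T v) = inner ℂ (u - w) (T u) + inner ℂ w (T (u - w)) := by
    rw [← hEw, map_sub, inner_sub_left, inner_sub_right]; ring
  have hb : ‖inner ℂ u (T u) - inner ℂ v (T v)‖ ≤ 2 * ‖u - w‖ := by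
    rw [hsplit]
    have h1 : ‖inner ℂ (u - w) (T u)‖ ≤ ‖u - w‖ * 1 :=
      (norm_inner_le_norm _ _).trans (mul_le_mul_of_nonneg_left (hu ▸ hT u) (norm_nonneg _))
    have h2 : ‖inner ℂ w (T (u - w))‖ ≤ 1 * ‖u - w‖ :=
      (norm_inner_le_norm _ _).trans (by rw [hwn, one_mul, one_mul]; exact hT _)
    linarith [norm_add_le (inner ℂ (u - w) (T u)) (inner ℂ w (T (u - w)))]
  calc _ ≤ (2 * ‖u - w‖) ^ 2 := by gcongr
    _ = 8 * (1 - ‖inner ℂ u v‖) := by rw [mul_pow, hdist]; ring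

theorem braket_eq_inner {m : ℕ} (φ : QState m) (A : QMatrix m) (ψ : QState m) :
    braket φ A ψ = inner ℂ (WithLp.toLp 2 φ) (WithLp.toLp 2 (A *ᵥ ψ)) := by
  rw [EuclideanSpace.inner_toLp_toLp, braket, dotProduct_comm]

theorem norm_toLp_sq {m : ℕ} (φ : QState m) :
    ((‖WithLp.toLp 2 φ‖ ^ 2 : ℝ) : ℂ) = braket φ 1 φ := by
  rw [EuclideanSpace.norm_sq_eq, braket_one_self]

theorem norm_toLp_eq_one {m : ℕ} {φ : QState m} (h : braket φ 1 φ = 1) :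
    ‖WithLp.toLp 2 φ‖ = 1 := by
  have h1 := norm_toLp_sq φ
  rw [h] at h1
  have h2 : ‖WithLp.toLp 2 φ‖ ^ 2 = 1 := by exact_mod_cast h1
  exact (pow_eq_one_iff_of_nonneg (norm_nonneg _) two_ne_zero).1 h2

theorem norm_toLp_mulVec {m : ℕ} {A : QMatrix m} (hA : star A * A = 1) (φ : QState m) :
    ‖WithLp.toLp 2 (A *ᵥ φ)‖ = ‖WithLp.toLp 2 φ‖ := by
  have h : ‖WithLp.toLp 2 (A *ᵥ φ)‖ ^ 2 = ‖WithLp.toLp 2 φ‖ ^ 2 := by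
    have := norm_toLp_sq (A *ᵥ φ)
    rw [braket_mulVec_mulVec, mul_one, hA, ← norm_toLp_sq] at this
    exact_mod_cast this
  exact (sq_eq_sq₀ (norm_nonneg _) (norm_nonneg _)).1 h

theorem norm_braket_le {m : ℕ} {A : QMatrix m} (hA : star A * A = 1) {φ ψ : QState m}
    (hφ : braket φ 1 φ = 1) (hψ : braket ψ 1 ψ = 1) : ‖braket φ A ψ‖ ≤ 1 := by
  rw [braket_eq_inner]
  refine (norm_inner_le_norm _ _).trans ?_
  rw [norm_toLp_mulVec hA, norm_toLp_eq_one hφ, norm_toLp_eq_one hψ, one_mul]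

theorem star_pauliString_mul_self {m : ℕ} (P : Fin m → Pauli) :
    star (pauliString P) * pauliString P = 1 := by
  rw [star_pauliString, pauliString_mul_self]

/-- If `U` nearly maps `ψ` to `φ`, the expectation value of a Pauli string in `φ` is close to that of
its conjugate in `ψ`. -/
theorem norm_expect_sub_le {m : ℕ} {U : QUnitary m} {φ ψ : QState m} {t d : ℝ}
    (hφ : braket φ 1 φ = 1) (hψ : braket ψ 1 ψ = 1) (ht : t ≤ ‖overlap φ U ψ‖) (hd : 0 ≤ d)
    (htd : 8 * (1 - t) ≤ d ^ 2) {P Q : Fin m → Pauli} {w : ℂ}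
    (hPQ : star (U : QMatrix m) * pauliString P * (U : QMatrix m) = w • pauliString Q) :
    ‖braket φ (pauliString P) φ - w * braket ψ (pauliString Q) ψ‖ ≤ d := by
  have hU : star (U : QMatrix m) * (U : QMatrix m) = 1 := Matrix.UnitaryGroup.star_mul_self U
  have key := norm_inner_map_sub_sq_le (Matrix.toLpLin 2 2 (pauliString P))
    (fun v => le_of_eq ?_) (norm_toLp_eq_one hφ)
    (v := WithLp.toLp 2 ((U : QMatrix m) *ᵥ ψ)) ?_
  · have h1 : inner ℂ (WithLp.toLp 2 φ) (WithLp.toLp 2 ((U : QMatrix m) *ᵥ ψ)) = overlap φ U ψ :=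
      (braket_eq_inner φ U ψ).symm
    rw [h1] at key
    have h2 : ∀ χ : QState m, inner ℂ (WithLp.toLp 2 χ)
        (Matrix.toLpLin 2 2 (pauliString P) (WithLp.toLp 2 χ)) = braket χ (pauliString P) χ :=
      fun χ => (braket_eq_inner χ _ χ).symm
    rw [h2, h2, braket_mulVec_mulVec, hPQ, braket_smul] at key
    refine le_of_sq_le_sq ?_ hd
    linarith
  · exact norm_toLp_mulVec (star_pauliString_mul_self P) v.ofLp
  · rw [norm_toLp_mulVec hU, norm_toLp_eq_one hψ]

/-! ### Clifford unitaries permute Pauli strings -/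

/-- Normalizing the Pauli group gives a string and a phase for every `P`. Conjugation is invertible
and proportional strings are equal, so the map on strings is injective, hence bijective on a finite
set. Bijectivity is what allows sums over all strings to be reindexed. -/
theorem clifford_conj {m : ℕ} {U : QUnitary m} (hU : U ∈ cliffordGroup m) :
    ∃ (L : Equiv.Perm (Fin m → Pauli)) (w : (Fin m → Pauli) → ℂ),
      (∀ P, w P ∈ ({1, -1, Complex.I, -Complex.I} : Set ℂ)) ∧
      ∀ P, star (U : QMatrix m) * pauliString P * (U : QMatrix m) = w P • pauliString (L P) := by
  have hUU : star (U : QMatrix m) * (U : QMatrix m) = 1 := Matrix.UnitaryGroup.star_mul_self U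
  have hUU' : (U : QMatrix m) * star (U : QMatrix m) = 1 := mul_eq_one_comm.1 hUU
  have h : ∀ P : Fin m → Pauli, ∃ Q : Fin m → Pauli,
      ∃ w ∈ ({1, -1, Complex.I, -Complex.I} : Set ℂ),
      star (U : QMatrix m) * pauliString P * (U : QMatrix m) = w • pauliString Q := by
    intro P
    let p : QUnitary m := ⟨pauliString P, Matrix.mem_unitaryGroup_iff'.2
      (star_pauliString_mul_self P)⟩
    have hp : p ∈ pauliGroup m := ⟨1, by simp, P, by simp [p]⟩
    obtain ⟨w, hw, Q, hQ⟩ := (Subgroup.mem_set_normalizer_iff''.1 hU p).1 hp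
    exact ⟨Q, w, hw, hQ⟩
  choose L w hw hL using h
  have hw0 : ∀ P, w P ≠ 0 := by
    intro P
    have := hw P
    simp only [Set.mem_insert_iff, Set.mem_singleton_iff] at this
    rcases this with h | h | h | h <;> simp [h]
  have hback : ∀ P, pauliString P
      = w P • ((U : QMatrix m) * pauliString (L P) * star (U : QMatrix m)) := by
    intro P
    rw [← Matrix.smul_mul, ← Matrix.mul_smul, ← hL]
    calc pauliString P = ((U : QMatrix m) * star (U : QMatrix m)) * pauliString P
          * ((U : QMatrix m) * star (U : QMatrix m)) := by rw [hUU', one_mul, mul_one]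
      _ = _ := by simp only [mul_assoc]
  have hinj : Function.Injective L := by
    intro P P' hPP
    apply pauliString_eq_of_smul (z := w P * (w P')⁻¹)
    rw [hback P, hback P', hPP, smul_smul, inv_mul_cancel_right₀ (hw0 P')]
  exact ⟨Equiv.ofBijective L (Finite.injective_iff_bijective.1 hinj), w, hw, hL⟩

theorem norm_of_mem_phases {w : ℂ} (hw : w ∈ ({1, -1, Complex.I, -Complex.I} : Set ℂ)) :
    ‖w‖ = 1 := by
  simp only [Set.mem_insert_iff, Set.mem_singleton_iff] at hw
  rcases hw with h | h | h | h <;> simp [h]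

/-! ### Pauli spectra -/

/-- This is the identity ∑ A ⊗ A = 2 · SWAP in coordinates; its tensor power gives the completeness
of the Pauli strings. -/
theorem Pauli.sum_toMatrix_mul (a b c d : Bool) :
    ∑ A : Pauli, A.toMatrix a b * A.toMatrix c d = if d = a ∧ c = b then 2 else 0 := by
  rw [Pauli.sum_eq]
  cases a <;> cases b <;> cases c <;> cases d <;> norm_num [Pauli.toMatrix]

theorem sum_pauliString_mul {m : ℕ} (x y z u : Fin m → Bool) :
    ∑ P : Fin m → Pauli, pauliString P x y * pauliString P z u
      = if u = x ∧ z = y then (2 : ℂ) ^ m else 0 := by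
  simp only [pauliString, ← Finset.prod_mul_distrib]
  have := Finset.prod_univ_sum (fun _ : Fin m => (Finset.univ : Finset Pauli))
    (fun j A => A.toMatrix (x j) (y j) * A.toMatrix (z j) (u j))
  rw [Fintype.piFinset_univ] at this
  rw [← this]
  simp only [Pauli.sum_toMatrix_mul, Fintype.prod_ite_zero, Finset.prod_const, Finset.card_univ,
    Fintype.card_fin, funext_iff, forall_and]

/-- The Pauli strings form an orthogonal basis of the space of matrices. -/
theorem sum_expect_mul_expect {m : ℕ} (φ χ : QState m) :
    ∑ P : Fin m → Pauli, braket φ (pauliString P) φ * braket χ (pauliString P) χ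
      = 2 ^ m * (braket φ 1 χ * star (braket φ 1 χ)) := by
  have h : ∀ P : Fin m → Pauli, braket φ (pauliString P) φ * braket χ (pauliString P) χ
      = ∑ x, ∑ z, ∑ y, ∑ u, (star (φ x) * φ y * star (χ z) * χ u) *
        (pauliString P x y * pauliString P z u) := by
    intro P
    simp only [braket_eq_sum, Finset.sum_mul_sum]
    refine Finset.sum_congr rfl fun x _ => Finset.sum_congr rfl fun z _ =>
      Finset.sum_congr rfl fun y _ => Finset.sum_congr rfl fun u _ => by ring
  have hsum : ∀ x z : Fin m → Bool, ∑ y, ∑ u, (star (φ x) * φ y * star (χ z) * χ u) *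
      (if u = x ∧ z = y then (2 : ℂ) ^ m else 0)
      = 2 ^ m * ((star (φ x) * χ x) * (φ z * star (χ z))) := by
    intro x z
    rw [Finset.sum_eq_single z, Finset.sum_eq_single x]
    · simp; ring
    · intro u _ hu; simp [hu]
    · simp
    · intro y _ hy; simp [hy.symm]
    · simp
  have hR : 2 ^ m * (braket φ 1 χ * star (braket φ 1 χ))
      = ∑ x, ∑ z, 2 ^ m * ((star (φ x) * χ x) * (φ z * star (χ z))) := by
    simp only [braket_one, star_sum, star_mul', star_star, Finset.sum_mul_sum, ← Finset.mul_sum]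
  simp only [h, hR]
  rw [Finset.sum_comm]
  refine Finset.sum_congr rfl fun x _ => ?_
  rw [Finset.sum_comm]
  refine Finset.sum_congr rfl fun z _ => ?_
  rw [← hsum, Finset.sum_comm]
  refine Finset.sum_congr rfl fun y _ => ?_
  rw [Finset.sum_comm]
  refine Finset.sum_congr rfl fun u _ => ?_
  rw [← Finset.mul_sum, sum_pauliString_mul]

/-- The overlap of two states is bounded by moments of their Pauli spectra. -/
theorem norm_braket_pow_le {m : ℕ} (φ χ : QState m) :
    (2 ^ m * ‖braket φ 1 χ‖ ^ 2) ^ 4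
      ≤ (∑ P : Fin m → Pauli, ‖braket χ (pauliString P) χ‖) ^ 2
        * ((∑ P : Fin m → Pauli, ‖braket φ (pauliString P) φ‖ ^ 4)
        * ∑ P : Fin m → Pauli, ‖braket χ (pauliString P) χ‖ ^ 2) := by
  set a : (Fin m → Pauli) → ℝ := fun P => ‖braket φ (pauliString P) φ‖ with ha
  set b : (Fin m → Pauli) → ℝ := fun P => ‖braket χ (pauliString P) χ‖ with hb
  have ha0 : ∀ P, 0 ≤ a P := fun P => norm_nonneg _
  have hb0 : ∀ P, 0 ≤ b P := fun P => norm_nonneg _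
  have h1 : 2 ^ m * ‖braket φ 1 χ‖ ^ 2 ≤ ∑ P, a P * b P := by
    have h := congrArg norm (sum_expect_mul_expect φ χ)
    rw [norm_mul, norm_mul, norm_star, norm_pow, Complex.norm_ofNat] at h
    calc _ = 2 ^ m * (‖braket φ 1 χ‖ * ‖braket φ 1 χ‖) := by rw [sq]
      _ ≤ _ := by
        rw [← h]
        refine (norm_sum_le _ _).trans (Finset.sum_le_sum fun P _ => ?_)
        rw [norm_mul]
  -- Cauchy–Schwarz with ab = √b · a√b, and then once more with a²b = a² · b. Only the fourth moment
  -- of `a` and the first two moments of `b` remain.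
  have h2 : (∑ P, a P * b P) ^ 2 ≤ (∑ P, b P) * ∑ P, a P ^ 2 * b P := by
    refine Finset.sum_sq_le_sum_mul_sum_of_sq_le_mul _ (fun P _ => hb0 P)
      (fun P _ => mul_nonneg (sq_nonneg _) (hb0 P)) fun P _ => le_of_eq (by ring)
  have h3 : (∑ P, a P ^ 2 * b P) ^ 2 ≤ (∑ P, a P ^ 4) * ∑ P, b P ^ 2 := by
    refine (Finset.sum_mul_sq_le_sq_mul_sq _ _ _).trans_eq ?_
    congr 1
    exact Finset.sum_congr rfl fun P _ => by ring
  calc (2 ^ m * ‖braket φ 1 χ‖ ^ 2) ^ 4 ≤ (∑ P, a P * b P) ^ 4 := by gcongr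
    _ = ((∑ P, a P * b P) ^ 2) ^ 2 := by ring
    _ ≤ ((∑ P, b P) * ∑ P, a P ^ 2 * b P) ^ 2 := by gcongr
    _ = (∑ P, b P) ^ 2 * (∑ P, a P ^ 2 * b P) ^ 2 := by ring
    _ ≤ (∑ P, b P) ^ 2 * ((∑ P, a P ^ 4) * ∑ P, b P ^ 2) := by gcongr

/-- The case φ = χ of the completeness relation: Pauli strings are Hermitian, so the expectation
values are real and their squares are squared norms. -/
theorem sum_norm_expect_sq {m : ℕ} {χ : QState m} (hχ : braket χ 1 χ = 1) :
    ∑ P : Fin m → Pauli, ‖braket χ (pauliString P) χ‖ ^ 2 = 2 ^ m := by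
  have h := sum_expect_mul_expect χ χ
  rw [hχ, star_one, mul_one, mul_one] at h
  have h1 : ∀ P : Fin m → Pauli, braket χ (pauliString P) χ * braket χ (pauliString P) χ
      = ((‖braket χ (pauliString P) χ‖ ^ 2 : ℝ) : ℂ) := by
    intro P
    have hs := star_braket χ (pauliString P) χ
    rw [star_pauliString] at hs
    nth_rewrite 1 [← hs]
    rw [Complex.star_def, ← Complex.normSq_eq_conj_mul_self, Complex.normSq_eq_norm_sq]
  simp only [h1] at h
  exact_mod_cast h

/-! ### The states `|R⟩` and `|R₋⟩` -/

theorem cos_pi_div_eight_sq : Real.cos (Real.pi / 8) ^ 2 = (2 + √2) / 4 := by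
  rw [Real.cos_pi_div_eight, div_pow, Real.sq_sqrt (by positivity)]; norm_num

theorem sin_pi_div_eight_sq : Real.sin (Real.pi / 8) ^ 2 = (2 - √2) / 4 := by
  rw [Real.sin_sq, cos_pi_div_eight_sq]; ring

theorem sqrt_two_bounds : 1.4142 < √2 ∧ √2 < 1.41422 :=
  ⟨Real.lt_sqrt_of_sq_lt (by norm_num), (Real.sqrt_lt' (by norm_num)).2 (by norm_num)⟩

theorem cos_pi_div_eight_bounds :
    0.9238 < Real.cos (Real.pi / 8) ∧ Real.cos (Real.pi / 8) < 0.9239 := by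
  have h0 : 0 ≤ Real.cos (Real.pi / 8) := by rw [Real.cos_pi_div_eight]; positivity
  have h := cos_pi_div_eight_sq
  obtain ⟨h1, h2⟩ := sqrt_two_bounds
  constructor <;> nlinarith

theorem sin_pi_div_eight_bounds :
    0.3826 < Real.sin (Real.pi / 8) ∧ Real.sin (Real.pi / 8) < 0.3828 := by
  have h0 : 0 ≤ Real.sin (Real.pi / 8) := by rw [Real.sin_pi_div_eight]; positivity
  have h := sin_pi_div_eight_sq
  obtain ⟨h1, h2⟩ := sqrt_two_bounds
  constructor <;> nlinarith

/-- The expectation values `⟨R| A |R⟩` of the Pauli matrices. -/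
noncomputable def Pauli.expectR : Pauli → ℝ
  | .I => 1
  | .X => Real.cos (Real.pi / 8)
  | .Y => Real.sin (Real.pi / 8)
  | .Z => 0

/-- The expectation values `⟨R₋| A |R₋⟩` of the Pauli matrices. -/
noncomputable def Pauli.expectRminus : Pauli → ℝ
  | .I => 1
  | .X => -Real.cos (Real.pi / 8)
  | .Y => -Real.sin (Real.pi / 8)
  | .Z => 0

theorem Pauli.expectR_nonneg (A : Pauli) : 0 ≤ A.expectR := by
  have h1 := cos_pi_div_eight_bounds
  have h2 := sin_pi_div_eight_bounds
  cases A <;> simp only [Pauli.expectR] <;> norm_num at * <;> linarith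

theorem Pauli.expectR_le_cos {A : Pauli} (hA : A ≠ .I) : A.expectR ≤ Real.cos (Real.pi / 8) := by
  have h1 := cos_pi_div_eight_bounds
  have h2 := sin_pi_div_eight_bounds
  cases A <;> simp only [Pauli.expectR] <;> norm_num at * <;> linarith

theorem Pauli.expectR_le_one (A : Pauli) : A.expectR ≤ 1 := by
  by_cases hA : A = .I
  · rw [hA, Pauli.expectR]
  · exact (Pauli.expectR_le_cos hA).trans (Real.cos_le_one _)

theorem exp_pi_div_eight :
    Complex.exp (Complex.I * Real.pi / 8)
      = Real.cos (Real.pi / 8) + Real.sin (Real.pi / 8) * Complex.I := by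
  have : Complex.I * Real.pi / 8 = ((Real.pi / 8 : ℝ) : ℂ) * Complex.I := by push_cast; ring
  rw [this, Complex.exp_mul_I, Complex.ofReal_cos, Complex.ofReal_sin]

theorem ofReal_inv_sqrt_two_sq : ((1 / √2 : ℝ) : ℂ) * ((1 / √2 : ℝ) : ℂ) = 1 / 2 := by
  rw [← Complex.ofReal_mul]
  have : (1 / √2 : ℝ) * (1 / √2) = 1 / 2 := by
    rw [div_mul_div_comm, Real.mul_self_sqrt (by norm_num), one_mul]
  rw [this]; push_cast; rfl

theorem ofReal_cos_sq_add_sin_sq :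
    (Real.cos (Real.pi / 8) : ℂ) ^ 2 + (Real.sin (Real.pi / 8) : ℂ) ^ 2 = 1 := by
  exact_mod_cast Real.cos_sq_add_sin_sq (Real.pi / 8)

/-- The Bloch vector of a qubit state on the equator is (C, S, 0). Stated with general C and S to
serve both |R⟩ and |R₋⟩, which differ by the sign of both coordinates. -/
theorem sum_star_toMatrix_mul {f : Bool → ℂ} {k : ℂ} {C S : ℝ} (hf0 : f false = k)
    (hf1 : f true = k * (C + S * Complex.I)) (hk : (starRingEnd ℂ) k = k) (hkk : k * k = 1 / 2)
    (hcs : (C : ℂ) ^ 2 + (S : ℂ) ^ 2 = 1) (A : Pauli) :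
    ∑ b, star (f b) * (A.toMatrix b (xor b A.xbit) * f (xor b A.xbit))
      = match A with | .I => 1 | .X => (C : ℂ) | .Y => (S : ℂ) | .Z => 0 := by
  have hI := Complex.I_sq
  rw [Fintype.sum_bool]
  cases A <;> simp [Pauli.toMatrix, Pauli.xbit, hf0, hf1, hk]
  · linear_combination 2 * hkk + k * k * hcs - k * k * S ^ 2 * hI
  · linear_combination 2 * C * hkk
  · linear_combination 2 * S * hkk - 2 * k * k * S * hI
  · linear_combination - (k * k * hcs) + k * k * S ^ 2 * hI

theorem expect_ketR (A : Pauli) :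
    ∑ b, star (ketR b) * (A.toMatrix b (xor b A.xbit) * ketR (xor b A.xbit)) = A.expectR := by
  rw [sum_star_toMatrix_mul (k := ((1 / √2 : ℝ) : ℂ)) (C := Real.cos (Real.pi / 8))
    (S := Real.sin (Real.pi / 8)) (by simp [ketR])
    (by rw [ketR, if_pos rfl, exp_pi_div_eight]) (Complex.conj_ofReal _) ofReal_inv_sqrt_two_sq
    ofReal_cos_sq_add_sin_sq]
  cases A <;> simp [Pauli.expectR]

theorem expect_ketRminus (A : Pauli) :
    ∑ b, star (ketRminus b) * (A.toMatrix b (xor b A.xbit) * ketRminus (xor b A.xbit))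
      = A.expectRminus := by
  rw [sum_star_toMatrix_mul (k := ((1 / √2 : ℝ) : ℂ)) (C := -Real.cos (Real.pi / 8))
    (S := -Real.sin (Real.pi / 8)) (by simp [ketRminus])
    (by rw [ketRminus, if_pos rfl, exp_pi_div_eight]; push_cast; ring) (Complex.conj_ofReal _)
    ofReal_inv_sqrt_two_sq (by
      rw [Complex.ofReal_neg, Complex.ofReal_neg, neg_sq, neg_sq]; exact ofReal_cos_sq_add_sin_sq)]
  cases A <;> simp [Pauli.expectRminus]

theorem expect_ketRpow {n : ℕ} (P : Fin n → Pauli) :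
    braket (ketRpow n) (pauliString P) (ketRpow n) = ((∏ j, (P j).expectR : ℝ) : ℂ) := by
  unfold ketRpow
  rw [braket_prod]
  simp only [expect_ketR, Complex.ofReal_prod]

theorem braket_ketRpow_self {n : ℕ} : braket (ketRpow n) 1 (ketRpow n) = 1 := by
  rw [← pauliString_const_I, expect_ketRpow]
  simp [Pauli.expectR]

theorem prod_expectR_nonneg {n : ℕ} (P : Fin n → Pauli) : 0 ≤ ∏ j, (P j).expectR :=
  Finset.prod_nonneg fun j _ => (P j).expectR_nonneg

/-- All factors lie in [0, 1], so any of them may be dropped from an upper bound. -/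
theorem prod_expectR_le {n : ℕ} (P : Fin n → Pauli) (i : Fin n) :
    ∏ j, (P j).expectR ≤ (P i).expectR := by
  rw [← Finset.mul_prod_erase _ _ (Finset.mem_univ i)]
  exact mul_le_of_le_one_right (P i).expectR_nonneg
    (Finset.prod_le_one (fun j _ => (P j).expectR_nonneg) fun j _ => (P j).expectR_le_one)

theorem prod_expectR_le_mul {n : ℕ} (P : Fin n → Pauli) {i j : Fin n} (hij : j ≠ i) :
    ∏ l, (P l).expectR ≤ (P i).expectR * (P j).expectR := by
  rw [← Finset.mul_prod_erase _ _ (Finset.mem_univ i)]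
  refine mul_le_mul_of_nonneg_left ?_ (P i).expectR_nonneg
  rw [← Finset.mul_prod_erase _ _ (Finset.mem_erase.2 ⟨hij, Finset.mem_univ j⟩)]
  exact mul_le_of_le_one_right (P j).expectR_nonneg
    (Finset.prod_le_one (fun j _ => (P j).expectR_nonneg) fun j _ => (P j).expectR_le_one)

/-! ### Clifford unitaries that nearly fix `|R^n⟩` -/

/-- The Pauli string with a single factor different from the identity. -/
def singlePauli {m : ℕ} (j : Fin m) (A : Pauli) : Fin m → Pauli :=
  Function.update (fun _ => .I) j A

@[simp] theorem singlePauli_same {m : ℕ} (j : Fin m) (A : Pauli) : singlePauli j A j = A :=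
  Function.update_self ..

theorem singlePauli_of_ne {m : ℕ} {i j : Fin m} (h : i ≠ j) (A : Pauli) :
    singlePauli j A i = .I :=
  Function.update_of_ne h ..

theorem prod_expectR_singlePauli {m : ℕ} (j : Fin m) (A : Pauli) :
    ∏ l, (singlePauli j A l).expectR = A.expectR := by
  rw [Finset.prod_eq_single j]
  · simp
  · intro i _ hi; rw [singlePauli_of_ne hi, Pauli.expectR]
  · simp

theorem eq_singlePauli {m : ℕ} {P : Fin m → Pauli} {j : Fin m} (h : ∀ i, i ≠ j → P i = .I) :
    P = singlePauli j (P j) := by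
  funext i
  by_cases hi : i = j
  · subst hi; simp
  · rw [h i hi, singlePauli_of_ne hi]

theorem pauliFlip_singlePauli {m : ℕ} (j : Fin m) {A : Pauli} (hA : A.xbit = true)
    (x : Fin m → Bool) : pauliFlip (singlePauli j A) x = Function.update x j (!x j) := by
  funext i
  by_cases hi : i = j
  · subst hi; simp [pauliFlip, hA]
  · simp [pauliFlip, singlePauli_of_ne hi, Function.update_of_ne hi, Pauli.xbit]

theorem pauliPhase_singlePauli {m : ℕ} (j : Fin m) (A : Pauli) (x : Fin m → Bool) :
    pauliPhase (singlePauli j A) x = A.toMatrix (x j) (xor (x j) A.xbit) := by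
  rw [pauliPhase, Finset.prod_eq_single j]
  · simp [pauliFlip]
  · intro i _ hi; simp [pauliFlip, singlePauli_of_ne hi, Pauli.toMatrix, Pauli.xbit]
  · simp

/-- For the phases -1, i and -i the real part of a - wa is 2a, a and a, far above 0.03. -/
theorem eq_one_of_norm_mul_le {w : ℂ} (hw : w ∈ ({1, -1, Complex.I, -Complex.I} : Set ℂ)) {a : ℝ}
    (ha : 0.3 ≤ a) (h : ‖(a : ℂ) - w * a‖ ≤ 0.03) : w = 1 := by
  have hre := (Complex.abs_re_le_norm ((a : ℂ) - w * a)).trans h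
  simp only [Set.mem_insert_iff, Set.mem_singleton_iff] at hw
  rcases hw with rfl | rfl | rfl | rfl
  · rfl
  all_goals
    exfalso
    have := (abs_le.1 hre).2
    norm_num at this
    linarith

theorem le_of_sq_ge {t : ℝ} (ht : 0 ≤ t) (h : 0.9999 ≤ t ^ 2) : 0.99994 ≤ t := by
  nlinarith

/-- Single bit flips connect the hypercube. -/
theorem const_of_update_eq {m : ℕ} {β : Type*} (f : (Fin m → Bool) → β)
    (h : ∀ x j, f (Function.update x j (!x j)) = f x) (x : Fin m → Bool) :
    f x = f fun _ => false := by
  have h' : ∀ x j b, f (Function.update x j b) = f x := by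
    intro x j b
    by_cases hb : b = x j
    · rw [hb, Function.update_eq_self]
    · rw [Bool.eq_not_of_ne hb, h]
  have key : ∀ s : Finset (Fin m), f (s.piecewise x fun _ => false) = f fun _ => false := by
    intro s
    induction s using Finset.induction_on with
    | empty => rw [Finset.piecewise_empty]
    | insert j s _ ih => rw [Finset.piecewise_insert, h', ih]
  simpa using key Finset.univ

/-- A unitary that permutes the single-qubit operators `X_j` and `Y_j` permutes the qubits. -/
theorem eq_smul_qubitPerm {m : ℕ} (U : QUnitary m) (p : Fin m → Fin m)
    (hX : ∀ j, star (U : QMatrix m) * pauliString (singlePauli j .X) * (U : QMatrix m)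
      = pauliString (singlePauli (p j) .X))
    (hY : ∀ j, star (U : QMatrix m) * pauliString (singlePauli j .Y) * (U : QMatrix m)
      = pauliString (singlePauli (p j) .Y)) :
    ∃ σ : Equiv.Perm (Fin m), ∃ c : ℂ, ‖c‖ = 1 ∧ (U : QMatrix m) = c • qubitPerm σ := by
  have hUU : star (U : QMatrix m) * (U : QMatrix m) = 1 := Matrix.UnitaryGroup.star_mul_self U
  have hUU' : (U : QMatrix m) * star (U : QMatrix m) = 1 := mul_eq_one_comm.1 hUU
  have hback : ∀ P Q : Fin m → Pauli, star (U : QMatrix m) * pauliString P * (U : QMatrix m)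
      = pauliString Q → pauliString P * (U : QMatrix m) = (U : QMatrix m) * pauliString Q := by
    intro P Q h
    rw [← h, ← mul_assoc, ← mul_assoc, hUU', one_mul]
  have hcancel : ∀ A : QMatrix m, (U : QMatrix m) * (star (U : QMatrix m) * A * (U : QMatrix m))
      * star (U : QMatrix m) = A := by
    intro A
    calc _ = ((U : QMatrix m) * star (U : QMatrix m)) * A * ((U : QMatrix m) * star (U : QMatrix m))
          := by simp only [mul_assoc]
      _ = A := by rw [hUU', one_mul, mul_one]
  have hp : Function.Injective p := by
    intro i j hij
    have h1 := hX i
    rw [hij, ← hX j] at h1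
    have h2 : pauliString (singlePauli i .X) = pauliString (singlePauli j .X) := by
      rw [← hcancel (pauliString (singlePauli i .X)), h1, hcancel]
    have h3 := pauliString_eq_of_smul (h2.trans (one_smul ℂ _).symm)
    by_contra hne
    have h4 := congrFun h3 i
    rw [singlePauli_same, singlePauli_of_ne hne] at h4
    cases h4
  let π : Equiv.Perm (Fin m) := Equiv.ofBijective p (Finite.injective_iff_bijective.1 hp)
  have hπ : ∀ j, π j = p j := fun j => rfl
  -- The X-relations move a bit flip from the row index to the column index.
  have hflip : ∀ x y j, (U : QMatrix m) (Function.update x j (!x j)) y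
      = (U : QMatrix m) x (Function.update y (p j) (!y (p j))) := by
    intro x y j
    have h := congrFun (congrFun (hback _ _ (hX j)) x) y
    rw [pauliString_mul_apply, mul_pauliString_apply, pauliFlip_singlePauli _ rfl,
      pauliFlip_singlePauli _ rfl, pauliPhase_singlePauli, pauliPhase_singlePauli] at h
    simpa [Pauli.toMatrix, Pauli.xbit] using h
  -- Y makes the same flips as X but with a sign that depends on the bit. Comparing both relations
  -- at a nonzero entry forces the two bits to agree.
  have hsupp : ∀ x y, (U : QMatrix m) x y ≠ 0 → ∀ j, x j = y (p j) := by
    intro x y hxy j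
    have h := congrFun (congrFun (hback _ _ (hY j)) (Function.update x j (!x j))) y
    rw [pauliString_mul_apply, mul_pauliString_apply, pauliFlip_singlePauli _ rfl,
      pauliFlip_singlePauli _ rfl, pauliPhase_singlePauli, pauliPhase_singlePauli,
      ← hflip] at h
    simp only [Function.update_self, Function.update_idem, Bool.not_not,
      Function.update_eq_self] at h
    rw [mul_comm] at h
    have h' := mul_left_cancel₀ hxy h
    by_contra hne
    rw [Bool.eq_not_of_ne hne] at h'
    have hI : Complex.I ≠ -Complex.I := fun h => Complex.I_ne_zero (self_eq_neg.1 h)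
    cases hy : y (p j) <;> rw [hy] at h' <;> simp [Pauli.toMatrix, Pauli.xbit] at h'
    · exact hI h'.symm
    · exact hI h'
  set σ := π.symm with hσ
  have hsupp' : ∀ x y, (U : QMatrix m) x y ≠ 0 → y = x ∘ σ := by
    intro x y hxy
    funext i
    have := hsupp x y hxy (σ i)
    rw [← hπ, hσ, Equiv.apply_symm_apply] at this
    rw [Function.comp_apply, hσ, this]
  -- The matrix is now supported on a permutation matrix, and the flip relation makes its nonzero
  -- entries equal.
  have hconst := const_of_update_eq (fun x => (U : QMatrix m) x (x ∘ σ)) (by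
    intro x j
    have hσp : σ (p j) = j := by rw [hσ, ← hπ, Equiv.symm_apply_apply]
    have hcomp : (Function.update x j (!x j)) ∘ σ
        = Function.update (x ∘ σ) (p j) (!(x ∘ σ) (p j)) := by
      funext i
      by_cases hi : i = p j
      · subst hi; simp [hσp]
      · have : σ i ≠ j := fun h => hi (by rw [← h, hσ, ← hπ, Equiv.apply_symm_apply])
        simp [Function.update_of_ne hi, Function.update_of_ne this]
    simp only [hcomp]
    rw [hflip, Function.update_self, Function.update_idem, Bool.not_not, Function.update_eq_self])
  -- The scalar is the only entry of its row that can be nonzero, so unitarity gives it norm 1.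
  refine ⟨σ, (U : QMatrix m) (fun _ => false) (fun _ => false), ?_, ?_⟩
  · have h := congrFun (congrFun hUU' fun _ => false) fun _ => false
    rw [Matrix.mul_apply, Finset.sum_eq_single (fun _ => false)] at h
    · rw [Matrix.star_apply, Matrix.one_apply_eq, Complex.star_def, Complex.mul_conj,
        Complex.normSq_eq_norm_sq] at h
      exact (pow_eq_one_iff_of_nonneg (norm_nonneg _) two_ne_zero).1 (by exact_mod_cast h)
    · intro y _ hy
      by_cases h0 : (U : QMatrix m) (fun _ => false) y = 0
      · rw [h0, zero_mul]
      · exact absurd (hsupp' _ _ h0) hy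
    · simp
  · ext x y
    rw [Matrix.smul_apply, qubitPerm, smul_eq_mul]
    split_ifs with hy
    · rw [hy, mul_one]; exact hconst x
    · rw [mul_zero]
      by_contra h0
      exact hy (hsupp' x y h0)

/-- A Clifford unitary that nearly fixes `|R^n⟩` permutes the qubits. -/
theorem clifford_eq_qubitPerm {n : ℕ} {U : QUnitary n} (hU : U ∈ cliffordGroup n)
    (h : 0.9999 ≤ ‖overlap (ketRpow n) U (ketRpow n)‖ ^ 2) :
    ∃ σ : Equiv.Perm (Fin n), ∃ c : ℂ, ‖c‖ = 1 ∧ (U : QMatrix n) = c • qubitPerm σ := by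
  obtain ⟨L, w, hw, hL⟩ := clifford_conj hU
  have hclose : ∀ P, ‖((∏ j, (P j).expectR : ℝ) : ℂ) - w P * (∏ j, (L P j).expectR : ℝ)‖ ≤ 0.022 := by
    intro P
    rw [← expect_ketRpow, ← expect_ketRpow]
    -- The tolerance comes from 8 · (1 - 0.99994) = 0.00048 ≤ 0.022² = 0.000484.
    exact norm_expect_sub_le braket_ketRpow_self braket_ketRpow_self
      (le_of_sq_ge (norm_nonneg _) h) (by norm_num) (by norm_num) (hL P)
  have habs : ∀ P, |(∏ j, (P j).expectR) - ∏ j, (L P j).expectR| ≤ 0.022 := by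
    intro P
    have h1 := (abs_norm_sub_norm_le _ _).trans (hclose P)
    rwa [norm_mul, norm_of_mem_phases (hw P), one_mul, Complex.norm_real, Complex.norm_real,
      Real.norm_of_nonneg (prod_expectR_nonneg _), Real.norm_of_nonneg (prod_expectR_nonneg _)] at h1
  have hc := cos_pi_div_eight_bounds
  have hs := sin_pi_div_eight_bounds
  -- By injectivity of `L`, no other string is then sent to the identity, the only string of
  -- expectation value 1.
  have hLI : L (fun _ => .I) = fun _ => .I := by
    have h1 := hL (fun _ => .I)
    rw [pauliString_const_I, mul_one, Matrix.UnitaryGroup.star_mul_self,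
      ← pauliString_const_I] at h1
    exact (pauliString_eq_of_smul h1).symm
  -- When string and image carry the same letter, both expectation values coincide and only the
  -- phase 1 keeps them close.
  have hw1 : ∀ (P : Fin n → Pauli) (j k : Fin n) (A : Pauli), P = singlePauli j A →
      L P = singlePauli k A → 0.3 ≤ A.expectR → w P = 1 := by
    intro P j k A hP hLP hA
    have h1 := hclose P
    rw [hLP, hP, prod_expectR_singlePauli, prod_expectR_singlePauli, ← hP] at h1
    exact eq_one_of_norm_mul_le (hw P) hA (h1.trans (by norm_num))
  -- The image has value at least cos(π/8) - 0.022 > 0.90. A factor Y or Z caps the value at 0.383,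
  -- and two factors other than I cap it at cos²(π/8) < 0.86.
  have hX : ∀ j, ∃ k, L (singlePauli j .X) = singlePauli k .X := by
    intro j
    have h1 := (abs_le.1 (habs (singlePauli j .X))).2
    rw [prod_expectR_singlePauli, Pauli.expectR] at h1
    obtain ⟨k, hk⟩ : ∃ k, L (singlePauli j .X) k ≠ .I := by
      by_contra! hcon
      have : singlePauli j .X = fun _ => Pauli.I := L.injective (by rw [hLI]; funext k; exact hcon k)
      have h2 := congrFun this j
      rw [singlePauli_same] at h2
      cases h2
    have hkX : L (singlePauli j .X) k = .X := by
      have h2 := prod_expectR_le (L (singlePauli j .X)) k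
      cases hA : L (singlePauli j .X) k
      · exact absurd hA hk
      · rfl
      · rw [hA, Pauli.expectR] at h2; exfalso; linarith
      · rw [hA, Pauli.expectR] at h2; exfalso; linarith
    refine ⟨k, ?_⟩
    refine (eq_singlePauli fun i hi => ?_).trans (by rw [hkX])
    by_contra hne
    have h2 := prod_expectR_le_mul (L (singlePauli j .X)) hi
    have h3 := Pauli.expectR_le_cos hne
    rw [hkX, Pauli.expectR] at h2
    nlinarith
  choose p hp using hX
  have hXeq : ∀ j, star (U : QMatrix n) * pauliString (singlePauli j .X) * (U : QMatrix n)
      = pauliString (singlePauli (p j) .X) := by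
    intro j
    rw [hL, hw1 _ j (p j) .X rfl (hp j) (by rw [Pauli.expectR]; linarith), one_smul, hp]
  refine eq_smul_qubitPerm U p hXeq fun j => ?_
  -- The value sin(π/8) alone does not place the image of Y_j on the qubit `p j`; anticommutation
  -- with X_j does.
  have hanti : pauliString (singlePauli j .X) * pauliString (singlePauli j .Y)
      = -(pauliString (singlePauli j .Y) * pauliString (singlePauli j .X)) := by
    ext x y
    rw [Matrix.neg_apply, pauliString_mul_apply, pauliString_mul_apply, pauliString_apply,
      pauliString_apply, pauliPhase_singlePauli, pauliPhase_singlePauli,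
      pauliPhase_singlePauli, pauliPhase_singlePauli]
    simp only [pauliFlip_singlePauli _ (A := .X) rfl, pauliFlip_singlePauli _ (A := .Y) rfl]
    cases x j <;> simp [Pauli.toMatrix, Pauli.xbit] <;> split_ifs <;> simp
  have hUU' : (U : QMatrix n) * star (U : QMatrix n) = 1 :=
    mul_eq_one_comm.1 (Matrix.UnitaryGroup.star_mul_self U)
  have hmulconj : ∀ A B : QMatrix n, star (U : QMatrix n) * (A * B) * (U : QMatrix n)
      = (star (U : QMatrix n) * A * (U : QMatrix n)) * (star (U : QMatrix n) * B * (U : QMatrix n)) := by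
    intro A B
    calc _ = star (U : QMatrix n) * A * (1 : QMatrix n) * B * (U : QMatrix n) := by
          simp only [mul_assoc, one_mul]
      _ = _ := by rw [← hUU']; simp only [mul_assoc]
  have hYk : L (singlePauli j .Y) (p j) = .Y := by
    have h1 := congrArg (fun M => star (U : QMatrix n) * M * (U : QMatrix n)) hanti
    simp only [mul_neg, neg_mul, hmulconj, hXeq, hL (singlePauli j .Y)] at h1
    -- If all factors commuted, the images would both commute and anticommute, so their product
    -- would vanish, although Pauli strings are invertible.
    have hne : ¬ ∀ i, (singlePauli (p j) Pauli.X i).toMatrix * (L (singlePauli j .Y) i).toMatrix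
        = (L (singlePauli j .Y) i).toMatrix * (singlePauli (p j) Pauli.X i).toMatrix := by
      intro hcomm
      have h2 := pauliString_commute hcomm
      rw [Matrix.mul_smul, Matrix.smul_mul, h2] at h1
      replace h1 := Matrix.ext fun x y => self_eq_neg.1 (congrFun (congrFun h1 x) y)
      replace h1 : w (singlePauli j .Y) • (pauliString (L (singlePauli j .Y)) *
        pauliString (singlePauli (p j) .X)) = 0 := h1
      rw [smul_eq_zero] at h1
      rcases h1 with h1 | h1
      · have := norm_of_mem_phases (hw (singlePauli j .Y))
        rw [h1, norm_zero] at this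
        exact zero_ne_one this
      · have h3 : (1 : QMatrix n) = 0 := by
          calc (1 : QMatrix n) = pauliString (L (singlePauli j .Y)) *
                (pauliString (L (singlePauli j .Y)) * pauliString (singlePauli (p j) .X))
                * pauliString (singlePauli (p j) .X) := by
                rw [← mul_assoc, pauliString_mul_self, one_mul, pauliString_mul_self]
            _ = 0 := by rw [h1, mul_zero, zero_mul]
        exact one_ne_zero h3
    have h4 := (abs_le.1 (habs (singlePauli j .Y))).2
    rw [prod_expectR_singlePauli, Pauli.expectR] at h4
    have h5 := prod_expectR_le (L (singlePauli j .Y)) (p j)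
    have hIone : Pauli.I.toMatrix = 1 := by ext a b; simp [Pauli.toMatrix, Matrix.one_apply]
    have hcommI : (L (singlePauli j .Y) (p j) = .I ∨ L (singlePauli j .Y) (p j) = .X) → False := by
      intro hor
      apply hne
      intro i
      by_cases hi : i = p j
      · subst hi
        rcases hor with h | h <;> rw [h, singlePauli_same]
        rw [hIone, mul_one, one_mul]
      · rw [singlePauli_of_ne hi, hIone, mul_one, one_mul]
    cases hA : L (singlePauli j .Y) (p j)
    · exact (hcommI (.inl hA)).elim
    · exact (hcommI (.inr hA)).elim
    · rfl
    · rw [hA, Pauli.expectR] at h5; exfalso; linarith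
  -- A further factor would cap the value at sin(π/8)cos(π/8) < 0.354, below sin(π/8) - 0.022 >
  -- 0.360. This is the narrowest gap in the argument.
  have hYeq : L (singlePauli j .Y) = singlePauli (p j) .Y := by
    refine (eq_singlePauli fun i hi => ?_).trans (by rw [hYk])
    by_contra hne
    have h2 := prod_expectR_le_mul (L (singlePauli j .Y)) hi
    have h3 := Pauli.expectR_le_cos hne
    have h4 := (abs_le.1 (habs (singlePauli j .Y))).2
    rw [prod_expectR_singlePauli, Pauli.expectR] at h4
    rw [hYk, Pauli.expectR] at h2
    nlinarith
  rw [hL, hw1 _ j (p j) .Y rfl hYeq (by rw [Pauli.expectR]; linarith), one_smul, hYeq]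

/-! ### Tensor products with a control qubit -/

/-- The product of a one-qubit state and an `n`-qubit state. -/
noncomputable def tensorState {n : ℕ} (a : Bool → ℂ) (φ : QState n) : QState (n + 1) :=
  fun x => a (x 0) * φ (Fin.tail x)

theorem sum_fin_succ {α : Type*} [Fintype α] {M : Type*} [AddCommMonoid M] {n : ℕ}
    (F : (Fin (n + 1) → α) → M) : ∑ x, F x = ∑ a, ∑ y, F (Fin.cons a y) := by
  rw [← Fintype.sum_prod_type', ← (Fin.consEquiv fun _ : Fin (n + 1) => α).sum_comp]
  rfl

theorem braket_tensorState {n : ℕ} (a b : Bool → ℂ) (φ ψ : QState n) (P : Fin (n + 1) → Pauli) :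
    braket (tensorState a φ) (pauliString P) (tensorState b ψ)
      = (∑ u, star (a u) * ((P 0).toMatrix u (xor u (P 0).xbit) * b (xor u (P 0).xbit)))
        * braket φ (pauliString (Fin.tail P)) ψ := by
  rw [braket_pauliString, braket_pauliString, sum_fin_succ, Finset.sum_mul_sum]
  refine Finset.sum_congr rfl fun u _ => Finset.sum_congr rfl fun y _ => ?_
  have h1 : Fin.tail (pauliFlip P (Fin.cons u y)) = pauliFlip (Fin.tail P) y := by
    funext j; simp [pauliFlip, Fin.tail]
  have h2 : pauliPhase P (Fin.cons u y)
      = (P 0).toMatrix u (xor u (P 0).xbit) * pauliPhase (Fin.tail P) y := by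
    rw [pauliPhase, Fin.prod_univ_succ]
    simp [pauliPhase, pauliFlip, Fin.tail]
  simp only [tensorState, h1, h2, Fin.cons_zero, Fin.tail_cons, star_mul']
  simp only [pauliFlip, Fin.cons_zero]
  ring

theorem ketRpow_succ (n : ℕ) : ketRpow (n + 1) = tensorState ketR (ketRpow n) := by
  funext x
  simp only [ketRpow, tensorState, Fin.prod_univ_succ, Fin.tail]

/-! ### Graph states -/

open Classical in
/-- The sign `(-1)^e` where `e` is the number of edges inside the set `x`. -/
noncomputable def graphSign {n : ℕ} (G : SimpleGraph (Fin n)) (x : Fin n → Bool) : ℂ :=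
  ∏ i, ∏ j, if i < j ∧ G.Adj i j ∧ x i = true ∧ x j = true then -1 else 1

open Classical in
/-- The sign `(-1)^d` where `d` is the number of neighbours of `j` in the set `x`. -/
noncomputable def degreeSign {n : ℕ} (G : SimpleGraph (Fin n)) (x : Fin n → Bool) (j : Fin n) : ℂ :=
  ∏ i, if G.Adj j i ∧ x i = true then -1 else 1

theorem graphState_eq {n : ℕ} (G : SimpleGraph (Fin n)) (x : Fin n → Bool) :
    graphState G x = ((1 / √2 : ℝ) : ℂ) ^ n * graphSign G x := rfl

theorem prod_mem_signs {ι : Type*} (s : Finset ι) (f : ι → ℂ) (h : ∀ i, f i = 1 ∨ f i = -1) :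
    ∏ i ∈ s, f i = 1 ∨ ∏ i ∈ s, f i = -1 := by
  induction s using Finset.cons_induction with
  | empty => simp
  | cons a s ha ih =>
    rw [Finset.prod_cons]
    rcases h a with h1 | h1 <;> rcases ih with h2 | h2 <;> simp [h1, h2]

theorem graphSign_mem {n : ℕ} (G : SimpleGraph (Fin n)) (x : Fin n → Bool) :
    graphSign G x = 1 ∨ graphSign G x = -1 :=
  prod_mem_signs _ _ fun i => prod_mem_signs _ _ fun j => by split_ifs <;> simp

theorem degreeSign_mem {n : ℕ} (G : SimpleGraph (Fin n)) (x : Fin n → Bool) (j : Fin n) :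
    degreeSign G x j = 1 ∨ degreeSign G x j = -1 :=
  prod_mem_signs _ _ fun i => by split_ifs <;> simp

theorem graphSign_mul_self {n : ℕ} (G : SimpleGraph (Fin n)) (x : Fin n → Bool) :
    graphSign G x * graphSign G x = 1 := by
  rcases graphSign_mem G x with h | h <;> simp [h]

theorem star_graphSign {n : ℕ} (G : SimpleGraph (Fin n)) (x : Fin n → Bool) :
    star (graphSign G x) = graphSign G x := by
  rcases graphSign_mem G x with h | h <;> simp [h]

theorem norm_graphSign {n : ℕ} (G : SimpleGraph (Fin n)) (x : Fin n → Bool) :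
    ‖graphSign G x‖ = 1 := by
  rcases graphSign_mem G x with h | h <;> simp [h]

/-- The quadratic expansion of the sign of a symmetric difference. -/
theorem graphSign_xor {n : ℕ} (G : SimpleGraph (Fin n)) (x y : Fin n → Bool) :
    graphSign G (fun j => xor (x j) (y j))
      = graphSign G x * graphSign G y * ∏ j, if x j = true then degreeSign G y j else 1 := by
  classical
  -- Parity of edges is quadratic in the vertex set. The cross terms come from edges with one end in
  -- `x` and the other in `y`, in both orientations; swapping the indices in one product merges them
  -- into degree signs.
  have h1 : graphSign G (fun j => xor (x j) (y j))
      = graphSign G x * graphSign G y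
        * ((∏ i, ∏ j, if i < j ∧ G.Adj i j ∧ x i = true ∧ y j = true then (-1 : ℂ) else 1)
        * ∏ i, ∏ j, if i < j ∧ G.Adj i j ∧ y i = true ∧ x j = true then (-1 : ℂ) else 1) := by
    simp only [graphSign, ← Finset.prod_mul_distrib]
    refine Finset.prod_congr rfl fun i _ => Finset.prod_congr rfl fun j _ => ?_
    by_cases hij : i < j ∧ G.Adj i j
    · simp only [hij.1, hij.2, true_and]
      cases x i <;> cases x j <;> cases y i <;> cases y j <;> simp
    · have : ∀ p : Prop, ¬ (i < j ∧ G.Adj i j ∧ p) := fun p h => hij ⟨h.1, h.2.1⟩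
      simp [this]
  rw [h1]
  congr 1
  rw [Finset.prod_comm (f := fun i j =>
    if i < j ∧ G.Adj i j ∧ y i = true ∧ x j = true then (-1 : ℂ) else 1)]
  simp only [← Finset.prod_mul_distrib]
  refine Finset.prod_congr rfl fun i _ => ?_
  by_cases hx : x i = true
  · rw [if_pos hx, degreeSign]
    refine Finset.prod_congr rfl fun j _ => ?_
    rcases lt_trichotomy i j with h | h | h
    · simp [h, h.not_gt, hx]
    · subst h; simp
    · simp [h, h.not_gt, hx, G.adj_comm j i]
  · simp [hx]

/-- The two nonzero entries of `A` are equal or opposite according to `zbit`. Weighted by 1 and `k`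
they add up when the sign patterns agree and cancel otherwise. -/
theorem norm_sum_toMatrix_mul (A : Pauli) {k : ℂ} (hk : k = 1 ∨ k = -1) :
    ‖∑ b, A.toMatrix b (xor b A.xbit) * (if b = true then k else 1)‖
      = 2 * if A.zbit = true ↔ k = -1 then 1 else 0 := by
  have h1 : (1 : ℂ) ≠ -1 := by norm_num
  rw [Fintype.sum_bool]
  rcases hk with rfl | rfl <;> cases A <;>
    norm_num [Pauli.toMatrix, Pauli.xbit, Pauli.zbit, h1, ← two_mul, ← sub_eq_add_neg]

/-- Pauli strings stabilize a graph state up to sign, or have expectation value zero in it. -/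
theorem norm_expect_graphState {n : ℕ} (G : SimpleGraph (Fin n)) (P : Fin n → Pauli)
    [Decidable (∀ j, (P j).zbit = true ↔ degreeSign G (fun l => (P l).xbit) j = -1)] :
    ‖braket (graphState G) (pauliString P) (graphState G)‖
      = if ∀ j, (P j).zbit = true ↔ degreeSign G (fun l => (P l).xbit) j = -1 then 1 else 0 := by
  classical
  -- The sign of `x` cancels against that of its flip, up to degree signs and a constant. What
  -- remains is a product over qubits, so the sum over `x` factors.
  have h : braket (graphState G) (pauliString P) (graphState G)
      = (1 / 2) ^ n * graphSign G (fun l => (P l).xbit) *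
        ∏ j, ∑ b, (P j).toMatrix b (xor b (P j).xbit) *
          (if b = true then degreeSign G (fun l => (P l).xbit) j else 1) := by
    rw [braket_pauliString, ← sum_prod_bits, Finset.mul_sum]
    refine Finset.sum_congr rfl fun x _ => ?_
    have hf : graphSign G (pauliFlip P x) = _ := graphSign_xor G x fun l => (P l).xbit
    rw [graphState_eq, graphState_eq, hf, star_mul', star_graphSign, star_pow, Complex.star_def,
      Complex.conj_ofReal, Finset.prod_mul_distrib, pauliPhase, ← ofReal_inv_sqrt_two_sq, mul_pow]
    simp only [pauliFlip]
    linear_combination (((1 / √2 : ℝ) : ℂ) ^ n * ((1 / √2 : ℝ) : ℂ) ^ n *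
      graphSign G (fun l => (P l).xbit) * (∏ j, (P j).toMatrix (x j) (xor (x j) (P j).xbit)) *
      ∏ j, if x j = true then degreeSign G (fun l => (P l).xbit) j else 1) * graphSign_mul_self G x
  rw [h, norm_mul, norm_mul, norm_graphSign, mul_one, norm_prod]
  simp only [norm_sum_toMatrix_mul _ (degreeSign_mem G _ _), Finset.prod_mul_distrib]
  rw [Finset.prod_const, Finset.card_univ, Fintype.card_fin, ← mul_assoc, norm_pow, ← mul_pow]
  norm_num
  rw [Fintype.prod_ite_zero]
  simp

theorem braket_graphState_self {n : ℕ} (G : SimpleGraph (Fin n)) :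
    braket (graphState G) 1 (graphState G) = 1 := by
  rw [braket_one]
  have : ∀ x, star (graphState G x) * graphState G x = (1 / 2) ^ n := by
    intro x
    rw [graphState_eq, star_mul', star_graphSign, star_pow, Complex.star_def, Complex.conj_ofReal,
      ← ofReal_inv_sqrt_two_sq, mul_pow]
    linear_combination (((1 / √2 : ℝ) : ℂ) ^ n * ((1 / √2 : ℝ) : ℂ) ^ n) * graphSign_mul_self G x
  rw [Finset.sum_congr rfl fun x _ => this x]
  simp

/-- A string with nonzero expectation has its Z-part forced by its X-part through the degree signs,
so there are at most as many such strings as X-parts. -/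
theorem sum_norm_expect_graphState_le {n : ℕ} (G : SimpleGraph (Fin n)) :
    ∑ P : Fin n → Pauli, ‖braket (graphState G) (pauliString P) (graphState G)‖ ≤ 2 ^ n := by
  classical
  simp only [norm_expect_graphState]
  rw [Finset.sum_boole]
  have h : (Finset.univ.filter fun P : Fin n → Pauli =>
      ∀ j, (P j).zbit = true ↔ degreeSign G (fun l => (P l).xbit) j = -1).card
      ≤ (Finset.univ : Finset (Fin n → Bool)).card := by
    refine Finset.card_le_card_of_injOn (fun P l => (P l).xbit) (fun _ _ => Finset.mem_univ _) ?_
    intro P hP Q hQ hPQ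
    simp only [Finset.coe_filter, Finset.mem_univ, true_and, Set.mem_ofPred_eq] at hP hQ hPQ
    funext j
    have hx : (P j).xbit = (Q j).xbit := congrFun hPQ j
    have hz : (P j).zbit = (Q j).zbit := by
      have h1 := hP j
      rw [hPQ] at h1
      exact Bool.eq_iff_iff.2 (h1.trans (hQ j).symm)
    revert hx hz
    cases P j <;> cases Q j <;> simp [Pauli.xbit, Pauli.zbit]
  simp only [Finset.card_univ, Fintype.card_pi, Fintype.card_bool, Finset.prod_const,
    Fintype.card_fin] at h
  exact_mod_cast h

/-! ### Moments of the Pauli spectra and smallness of the cross terms -/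

/-- The state `|R₋⟩ |G⟩`. -/
noncomputable def markedGraphState {n : ℕ} (G : SimpleGraph (Fin n)) : QState (n + 1) :=
  tensorState ketRminus (graphState G)

theorem expect_markedGraphState {n : ℕ} (G : SimpleGraph (Fin n)) (P : Fin (n + 1) → Pauli) :
    braket (markedGraphState G) (pauliString P) (markedGraphState G)
      = (P 0).expectRminus * braket (graphState G) (pauliString (Fin.tail P)) (graphState G) := by
  rw [markedGraphState, braket_tensorState, expect_ketRminus]

theorem braket_markedGraphState_self {n : ℕ} (G : SimpleGraph (Fin n)) :
    braket (markedGraphState G) 1 (markedGraphState G) = 1 := by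
  rw [← pauliString_const_I, expect_markedGraphState]
  have : Fin.tail (fun _ : Fin (n + 1) => Pauli.I) = fun _ => Pauli.I := rfl
  rw [this, pauliString_const_I, braket_graphState_self]
  simp [Pauli.expectRminus]

/-- The sum factors over control and target, and the control contributes 1 + cos(π/8) + sin(π/8) <
2.4. -/
theorem sum_norm_expect_markedGraphState_le {n : ℕ} (G : SimpleGraph (Fin n)) :
    ∑ P : Fin (n + 1) → Pauli, ‖braket (markedGraphState G) (pauliString P) (markedGraphState G)‖
      ≤ 1.2 * 2 ^ (n + 1) := by
  have hc := cos_pi_div_eight_bounds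
  have hs := sin_pi_div_eight_bounds
  simp only [expect_markedGraphState, norm_mul]
  rw [sum_fin_succ]
  simp only [Fin.cons_zero, Fin.tail_cons]
  rw [← Finset.sum_mul_sum, Pauli.sum_eq]
  simp only [Pauli.expectRminus, Complex.norm_real, Real.norm_eq_abs, abs_neg, abs_one, abs_zero]
  rw [abs_of_nonneg (by linarith), abs_of_nonneg (by linarith)]
  have h := sum_norm_expect_graphState_le G
  have h2 : (0 : ℝ) < 2 ^ n := by positivity
  rw [pow_succ]
  have h0 : 0 ≤ ∑ P : Fin n → Pauli, ‖braket (graphState G) (pauliString P) (graphState G)‖ :=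
    Finset.sum_nonneg fun _ _ => norm_nonneg _
  nlinarith

/-- Each qubit contributes 1 + cos⁴(π/8) + sin⁴(π/8) = 7/4. That this is less than 2 is the source
of the exponential decay of the cross terms. -/
theorem sum_norm_expect_ketRpow {n : ℕ} :
    ∑ P : Fin n → Pauli, ‖braket (ketRpow n) (pauliString P) (ketRpow n)‖ ^ 4 = 1.75 ^ n := by
  have h1 : ∀ P : Fin n → Pauli, ‖braket (ketRpow n) (pauliString P) (ketRpow n)‖ ^ 4
      = ∏ j, (P j).expectR ^ 4 := by
    intro P
    rw [expect_ketRpow, Complex.norm_real, Real.norm_of_nonneg (prod_expectR_nonneg _),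
      Finset.prod_pow]
  have h2 := Finset.prod_univ_sum (fun _ : Fin n => (Finset.univ : Finset Pauli))
    (fun _ A => A.expectR ^ 4)
  rw [Fintype.piFinset_univ] at h2
  simp only [h1]
  rw [← h2, Finset.prod_const, Finset.card_univ, Fintype.card_fin, Pauli.sum_eq]
  congr 1
  simp only [Pauli.expectR]
  have hc := cos_pi_div_eight_sq
  have hs := sin_pi_div_eight_sq
  have h3 : √2 ^ 2 = 2 := Real.sq_sqrt (by norm_num)
  calc _ = 1 + (Real.cos (Real.pi / 8) ^ 2) ^ 2 + (Real.sin (Real.pi / 8) ^ 2) ^ 2 := by ring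
    _ = 1.75 := by rw [hc, hs]; linear_combination (1 / 8 : ℝ) * h3

theorem overlap_eq_braket {m : ℕ} (φ : QState m) (U : QUnitary m) (ψ : QState m) :
    overlap φ U ψ = braket φ U ψ := rfl

/-- A Clifford unitary maps `|R₋⟩ |G⟩` to a state nearly orthogonal to `|R^{n+1}⟩`. -/
theorem norm_overlap_markedGraphState_le {n : ℕ} (hn : 1000 ≤ n) (G : SimpleGraph (Fin n))
    {U : QUnitary (n + 1)} (hU : U ∈ cliffordGroup (n + 1)) :
    ‖overlap (ketRpow (n + 1)) U (markedGraphState G)‖ ≤ 0.00001 := by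
  obtain ⟨L, w, hw, hL⟩ := clifford_conj hU
  set χ := (U : QMatrix (n + 1)) *ᵥ markedGraphState G with hχ
  set t := ‖overlap (ketRpow (n + 1)) U (markedGraphState G)‖ with ht
  have ht' : t = ‖braket (ketRpow (n + 1)) 1 χ‖ := by
    rw [ht, overlap, braket, Matrix.one_mulVec]
  have hE : ∀ P, ‖braket χ (pauliString P) χ‖
      = ‖braket (markedGraphState G) (pauliString (L P)) (markedGraphState G)‖ := by
    intro P
    rw [hχ, braket_mulVec_mulVec, hL, braket_smul, norm_mul, norm_of_mem_phases (hw P), one_mul]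
  have hχ1 : braket χ 1 χ = 1 := by
    rw [hχ, braket_mulVec_mulVec, mul_one, Matrix.UnitaryGroup.star_mul_self,
      braket_markedGraphState_self]
  have hsum : ∑ P, ‖braket χ (pauliString P) χ‖ ≤ 1.2 * 2 ^ (n + 1) := by
    simp only [hE]
    rw [Equiv.sum_comp L fun P =>
      ‖braket (markedGraphState G) (pauliString P) (markedGraphState G)‖]
    exact sum_norm_expect_markedGraphState_le G
  have key := norm_braket_pow_le (ketRpow (n + 1)) χ
  rw [sum_norm_expect_sq hχ1, sum_norm_expect_ketRpow, ← ht'] at key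
  have hs0 : 0 ≤ ∑ P, ‖braket χ (pauliString P) χ‖ := Finset.sum_nonneg fun _ _ => norm_nonneg _
  have h1 : (2 ^ (n + 1) * t ^ 2) ^ 4
      ≤ (1.2 * 2 ^ (n + 1)) ^ 2 * (1.75 ^ (n + 1) * 2 ^ (n + 1)) :=
    key.trans (mul_le_mul_of_nonneg_right (pow_le_pow_left₀ hs0 hsum 2) (by positivity))
  -- All powers of two cancel against the left side, and (7/8)^{n+1} is left.
  have h2 : (1.2 * 2 ^ (n + 1)) ^ 2 * (1.75 ^ (n + 1) * 2 ^ (n + 1))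
      = (2 ^ (n + 1)) ^ 4 * (1.44 * (0.875 : ℝ) ^ (n + 1)) := by
    have h175 : (1.75 : ℝ) ^ (n + 1) = 2 ^ (n + 1) * 0.875 ^ (n + 1) := by
      rw [← mul_pow]; norm_num
    rw [h175]
    generalize (2 : ℝ) ^ (n + 1) = a
    generalize (0.875 : ℝ) ^ (n + 1) = b
    ring
  rw [h2, mul_pow] at h1
  have h3 : (t ^ 2) ^ 4 ≤ 1.44 * (0.875 : ℝ) ^ (n + 1) :=
    le_of_mul_le_mul_left h1 (by positivity)
  have h4 : (0.875 : ℝ) ^ (n + 1) ≤ 0.875 ^ 1000 :=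
    pow_le_pow_of_le_one (by norm_num) (by norm_num) (by omega)
  -- The eighth power of the target bound is 10^{-40}. Since 0.875^20 < 1/10, the threshold 1000
  -- leaves ample room.
  have h5 : (0.875 : ℝ) ^ 1000 ≤ 1 / 10 ^ 50 := by
    calc (0.875 : ℝ) ^ 1000 = (0.875 ^ 20) ^ 50 := by rw [← pow_mul]
      _ ≤ (1 / 10) ^ 50 := by gcongr; norm_num
      _ = 1 / 10 ^ 50 := by rw [div_pow, one_pow]
  have h6 : t ^ 8 ≤ (0.00001 : ℝ) ^ 8 := by
    calc t ^ 8 = (t ^ 2) ^ 4 := by ring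
      _ ≤ 1.44 * (1 / 10 ^ 50) :=
        h3.trans (mul_le_mul_of_nonneg_left (h4.trans h5) (by norm_num))
      _ ≤ (0.00001 : ℝ) ^ 8 := by norm_num
  exact le_of_pow_le_pow_left₀ (by norm_num) (by norm_num) h6

/-! ### Qubit permutations are Clifford unitaries -/

theorem qubitPerm_mulVec {m : ℕ} (σ : Equiv.Perm (Fin m)) (φ : QState m) (x : Fin m → Bool) :
    (qubitPerm σ *ᵥ φ) x = φ (x ∘ σ) := by
  simp [Matrix.mulVec, dotProduct, qubitPerm]

theorem qubitPerm_mul {m : ℕ} (σ τ : Equiv.Perm (Fin m)) :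
    qubitPerm σ * qubitPerm τ = qubitPerm (σ * τ) := by
  ext x y
  rw [Matrix.mul_apply, Finset.sum_eq_single (x ∘ σ)]
  · simp only [qubitPerm, if_true, one_mul, Equiv.Perm.coe_mul, Function.comp_assoc]
    congr
  · intro z _ hz; simp [qubitPerm, hz]
  · simp

theorem qubitPerm_one {m : ℕ} : qubitPerm (1 : Equiv.Perm (Fin m)) = 1 := by
  ext x y
  simp [qubitPerm, Matrix.one_apply, eq_comm]

theorem star_qubitPerm {m : ℕ} (σ : Equiv.Perm (Fin m)) : star (qubitPerm σ) = qubitPerm σ⁻¹ := by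
  ext x y
  have h : x = y ∘ σ ↔ y = x ∘ ⇑σ⁻¹ := by
    constructor
    · rintro rfl; funext i; simp
    · rintro rfl; funext i; simp
  simp only [Matrix.star_apply, qubitPerm, h]
  split_ifs <;> simp

/-- The representation of the symmetric group by qubit permutations. -/
noncomputable def qubitPermHom (m : ℕ) : Equiv.Perm (Fin m) →* QUnitary m where
  toFun σ := ⟨qubitPerm σ, Matrix.mem_unitaryGroup_iff'.2 (by
    rw [star_qubitPerm, qubitPerm_mul, inv_mul_cancel, qubitPerm_one])⟩
  map_one' := Subtype.ext qubitPerm_one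
  map_mul' σ τ := Subtype.ext (qubitPerm_mul σ τ).symm

theorem pauliString_mul_qubitPerm {m : ℕ} (P : Fin m → Pauli) (σ : Equiv.Perm (Fin m)) :
    pauliString P * qubitPerm σ = qubitPerm σ * pauliString (P ∘ σ) := by
  ext x y
  have hz : ∀ z : Fin m → Bool, y = z ∘ σ ↔ z = y ∘ σ.symm := by
    intro z
    constructor
    · rintro rfl; funext i; simp
    · rintro rfl; funext i; simp
  simp only [Matrix.mul_apply, qubitPerm, hz, mul_ite, mul_one, mul_zero, ite_mul, one_mul,
    zero_mul, Finset.sum_ite_eq', Finset.mem_univ, if_true]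
  rw [pauliString, pauliString, ← Equiv.prod_comp σ]
  simp

theorem conj_smul_qubitPerm {m : ℕ} {U : QMatrix m} {c : ℂ} (hc : ‖c‖ = 1)
    {σ : Equiv.Perm (Fin m)} (hU : U = c • qubitPerm σ) (P : Fin m → Pauli) :
    star U * pauliString P * U = (1 : ℂ) • pauliString (P ∘ σ) := by
  have hcc : star c * c = 1 := by
    rw [Complex.star_def, ← Complex.normSq_eq_conj_mul_self, Complex.normSq_eq_norm_sq, hc]; simp
  rw [hU, star_smul, Matrix.mul_smul, Matrix.smul_mul, Matrix.smul_mul, smul_smul, mul_comm c, hcc,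
    mul_assoc, pauliString_mul_qubitPerm, ← mul_assoc, star_qubitPerm, qubitPerm_mul,
    inv_mul_cancel, qubitPerm_one, one_mul]

theorem qubitPermHom_mem_cliffordGroup {m : ℕ} (σ : Equiv.Perm (Fin m)) :
    qubitPermHom m σ ∈ cliffordGroup m := by
  -- For a whole subgroup it is enough to check that conjugation maps the Pauli group into itself,
  -- because inverses are covered as well.
  suffices h : (qubitPermHom m).range ≤ cliffordGroup m from h ⟨σ, rfl⟩
  refine Subgroup.le_set_normalizer_iff.2 ?_
  rintro _ ⟨τ, rfl⟩ g ⟨w, hw, P, hP⟩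
  refine ⟨w, hw, P ∘ ⇑τ⁻¹, ?_⟩
  rw [← map_inv]
  change qubitPerm τ * (g : QMatrix m) * qubitPerm τ⁻¹ = _
  rw [hP, Matrix.mul_smul, Matrix.smul_mul, mul_assoc, pauliString_mul_qubitPerm, ← mul_assoc,
    qubitPerm_mul, mul_inv_cancel, qubitPerm_one, one_mul]

/-! ### Isomorphic graphs -/

theorem graphSign_comp_iso {n : ℕ} {G₁ G₂ : SimpleGraph (Fin n)} (e : G₁ ≃g G₂)
    (x : Fin n → Bool) : graphSign G₂ (x ∘ e.symm) = graphSign G₁ x := by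
  classical
  -- An isomorphism need not preserve the order that selects one orientation of each edge. The
  -- product is the same for the orientation induced by any injective `f`.
  have h1 : ∀ G : SimpleGraph (Fin n), ∀ f : Fin n → Fin n, Function.Injective f → graphSign G x
      = ∏ i, ∏ j, if f i < f j ∧ G.Adj i j ∧ x i = true ∧ x j = true then (-1 : ℂ) else 1 := by
    intro G f hf
    have hsplit : (∏ i, ∏ j, if f i < f j ∧ G.Adj i j ∧ x i = true ∧ x j = true then (-1 : ℂ) else 1)
        = (∏ i, ∏ j, if f i < f j ∧ i < j ∧ G.Adj i j ∧ x i = true ∧ x j = true then (-1 : ℂ) else 1)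
        * ∏ i, ∏ j, if f i < f j ∧ j < i ∧ G.Adj i j ∧ x i = true ∧ x j = true then (-1 : ℂ)
          else 1 := by
      simp only [← Finset.prod_mul_distrib]
      refine Finset.prod_congr rfl fun i _ => Finset.prod_congr rfl fun j _ => ?_
      rcases lt_trichotomy i j with h | h | h
      · simp [h, h.not_gt]
      · subst h; simp
      · simp [h, h.not_gt]
    rw [hsplit, Finset.prod_comm (f := fun i j =>
      if f i < f j ∧ j < i ∧ G.Adj i j ∧ x i = true ∧ x j = true then (-1 : ℂ) else 1)]
    simp only [graphSign, ← Finset.prod_mul_distrib]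
    refine Finset.prod_congr rfl fun i _ => Finset.prod_congr rfl fun j _ => ?_
    rcases lt_trichotomy (f i) (f j) with h | h | h
    · simp [h, h.not_gt]
    · have := hf h; subst this; simp
    · simp only [h, h.not_gt, true_and, false_and, if_false, one_mul, G.adj_comm j i]
      congr 1
      simp only [eq_iff_iff]
      tauto
  rw [h1 G₁ e e.injective, graphSign, ← Equiv.prod_comp e.toEquiv]
  refine Finset.prod_congr rfl fun i _ => ?_
  rw [← Equiv.prod_comp e.toEquiv]
  refine Finset.prod_congr rfl fun j _ => ?_
  simp [e.map_adj_iff]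

theorem controlledGraphState_eq {n : ℕ} (G : SimpleGraph (Fin n)) :
    controlledGraphState G
      = ((1 / √2 : ℝ) : ℂ) • (ketRpow (n + 1) + markedGraphState G) := by
  funext x
  rw [ketRpow_succ]
  rfl

theorem overlap_controlledGraphState {n : ℕ} (G₁ G₂ : SimpleGraph (Fin n)) (A : QMatrix (n + 1)) :
    braket (controlledGraphState G₁) A (controlledGraphState G₂)
      = (1 / 2) * (braket (ketRpow (n + 1)) A (ketRpow (n + 1))
        + braket (ketRpow (n + 1)) A (markedGraphState G₂)
        + braket (markedGraphState G₁) A (ketRpow (n + 1))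
        + braket (markedGraphState G₁) A (markedGraphState G₂)) := by
  rw [controlledGraphState_eq, controlledGraphState_eq, ← ofReal_inv_sqrt_two_sq]
  simp only [braket, star_smul, star_add, smul_dotProduct, add_dotProduct, Matrix.mulVec_smul,
    Matrix.mulVec_add, dotProduct_smul, dotProduct_add, smul_eq_mul, Complex.star_def,
    Complex.conj_ofReal]
  ring

/-- The control qubits are orthogonal, since ⟨R|R₋⟩ = 0; this makes the controlled states
normalized. -/
theorem braket_ketRpow_markedGraphState {n : ℕ} (G : SimpleGraph (Fin n)) :
    braket (ketRpow (n + 1)) 1 (markedGraphState G) = 0 := by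
  rw [← pauliString_const_I, ketRpow_succ, markedGraphState, braket_tensorState]
  have hI := Complex.I_sq
  have hcs := ofReal_cos_sq_add_sin_sq
  have h : ∑ u, star (ketR u) * (Pauli.I.toMatrix u (xor u Pauli.I.xbit) *
      ketRminus (xor u Pauli.I.xbit)) = 0 := by
    have hk : (starRingEnd ℂ) ((1 / √2 : ℝ) : ℂ) = ((1 / √2 : ℝ) : ℂ) := Complex.conj_ofReal _
    simp only [Fintype.sum_bool, ketR, ketRminus, exp_pi_div_eight, Pauli.toMatrix, Pauli.xbit]
    generalize ((1 / √2 : ℝ) : ℂ) = k at *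
    generalize Real.cos (Real.pi / 8) = C at *
    generalize Real.sin (Real.pi / 8) = S at *
    simp [hk]
    linear_combination - (k * k * hcs) + k * k * S ^ 2 * hI
  rw [h, zero_mul]

theorem braket_controlledGraphState_self {n : ℕ} (G : SimpleGraph (Fin n)) :
    braket (controlledGraphState G) 1 (controlledGraphState G) = 1 := by
  have h := star_braket (ketRpow (n + 1)) 1 (markedGraphState G)
  rw [braket_ketRpow_markedGraphState, star_zero, star_one] at h
  rw [overlap_controlledGraphState, braket_ketRpow_markedGraphState, ← h, braket_ketRpow_self,
    braket_markedGraphState_self]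
  norm_num

/-- Isomorphic graphs have states related by a permutation of the target qubits. -/
theorem exists_qubitPerm_of_iso {n : ℕ} {G₁ G₂ : SimpleGraph (Fin n)} (e : G₁ ≃g G₂) :
    ∃ U ∈ cliffordGroup (n + 1), ∃ σ : Equiv.Perm (Fin (n + 1)), σ 0 = 0 ∧
      (U : QMatrix (n + 1)) = qubitPerm σ ∧
      (U : QMatrix (n + 1)) *ᵥ controlledGraphState G₂ = controlledGraphState G₁ := by
  -- The inverse isomorphism, extended by fixing the control. The inverse appears because
  -- `qubitPerm` acts by precomposition on bit strings.
  set σ : Equiv.Perm (Fin (n + 1)) := Equiv.Perm.decomposeFin.symm (0, e.toEquiv.symm) with hσ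
  have h0 : σ 0 = 0 := by simp [hσ]
  have hs : ∀ i : Fin n, σ i.succ = (e.symm i).succ := by
    intro i
    simp only [hσ, Equiv.Perm.decomposeFin_symm_apply_succ, Equiv.swap_self, Equiv.refl_apply]
    rfl
  refine ⟨qubitPermHom (n + 1) σ, qubitPermHom_mem_cliffordGroup σ, σ, h0, rfl, ?_⟩
  funext x
  have htail : Fin.tail (x ∘ σ) = Fin.tail x ∘ e.symm := by
    funext i; simp [Fin.tail, hs]
  have hR : ketRpow n (Fin.tail x ∘ e.symm) = ketRpow n (Fin.tail x) :=
    Equiv.prod_comp e.symm.toEquiv fun i => ketR (Fin.tail x i)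
  change (qubitPerm σ *ᵥ _) x = _
  rw [qubitPerm_mulVec, controlledGraphState, controlledGraphState, htail, hR, graphState_eq,
    graphSign_comp_iso, ← graphState_eq, Function.comp_apply, h0]

/-! ### Clifford unitaries with high overlap -/

/-- The four terms sum in norm to at least 2 · 0.99999. Each cross term is at most 0.00001 and each
diagonal term at most 1, so each diagonal term is at least 0.99996. -/
theorem norm_overlaps_of_controlled {n : ℕ} (hn : 1000 ≤ n) {G₁ G₂ : SimpleGraph (Fin n)}
    {U : QUnitary (n + 1)} (hU : U ∈ cliffordGroup (n + 1))
    (h : 0.99999 ≤ ‖overlap (controlledGraphState G₁) U (controlledGraphState G₂)‖) :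
    0.9999 ≤ ‖overlap (ketRpow (n + 1)) U (ketRpow (n + 1))‖ ^ 2 ∧
      0.9999 ≤ ‖overlap (markedGraphState G₁) U (markedGraphState G₂)‖ := by
  have hUU : star (U : QMatrix (n + 1)) * (U : QMatrix (n + 1)) = 1 :=
    Matrix.UnitaryGroup.star_mul_self U
  have h1 := norm_braket_le hUU (braket_ketRpow_self (n := n + 1)) braket_ketRpow_self
  have h2 := norm_overlap_markedGraphState_le hn G₂ hU
  -- The other cross term is the adjoint one, bounded through the Clifford `U⁻¹`.
  have h3 := norm_overlap_markedGraphState_le hn G₁ (inv_mem hU)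
  have h4 := norm_braket_le hUU (braket_markedGraphState_self G₁) (braket_markedGraphState_self G₂)
  have h3' : ‖braket (markedGraphState G₁) U (ketRpow (n + 1))‖
      = ‖overlap (ketRpow (n + 1)) U⁻¹ (markedGraphState G₁)‖ := by
    rw [← norm_star, star_braket]
    rfl
  rw [← h3'] at h3
  simp only [overlap_eq_braket] at h h2 ⊢
  rw [overlap_controlledGraphState, norm_mul] at h
  have h5 := norm_add₃_le (a := braket (ketRpow (n + 1)) (U : QMatrix (n + 1)) (ketRpow (n + 1))
    + braket (ketRpow (n + 1)) (U : QMatrix (n + 1)) (markedGraphState G₂))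
    (b := braket (markedGraphState G₁) (U : QMatrix (n + 1)) (ketRpow (n + 1)))
    (c := braket (markedGraphState G₁) (U : QMatrix (n + 1)) (markedGraphState G₂))
  have h6 := norm_add_le (braket (ketRpow (n + 1)) (U : QMatrix (n + 1)) (ketRpow (n + 1)))
    (braket (ketRpow (n + 1)) (U : QMatrix (n + 1)) (markedGraphState G₂))
  have h7 : ‖(1 / 2 : ℂ)‖ = 1 / 2 := by norm_num
  rw [h7] at h
  constructor
  · have : 0.99995 ≤ ‖braket (ketRpow (n + 1)) (U : QMatrix (n + 1)) (ketRpow (n + 1))‖ := by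
      linarith
    nlinarith
  · linarith

theorem degreeSign_eq_neg_one_iff {n : ℕ} (G : SimpleGraph (Fin n)) {x : Fin n → Bool} {a : Fin n}
    (hx : ∀ l, x l = true ↔ l = a) (j : Fin n) : degreeSign G x j = -1 ↔ G.Adj j a := by
  classical
  have h : degreeSign G x j = if G.Adj j a then -1 else 1 := by
    rw [degreeSign, Finset.prod_eq_single a]
    · simp [(hx a).2 rfl]
    · intro i _ hi
      rw [if_neg fun h => hi ((hx i).1 h.2)]
    · simp
  rw [h]
  split_ifs with h'
  · simp [h']
  · simp only [h', iff_false]; norm_num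

/-- A Clifford unitary with high overlap permutes the qubits, fixes the control qubit, and permutes
the vertices of the graphs by an isomorphism. -/
theorem clifford_rigidity {n : ℕ} (hn : 1000 ≤ n) {G₁ G₂ : SimpleGraph (Fin n)}
    {U : QUnitary (n + 1)} (hU : U ∈ cliffordGroup (n + 1))
    (h : 0.99999 ≤ ‖overlap (controlledGraphState G₁) U (controlledGraphState G₂)‖) :
    (∃ σ : Equiv.Perm (Fin (n + 1)), σ 0 = 0 ∧
      ∃ c : ℂ, ‖c‖ = 1 ∧ (U : QMatrix (n + 1)) = c • qubitPerm σ) ∧ Nonempty (G₁ ≃g G₂) := by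
  classical
  obtain ⟨h1, h4⟩ := norm_overlaps_of_controlled hn hU h
  obtain ⟨σ, c, hc, hUσ⟩ := clifford_eq_qubitPerm hU h1
  have hclose : ∀ P : Fin (n + 1) → Pauli,
      |‖((P 0).expectRminus : ℂ) * braket (graphState G₁) (pauliString (Fin.tail P)) (graphState G₁)‖
      - ‖((P (σ 0)).expectRminus : ℂ) *
        braket (graphState G₂) (pauliString (Fin.tail (P ∘ σ))) (graphState G₂)‖| ≤ 0.03 := by
    intro P
    -- Here 8 · (1 - 0.9999) = 0.0008 ≤ 0.03².
    have h5 := norm_expect_sub_le (braket_markedGraphState_self G₁) (braket_markedGraphState_self G₂)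
      h4 (d := 0.03) (by norm_num) (by norm_num) (conj_smul_qubitPerm hc hUσ P)
    rw [expect_markedGraphState, expect_markedGraphState, one_mul] at h5
    exact (abs_norm_sub_norm_le _ _).trans h5
  have hcos := cos_pi_div_eight_bounds
  have hσ0 : σ 0 = 0 := by
    by_contra hne
    -- X on the control has absolute value cos(π/8). If σ moved the control, the permuted string
    -- would act on the target only, where values are 0 or 1.
    have h5 := hclose (singlePauli 0 .X)
    have htail : Fin.tail (singlePauli (0 : Fin (n + 1)) .X) = fun _ => .I := by
      funext j; exact singlePauli_of_ne (Fin.succ_ne_zero j) _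
    rw [htail, pauliString_const_I, braket_graphState_self, singlePauli_same, singlePauli_of_ne hne,
      norm_mul, norm_mul, norm_expect_graphState] at h5
    simp only [Pauli.expectRminus, Complex.norm_real, Real.norm_eq_abs, abs_neg, norm_one,
      one_mul, mul_one] at h5
    rw [abs_of_nonneg (show 0 ≤ Real.cos (Real.pi / 8) by linarith)] at h5
    rw [abs_le] at h5
    split_ifs at h5 <;> linarith [h5.1, h5.2]
  refine ⟨⟨σ, hσ0, c, hc, hUσ⟩, ?_⟩
  obtain ⟨τ, hτ⟩ : ∃ τ : Equiv.Perm (Fin n), ∀ j, σ (Fin.succ j) = Fin.succ (τ j) := by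
    obtain ⟨⟨p, τ⟩, rfl⟩ := Equiv.Perm.decomposeFin.symm.surjective σ
    rw [Equiv.Perm.decomposeFin_symm_apply_zero] at hσ0
    subst hσ0
    exact ⟨τ, fun j => by simp⟩
  have hadj : ∀ i j, G₁.Adj (τ i) (τ j) ↔ G₂.Adj i j := by
    intro i j
    -- The stabilizer generator of `G₁` at the vertex `τ i`. Its value ±1 forces a nonzero value of
    -- the permuted string in `G₂`, hence a stabilizer there, and its Z-support must be the
    -- neighbourhood of `i`.
    set B : Fin n → Pauli := fun l => if l = τ i then .X else if G₁.Adj (τ i) l then .Z else .I with hB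
    have hBx : ∀ l, (B l).xbit = true ↔ l = τ i := by
      intro l; simp only [hB]; split_ifs with h1 h2 <;> simp [Pauli.xbit, h1]
    have hBz : ∀ l, (B l).zbit = true ↔ G₁.Adj (τ i) l := by
      intro l; simp only [hB]; split_ifs with h1 h2
      · simp [Pauli.zbit, h1]
      · simp [Pauli.zbit, h2]
      · simp [Pauli.zbit, h2]
    have h5 := hclose (Fin.cons .I B)
    have htail : Fin.tail ((Fin.cons .I B : Fin (n + 1) → Pauli) ∘ σ) = B ∘ τ := by
      funext l; simp [Fin.tail, hτ]
    rw [hσ0, htail, Fin.tail_cons, Fin.cons_zero, norm_mul, norm_mul, norm_expect_graphState,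
      norm_expect_graphState, if_pos] at h5
    · simp only [Pauli.expectRminus, Complex.norm_real, norm_one, one_mul] at h5
      split_ifs at h5 with h6
      · have h7 := h6 j
        rw [degreeSign_eq_neg_one_iff G₂ (a := i) (fun l => by simp [hBx]), Function.comp_apply,
          hBz] at h7
        rw [h7, G₂.adj_comm]
      · norm_num at h5
    · intro l
      rw [degreeSign_eq_neg_one_iff G₁ hBx, hBz, G₁.adj_comm]
  exact ⟨(⟨τ, fun {a b} => hadj a b⟩ : G₂ ≃g G₁).symm⟩

/-! ### A pair of states that no Clifford unitary relates -/

/-- The state `|0^m⟩`. -/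
noncomputable def zeroState (m : ℕ) : QState m := Pi.single (fun _ => false) 1

theorem expect_zeroState {m : ℕ} (P : Fin m → Pauli) :
    braket (zeroState m) (pauliString P) (zeroState m)
      = pauliPhase P (fun _ => false) * zeroState m (pauliFlip P fun _ => false) := by
  rw [braket_pauliString, Finset.sum_eq_single (fun _ => false)]
  · simp [zeroState]
  · intro x _ hx; simp [zeroState, hx]
  · simp

theorem norm_expect_zeroState {m : ℕ} (P : Fin m → Pauli) :
    ‖braket (zeroState m) (pauliString P) (zeroState m)‖ = 0 ∨
      ‖braket (zeroState m) (pauliString P) (zeroState m)‖ = 1 := by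
  rw [expect_zeroState, norm_mul, norm_pauliPhase, one_mul]
  by_cases h : (pauliFlip P fun _ => false) = fun _ => false
  · right; rw [h]; simp [zeroState]
  · left; rw [zeroState, Pi.single_eq_of_ne h, norm_zero]

theorem braket_zeroState_self {m : ℕ} : braket (zeroState m) 1 (zeroState m) = 1 := by
  rw [braket_one, Finset.sum_eq_single (fun _ => false)]
  · simp [zeroState]
  · intro x _ hx; simp [zeroState, hx]
  · simp

/-- All strings have absolute value 0 or 1 in |0^{n+1}⟩, while X on the first qubit of |R⟩|0^n⟩ has
value cos(π/8). This yields fixed NO instances for small graphs. -/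
theorem norm_overlap_zeroState_le {n : ℕ} {U : QUnitary (n + 1)} (hU : U ∈ cliffordGroup (n + 1)) :
    ‖overlap (zeroState (n + 1)) U (tensorState ketR (zeroState n))‖ ≤ 0.99999 := by
  by_contra! hlt
  obtain ⟨L, w, hw, hL⟩ := clifford_conj hU
  have hcos := cos_pi_div_eight_bounds
  have hE : ∀ P : Fin (n + 1) → Pauli, Fin.tail P = (fun _ => .I) →
      braket (tensorState ketR (zeroState n)) (pauliString P) (tensorState ketR (zeroState n))
        = (P 0).expectR := by
    intro P hP
    rw [braket_tensorState, expect_ketR, hP, pauliString_const_I, braket_zeroState_self, mul_one]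
  have hnorm : braket (tensorState ketR (zeroState n)) 1 (tensorState ketR (zeroState n)) = 1 := by
    rw [← pauliString_const_I, hE _ rfl]
    simp [Pauli.expectR]
  have h1 := norm_expect_sub_le braket_zeroState_self hnorm hlt.le (d := 0.03) (by norm_num)
    (by norm_num) (hL (L.symm (singlePauli 0 .X)))
  rw [Equiv.apply_symm_apply, hE _ (by funext j; exact singlePauli_of_ne (Fin.succ_ne_zero j) _),
    singlePauli_same, Pauli.expectR] at h1
  have h2 := (abs_norm_sub_norm_le _ _).trans h1
  rw [norm_mul, norm_of_mem_phases (hw _), one_mul, Complex.norm_real,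
    Real.norm_of_nonneg (by linarith), abs_le] at h2
  rcases norm_expect_zeroState (L.symm (singlePauli 0 .X)) with h | h <;> rw [h] at h2 <;>
    linarith [h2.1, h2.2]

/-! ### Circuits that prepare the states of the reduction -/

/-- The action of a circuit on states. -/
noncomputable def Circuit.run {m : ℕ} (C : Circuit m) (ψ : QState m) : QState m :=
  C.foldl (fun ψ g => g.apply ψ) ψ

theorem Circuit.state_eq_run {m : ℕ} (C : Circuit m) : C.state = C.run (zeroState m) := rfl

theorem Circuit.run_append {m : ℕ} (C D : Circuit m) (ψ : QState m) :
    Circuit.run (C ++ D) ψ = Circuit.run D (Circuit.run C ψ) :=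
  List.foldl_append ..

theorem Circuit.run_cons {m : ℕ} (g : Gate m) (C : Circuit m) (ψ : QState m) :
    Circuit.run (g :: C) ψ = Circuit.run C (g.apply ψ) := rfl

theorem Circuit.run_nil {m : ℕ} (ψ : QState m) : Circuit.run [] ψ = ψ := rfl

open Classical in
/-- The doubly controlled `Z` gate for an edge between `j < i`. -/
noncomputable def edgeGates {n : ℕ} (G : SimpleGraph (Fin n)) (i j : Fin n) : Circuit (n + 1) :=
  if h : j < i ∧ G.Adj i j then
    [.ccz 0 j.succ i.succ (Fin.succ_ne_zero j).symm (Fin.succ_ne_zero i).symm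
      fun hji => h.1.ne (Fin.succ_inj.1 hji)]
  else []

/-- The gates that introduce the vertex `i`. -/
noncomputable def vertexGates {n : ℕ} (G : SimpleGraph (Fin n)) (i : Fin n) : Circuit (n + 1) :=
  -- The X gates make the phase conditional on control 0, the branch that builds |R^n⟩; the edge
  -- gates act on control 1, the branch that builds |G⟩.
  [.hadamard i.succ, .x 0, .cphase 0 i.succ (Fin.succ_ne_zero i).symm, .x 0]
    ++ (List.finRange n).flatMap (edgeGates G i)

/-- A circuit that prepares the state of the reduction. -/
noncomputable def graphCircuit {n : ℕ} (G : SimpleGraph (Fin n)) : Circuit (n + 1) :=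
  -- The last two gates turn the control states |0⟩ and |1⟩ into |R⟩ and |R₋⟩.
  [.hadamard 0] ++ (List.finRange n).flatMap (vertexGates G) ++ [.hadamard 0, .phase 0]

open Classical in
/-- The sign contributed by a potential edge. -/
noncomputable def edgeFactor {n : ℕ} (G : SimpleGraph (Fin n)) (i j : Fin n)
    (b : Fin (n + 1) → Bool) : ℂ :=
  if j < i ∧ G.Adj i j ∧ b j.succ = true ∧ b i.succ = true then -1 else 1

/-- The phase contributed by the diagonal gates of a vertex. -/
noncomputable def vertexFactor {n : ℕ} (G : SimpleGraph (Fin n)) (i : Fin n)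
    (b : Fin (n + 1) → Bool) : ℂ :=
  if b 0 = true then ∏ j, edgeFactor G i j b
  else if b i.succ = true then Complex.exp (Complex.I * Real.pi / 8) else 1

open Classical in
/-- The state after the first `k` vertices have been introduced. -/
noncomputable def partialState {n : ℕ} (G : SimpleGraph (Fin n)) (k : ℕ) : QState (n + 1) :=
  fun b => if ∀ l : Fin n, k ≤ l → b l.succ = false then
    -- The exponent counts the control as well. The product may run over all vertices because a
    -- vertex with bit 0 contributes the factor 1.
    ((1 / √2 : ℝ) : ℂ) ^ (k + 1) * ∏ i, vertexFactor G i b else 0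

theorem run_edgeGates {n : ℕ} (G : SimpleGraph (Fin n)) (i : Fin n) (ψ : QState (n + 1))
    (b : Fin (n + 1) → Bool) :
    Circuit.run ((List.finRange n).flatMap (edgeGates G i)) ψ b
      = (if b 0 = true then ∏ j, edgeFactor G i j b else 1) * ψ b := by
  classical
  have h : ∀ (l : List (Fin n)) (ψ : QState (n + 1)), Circuit.run (l.flatMap (edgeGates G i)) ψ b
      = (if b 0 = true then (l.map fun j => edgeFactor G i j b).prod else 1) * ψ b := by
    intro l
    induction l with
    | nil => intro ψ; simp [Circuit.run]
    | cons j l ih =>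
      intro ψ
      rw [List.flatMap_cons, Circuit.run_append, ih, List.map_cons, List.prod_cons]
      by_cases h : j < i ∧ G.Adj i j
      · rw [edgeGates, dif_pos h, Circuit.run_cons, Circuit.run_nil]
        simp only [Gate.apply, edgeFactor, h.1, h.2, true_and]
        cases b 0 <;> cases b j.succ <;> cases b i.succ <;> simp
      · have h' : edgeFactor G i j b = 1 := if_neg fun hh => h ⟨hh.1, hh.2.1⟩
        rw [edgeGates, dif_neg h, h', one_mul, Circuit.run_nil]
  rw [h, Fin.prod_univ_def]

/-- Before its Hadamard gate the new qubit is 0, so only one branch survives; the remaining gates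
amount to the diagonal factor of the vertex. -/
theorem run_vertexGates {n : ℕ} (G : SimpleGraph (Fin n)) (i : Fin n) :
    Circuit.run (vertexGates G i) (partialState G i) = partialState G (i + 1) := by
  classical
  funext b
  have hne : i.succ ≠ 0 := Fin.succ_ne_zero i
  have h1 : Circuit.run (vertexGates G i) (partialState G i) b
      = vertexFactor G i b * (((1 / √2 : ℝ) : ℂ) *
        (partialState G i (Function.update b i.succ false) + (if b i.succ then -1 else 1)
          * partialState G i (Function.update b i.succ true))) := by
    rw [vertexGates, Circuit.run_append, run_edgeGates]
    simp only [Circuit.run_cons, Circuit.run_nil, Gate.apply, vertexFactor]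
    have hflip : Function.update (Function.update b 0 !b 0) 0 (!!b 0) = b := by simp
    simp only [Function.update_self, Function.update_of_ne hne, hflip]
    cases b 0 <;> simp
  have h2 : partialState G i (Function.update b i.succ true) = 0 := by
    rw [partialState, if_neg]
    intro h
    simpa using h i le_rfl
  rw [h1, h2, mul_zero, add_zero, partialState, partialState]
  have h3 : (∀ l : Fin n, (i : ℕ) ≤ l → Function.update b i.succ false l.succ = false)
      ↔ ∀ l : Fin n, (i : ℕ) + 1 ≤ l → b l.succ = false := by
    refine forall_congr' fun l => ?_
    by_cases hl : l = i
    · subst hl; simp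
    · rw [Function.update_of_ne (fun h => hl (Fin.succ_inj.1 h))]
      have : (l : ℕ) ≠ i := fun h => hl (Fin.ext h)
      refine imp_congr_left ?_
      omega
  simp only [h3]
  split_ifs with hsupp
  -- Setting bit `i` to 0 changes no other vertex factor: the edges to `i` are counted at their
  -- larger end, and later vertices still have bit 0.
  · have h4 : ∏ l, vertexFactor G l b
        = vertexFactor G i b * ∏ l, vertexFactor G l (Function.update b i.succ false) := by
      rw [← Finset.mul_prod_erase _ _ (Finset.mem_univ i),
        ← Finset.mul_prod_erase Finset.univ (fun l => vertexFactor G l (Function.update b _ _))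
          (Finset.mem_univ i)]
      have h5 : vertexFactor G i (Function.update b i.succ false) = 1 := by
        simp [vertexFactor, edgeFactor]
      rw [h5, one_mul]
      congr 1
      refine Finset.prod_congr rfl fun l hl => ?_
      have hl' : l.succ ≠ i.succ := fun h => Finset.ne_of_mem_erase hl (Fin.succ_inj.1 h)
      simp only [vertexFactor, edgeFactor, Function.update_of_ne hl', Function.update_of_ne hne.symm]
      congr 1
      refine Finset.prod_congr rfl fun j _ => ?_
      by_cases hj : j = i
      · subst hj
        by_cases hlt : j < l
        · have := hsupp l (by exact hlt)
          simp [this]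
        · simp [hlt]
      · rw [Function.update_of_ne (fun h => hj (Fin.succ_inj.1 h))]
    rw [h4, pow_succ _ ((i : ℕ) + 1)]
    ring
  · simp

theorem run_flatMap_vertexGates {n : ℕ} (G : SimpleGraph (Fin n)) {k : ℕ} (hk : k ≤ n) :
    Circuit.run (((List.finRange n).take k).flatMap (vertexGates G)) (partialState G 0)
      = partialState G k := by
  induction k with
  | zero => rfl
  | succ k ih =>
    have hlt : k < (List.finRange n).length := by simpa using hk
    rw [List.take_succ_eq_append_getElem hlt, List.flatMap_append, Circuit.run_append,
      ih (by omega), List.flatMap_singleton]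
    have h := run_vertexGates G ⟨k, hk⟩
    simpa using h

theorem prod_vertexFactor_false {n : ℕ} (G : SimpleGraph (Fin n)) (b : Fin (n + 1) → Bool) :
    ((1 / √2 : ℝ) : ℂ) ^ n * ∏ i, vertexFactor G i (Function.update b 0 false)
      = ketRpow n (Fin.tail b) := by
  simp only [vertexFactor, Function.update_self, Function.update_of_ne (Fin.succ_ne_zero _),
    Bool.false_eq_true, if_false, ketRpow, ketR, Finset.prod_mul_distrib, Finset.prod_const,
    Finset.card_univ, Fintype.card_fin, Fin.tail]
  congr

theorem prod_vertexFactor_true {n : ℕ} (G : SimpleGraph (Fin n)) (b : Fin (n + 1) → Bool) :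
    ((1 / √2 : ℝ) : ℂ) ^ n * ∏ i, vertexFactor G i (Function.update b 0 true)
      = graphState G (Fin.tail b) := by
  classical
  rw [graphState_eq, graphSign, Finset.prod_comm]
  simp only [vertexFactor, edgeFactor, Function.update_self,
    Function.update_of_ne (Fin.succ_ne_zero _), if_true, Fin.tail]
  congr 1
  refine Finset.prod_congr rfl fun i _ => Finset.prod_congr rfl fun j _ => ?_
  rw [G.adj_comm]
  congr

theorem state_graphCircuit {n : ℕ} (G : SimpleGraph (Fin n)) :
    (graphCircuit G).state = controlledGraphState G := by
  classical
  have h0 : Circuit.run [Gate.hadamard 0] (zeroState (n + 1)) = partialState G 0 := by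
    funext b
    have hz : ∀ c, zeroState (n + 1) (Function.update b 0 c)
        = if c = false ∧ ∀ l : Fin n, b l.succ = false then 1 else 0 := by
      intro c
      have : Function.update b 0 c = (fun _ => false) ↔
          c = false ∧ ∀ l : Fin n, b l.succ = false := by
        rw [funext_iff, Fin.forall_fin_succ]
        simp
      rw [zeroState, Pi.single_apply]
      simp only [this]
    simp only [Circuit.run_cons, Circuit.run_nil, Gate.apply, hz, partialState]
    by_cases hb : ∀ l : Fin n, b l.succ = false
    · have h1 : ∀ i, vertexFactor G i b = 1 := by
        intro i
        simp [vertexFactor, edgeFactor, hb]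
      simp [hb, h1]
    · simp [hb]
  have hn : Circuit.run ((List.finRange n).flatMap (vertexGates G)) (partialState G 0)
      = partialState G n := by
    have := run_flatMap_vertexGates G (le_refl n)
    rwa [List.take_of_length_le (by simp)] at this
  rw [Circuit.state_eq_run, graphCircuit, Circuit.run_append, Circuit.run_append, h0, hn]
  funext b
  have hs : ∀ c, partialState G n (Function.update b 0 c) = ((1 / √2 : ℝ) : ℂ) *
      (((1 / √2 : ℝ) : ℂ) ^ n * ∏ i, vertexFactor G i (Function.update b 0 c)) := by
    intro c
    rw [partialState, if_pos fun l hl => absurd l.isLt (by omega), pow_succ]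
    ring
  simp only [Circuit.run_cons, Circuit.run_nil, Gate.apply, hs, prod_vertexFactor_false,
    prod_vertexFactor_true, controlledGraphState, ketR, ketRminus]
  cases b 0
  · simp
  · simp
    ring

/-! ### The reduction -/

/-- A circuit that prepares `|R⟩ |0^n⟩`. -/
def magicCircuit (n : ℕ) : Circuit (n + 1) := [.hadamard 0, .phase 0]

theorem state_magicCircuit (n : ℕ) :
    (magicCircuit n).state = tensorState ketR (zeroState n) := by
  classical
  funext b
  have hz : ∀ c, zeroState (n + 1) (Function.update b 0 c)
      = if c = false then zeroState n (Fin.tail b) else 0 := by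
    intro c
    have : Function.update b 0 c = (fun _ => false) ↔
        c = false ∧ Fin.tail b = fun _ => false := by
      rw [funext_iff, Fin.forall_fin_succ, funext_iff]
      simp [Fin.tail]
    rw [zeroState, zeroState, Pi.single_apply, Pi.single_apply, ← ite_and]
    simp only [this]
  rw [Circuit.state_eq_run, magicCircuit]
  simp only [Circuit.run_cons, Circuit.run_nil, Gate.apply, hz, tensorState, ketR]
  cases b 0 <;> simp
  ring

open Classical in
/-- The reduction from Graph Isomorphism, with a table for small graphs. -/
noncomputable def graphReduction (p : GraphPair) : CircuitPair :=
  if p.1 < 1000 then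
    ⟨p.1 + 1, [], if Nonempty (p.2.1 ≃g p.2.2) then [] else magicCircuit p.1⟩
  else ⟨p.1 + 1, graphCircuit p.2.1, graphCircuit p.2.2⟩

theorem graphReduction_yes (p : GraphPair) (hp : Nonempty (p.2.1 ≃g p.2.2)) :
    graphReduction p ∈ (cliffordPSGI 0.99999 1).yes := by
  rw [graphReduction]
  split_ifs
  · refine ⟨1, ?_⟩
    rw [map_one, overlap_eq_braket]
    change (1 : ℝ) ≤ (braket (zeroState _) 1 (zeroState _)).re
    rw [braket_zeroState_self, Complex.one_re]
  · obtain ⟨e⟩ := hp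
    obtain ⟨U, hU, σ, -, -, h⟩ := exists_qubitPerm_of_iso e
    refine ⟨⟨U, hU⟩, ?_⟩
    change (1 : ℝ) ≤ (overlap (graphCircuit p.2.1).state U (graphCircuit p.2.2).state).re
    rw [state_graphCircuit, state_graphCircuit, overlap, h]
    have := braket_controlledGraphState_self p.2.1
    rw [braket, Matrix.one_mulVec] at this
    rw [this, Complex.one_re]

theorem graphReduction_no (p : GraphPair) (hp : ¬ Nonempty (p.2.1 ≃g p.2.2)) :
    graphReduction p ∈ (cliffordPSGI 0.99999 1).no := by
  rw [graphReduction]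
  split_ifs with hlt
  · rintro ⟨U, hU⟩
    change ‖overlap (zeroState (p.1 + 1)) U (magicCircuit p.1).state‖ ≤ 0.99999
    rw [state_magicCircuit]
    exact norm_overlap_zeroState_le hU
  · rintro ⟨U, hU⟩
    change ‖overlap (graphCircuit p.2.1).state U (graphCircuit p.2.2).state‖ ≤ 0.99999
    rw [state_graphCircuit, state_graphCircuit]
    by_contra! h
    exact hp (clifford_rigidity (not_lt.1 hlt) hU h.le).2

/-! ### A stack machine for the reduction -/

/-- The counters of the machine, each kept in unary on a stack: the vertices before the current one,
the remaining vertices, and two scratch counters. -/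
inductive Counter where
  | lo
  | hi
  | tmp
  | aux
  deriving DecidableEq

instance : Fintype Counter := ⟨{.lo, .hi, .tmp, .aux}, fun c => by cases c <;> simp⟩

/-- The stacks of the machine: input, output, the remaining adjacency bits, and the counters. -/
inductive StackName where
  | inp
  | out
  | adj
  | ctr (c : Counter)
  deriving DecidableEq, Fintype

/-- The main program labels. The flag tells whether the second circuit is being written. -/
inductive MainLabel where
  | readSize
  | readBits
  | dispatch
  | circuit (c : Bool)
  | row (c : Bool)
  | skip (c : Bool)
  | cols (c : Bool)
  | edgeFst (c : Bool)
  | edgeSnd (c : Bool)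
  | edgeEnd (c : Bool)
  | vertexFst (c : Bool)
  | vertexSnd (c : Bool)
  | vertexEnd (c : Bool)
  | finish
  | drain
  | clear
  deriving Fintype

/-- The program labels, with the subroutines that move a counter and that write a counter. -/
inductive Label where
  | main (l : MainLabel)
  | move (a b : Counter) (ret : MainLabel)
  | emit (a : Counter) (ret : MainLabel)
  deriving Fintype

/-- A buffer for bit strings of length at most `B`. -/
abbrev Buffer (B : ℕ) : Type := Option {l : List Bool // l.length ≤ B}

noncomputable instance (B : ℕ) : Fintype {l : List Bool // l.length ≤ B} :=
  (List.finite_length_le Bool B).fintype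

/-- The buffer that holds `l` if it is short enough. -/
def Buffer.ofList (B : ℕ) (l : List Bool) : Buffer B :=
  if h : l.length ≤ B then some ⟨l, h⟩ else none

/-- Add a bit to a buffer. -/
def Buffer.push {B : ℕ} (s : Buffer B) (b : Bool) : Buffer B :=
  s.bind fun l => Buffer.ofList B (b :: l.1)

/-- Overflow is absorbing, so the buffer depends only on the word read so far. -/
theorem Buffer.push_ofList {B : ℕ} (l : List Bool) (b : Bool) :
    (Buffer.ofList B l).push b = Buffer.ofList B (b :: l) := by
  by_cases h : l.length ≤ B
  · simp [Buffer.ofList, Buffer.push, h]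
  · have h' : ¬ (b :: l).length ≤ B := by simp; omega
    rw [Buffer.ofList, dif_neg h, Buffer.ofList, dif_neg h']
    rfl

/-- The internal states of the machine: the symbol read last, and the buffered input. -/
abbrev MachineState (B : ℕ) : Type := Option Bool × Buffer B

/-- The statements of the machine. -/
abbrev MachineStmt (B : ℕ) : Type :=
  Turing.TM2.Stmt (fun _ : StackName => Bool) Label (MachineState B)

namespace MachineStmt

variable {B : ℕ}

/-- Jump to a label. -/
def jump (l : Label) : MachineStmt B := .goto fun _ => l

/-- Pop a symbol into the internal state. -/
def popTo (k : StackName) (q : MachineStmt B) : MachineStmt B :=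
  .pop k (fun s o => (o, s.2)) q

/-- Pop a symbol into the internal state and the buffer. -/
def popBuffered (k : StackName) (q : MachineStmt B) : MachineStmt B :=
  .pop k (fun s o => (o, o.elim s.2 s.2.push)) q

/-- Branch on whether a symbol was read. -/
def ifSome (q r : MachineStmt B) : MachineStmt B := .branch (fun s => s.1.isSome) q r

/-- Branch on whether the symbol `1` was read. -/
def ifOne (q r : MachineStmt B) : MachineStmt B := .branch (fun s => s.1.getD false) q r

/-- Increment a counter. -/
def incr (c : Counter) (q : MachineStmt B) : MachineStmt B := .push (.ctr c) (fun _ => true) q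

/-- Put a word in front of the output. -/
def write : List Bool → MachineStmt B → MachineStmt B
  | [], q => q
  | b :: w, q => write w (.push .out (fun _ => b) q)

end MachineStmt

open MachineStmt in
/-- The program of the machine, with the answers `T` for buffered inputs. -/
def machineProgram {B : ℕ} (T : List Bool → Option Bool) : Label → MachineStmt B
  | .main .readSize => popBuffered .inp <|
      ifOne (incr .lo <| jump (.main .readSize)) (jump (.main .readBits))
  | .main .readBits => popBuffered .inp <|
      ifSome (.push .adj (fun s => s.1.getD false) <| jump (.main .readBits))
        (jump (.main .dispatch))
  | .main .dispatch =>
      .branch (fun s => (s.2.bind fun l => T l.1) == some true)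
        -- The codes of the empty circuit and of `magicCircuit` do not depend on the number of
        -- qubits, so the fixed answers are fixed words.
        (write (encodeCircuit (m := 1) [] ++ encodeCircuit (m := 1) []) <| jump (.main .finish)) <|
      .branch (fun s => (s.2.bind fun l => T l.1) == some false)
        (write (encodeCircuit (m := 1) [] ++ encodeCircuit (magicCircuit 0)) <|
          jump (.main .finish)) <|
      jump (.main (.circuit true))
  | .main (.circuit c) =>
      write (unaryCode 2 ++ unaryCode 0 ++ (unaryCode 3 ++ unaryCode 0) ++ unaryCode 0) <|
      jump (.main (.row c))
  | .main (.row c) => popTo (.ctr .lo) <|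
      ifSome (incr .hi <| jump (.main (.skip c)))
        (write (unaryCode 2 ++ unaryCode 0) <|
          jump (.move .hi .lo (if c then .circuit false else .finish)))
  | .main (.skip c) => popTo (.ctr .hi) <|
      ifSome (incr .tmp <| popTo .adj <| jump (.main (.skip c)))
        (jump (.move .tmp .hi (.cols c)))
  | .main (.cols c) => popTo (.ctr .lo) <|
      ifSome
        (incr .tmp <| popTo .adj <|
          ifOne (write (unaryCode 1) <| jump (.emit .lo (.edgeFst c))) (jump (.main (.cols c))))
        (jump (.move .tmp .lo (.vertexFst c)))
  | .main (.edgeFst c) => jump (.emit .tmp (.edgeSnd c))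
  | .main (.edgeSnd c) => write (unaryCode 1) <| jump (.emit .lo (.edgeEnd c))
  | .main (.edgeEnd c) => write (unaryCode 6 ++ unaryCode 0) <| jump (.main (.cols c))
  | .main (.vertexFst c) => write (unaryCode 1 ++ (unaryCode 1 ++ unaryCode 0)) <|
      jump (.emit .lo (.vertexSnd c))
  | .main (.vertexSnd c) =>
      write (unaryCode 1 ++ (unaryCode 1 ++ unaryCode 0) ++ (unaryCode 5 ++ unaryCode 0)) <|
      jump (.emit .lo (.vertexEnd c))
  | .main (.vertexEnd c) => write (unaryCode 2) <| jump (.main (.row c))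
  | .main .finish => write (unaryCode 1) <| jump (.main .drain)
  | .main .drain => popTo (.ctr .lo) <|
      ifSome (write [true] <| jump (.main .drain)) (jump (.main .clear))
  -- A halting configuration must have the initial internal state and empty stacks apart from the
  -- output. After a table answer the adjacency bits are still present.
  | .main .clear => popTo .adj <|
      ifSome (jump (.main .clear)) (.load (fun _ => (none, Buffer.ofList B [])) .halt)
  | .move a b ret => popTo (.ctr a) <|
      ifSome (incr b <| jump (.move a b ret)) (jump (.main ret))
  | .emit a ret => popTo (.ctr a) <|
      ifSome (incr .aux <| write [true] <| jump (.emit a ret)) (jump (.move .aux a ret))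

/-- The contents of the stacks. -/
def stackMap (inp out adj : List Bool) (f : Counter → ℕ) : StackName → List Bool
  | .inp => inp
  | .out => out
  | .adj => adj
  | .ctr c => List.replicate (f c) true

/-- The values of the counters. -/
def counters (lo hi tmp aux : ℕ) : Counter → ℕ
  | .lo => lo
  | .hi => hi
  | .tmp => tmp
  | .aux => aux

section stackMap

variable (inp out adj l : List Bool) (f : Counter → ℕ)

@[simp] theorem update_stackMap_inp :
    Function.update (stackMap inp out adj f) .inp l = stackMap l out adj f := by
  funext k; cases k <;> simp [stackMap, Function.update]

@[simp] theorem update_stackMap_out :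
    Function.update (stackMap inp out adj f) .out l = stackMap inp l adj f := by
  funext k; cases k <;> simp [stackMap, Function.update]

@[simp] theorem update_stackMap_adj :
    Function.update (stackMap inp out adj f) .adj l = stackMap inp out l f := by
  funext k; cases k <;> simp [stackMap, Function.update]

theorem update_stackMap_ctr (c : Counter) (k : ℕ) :
    Function.update (stackMap inp out adj f) (.ctr c) (List.replicate k true)
      = stackMap inp out adj (Function.update f c k) := by
  funext j
  cases j with
  | ctr d =>
    by_cases h : d = c
    · subst h; simp [stackMap]
    · rw [Function.update_of_ne (by simpa using h)]
      simp [stackMap, Function.update_of_ne h]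
  | _ => simp [stackMap, Function.update]

end stackMap

@[simp] theorem update_counters_lo (a b c d k : ℕ) :
    Function.update (counters a b c d) .lo k = counters k b c d := by
  funext j; cases j <;> simp [counters, Function.update]

@[simp] theorem update_counters_hi (a b c d k : ℕ) :
    Function.update (counters a b c d) .hi k = counters a k c d := by
  funext j; cases j <;> simp [counters, Function.update]

@[simp] theorem update_counters_tmp (a b c d k : ℕ) :
    Function.update (counters a b c d) .tmp k = counters a b k d := by
  funext j; cases j <;> simp [counters, Function.update]

/-! ### Runs of the machine -/

/-- The configurations of the machine. -/
abbrev MachineCfg (B : ℕ) : Type :=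
  Turing.TM2.Cfg (fun _ : StackName => Bool) Label (MachineState B)

/-- The machine goes from one configuration to another in at most `t` steps. -/
def RunsIn {B : ℕ} (T : List Bool → Option Bool) (t : ℕ) (c d : MachineCfg B) : Prop :=
  ∃ k ≤ t, (flip bind (Turing.TM2.step (machineProgram T)))^[k] (some c) = some d

section runs

variable {B : ℕ} {T : List Bool → Option Bool}

theorem RunsIn.trans {s t : ℕ} {c d e : MachineCfg B} (h : RunsIn T s c d) (h' : RunsIn T t d e) :
    RunsIn T (s + t) c e := by
  obtain ⟨k, hk, h⟩ := h
  obtain ⟨k', hk', h'⟩ := h'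
  exact ⟨k' + k, by omega, by rw [Function.iterate_add_apply, h, h']⟩

theorem RunsIn.mono {s t : ℕ} {c d : MachineCfg B} (h : RunsIn T s c d) (hst : s ≤ t) :
    RunsIn T t c d := by
  obtain ⟨k, hk, h⟩ := h
  exact ⟨k, hk.trans hst, h⟩

theorem RunsIn.of_step {l : Label} {v : MachineState B} {S : StackName → List Bool}
    {d : MachineCfg B} (h : Turing.TM2.stepAux (machineProgram T l) v S = d) :
    RunsIn T 1 ⟨some l, v, S⟩ d :=
  ⟨1, le_rfl, by rw [← h]; rfl⟩

/-- The machine goes from one label to another and transforms the stacks in at most `t` steps,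
whatever its internal state. -/
def Leads (B : ℕ) (T : List Bool → Option Bool) (t : ℕ) (l : Label) (S : StackName → List Bool)
    (l' : Label) (S' : StackName → List Bool) : Prop :=
  ∀ v : MachineState B, ∃ v' : MachineState B,
    RunsIn T t ⟨some l, v, S⟩ ⟨some l', v', S'⟩

theorem Leads.trans {s t : ℕ} {l l' l'' : Label} {S S' S'' : StackName → List Bool}
    (h : Leads B T s l S l' S') (h' : Leads B T t l' S' l'' S'') :
    Leads B T (s + t) l S l'' S'' := by
  intro v
  obtain ⟨v', h1⟩ := h v
  obtain ⟨v'', h2⟩ := h' v'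
  exact ⟨v'', h1.trans h2⟩

theorem Leads.mono {s t : ℕ} {l l' : Label} {S S' : StackName → List Bool}
    (h : Leads B T s l S l' S') (hst : s ≤ t) : Leads B T t l S l' S' := fun v =>
  let ⟨v', h1⟩ := h v
  ⟨v', h1.mono hst⟩

theorem Leads.congr {s t : ℕ} {l l' : Label} {S S' S'' : StackName → List Bool}
    (h : Leads B T s l S l' S') (hst : s ≤ t) (hS : S' = S'') : Leads B T t l S l' S'' :=
  hS ▸ h.mono hst

theorem Leads.of_step {l l' : Label} {S S' : StackName → List Bool}
    (h : ∀ v : MachineState B, ∃ v' : MachineState B,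
      Turing.TM2.stepAux (machineProgram T l) v S = ⟨some l', v', S'⟩) :
    Leads B T 1 l S l' S' := fun v =>
  let ⟨v', h1⟩ := h v
  ⟨v', RunsIn.of_step h1⟩

/-- The recursion pushes the last letter first, so the word lands in reading order on top of the
output. The machine composes its whole output from the end. -/
theorem stepAux_write (w : List Bool) (q : MachineStmt B) (v : MachineState B)
    (S : StackName → List Bool) :
    Turing.TM2.stepAux (MachineStmt.write w q) v S
      = Turing.TM2.stepAux q v (Function.update S .out (w ++ S .out)) := by
  induction w generalizing q with
  | nil => simp [MachineStmt.write]
  | cons b w ih => rw [MachineStmt.write, ih]; simp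

theorem stepAux_incr (c : Counter) (q : MachineStmt B) (v : MachineState B)
    (inp out adj : List Bool) (f : Counter → ℕ) :
    Turing.TM2.stepAux (MachineStmt.incr c q) v (stackMap inp out adj f)
      = Turing.TM2.stepAux q v (stackMap inp out adj (Function.update f c (f c + 1))) := by
  rw [← update_stackMap_ctr, List.replicate_succ]
  rfl

theorem stepAux_popTo_ctr_zero {c : Counter} (q r : MachineStmt B) (v : MachineState B)
    (inp out adj : List Bool) {f : Counter → ℕ} (hf : f c = 0) :
    Turing.TM2.stepAux (MachineStmt.popTo (.ctr c) (MachineStmt.ifSome q r)) v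
      (stackMap inp out adj f)
      = Turing.TM2.stepAux r (none, v.2) (stackMap inp out adj f) := by
  have h1 : stackMap inp out adj f = Function.update (stackMap inp out adj f) (.ctr c) [] := by
    rw [← List.replicate_zero (a := true), update_stackMap_ctr, ← hf, Function.update_eq_self]
  have h2 : stackMap inp out adj f (.ctr c) = [] := by simp [stackMap, hf]
  nth_rewrite 2 [h1]
  simp only [MachineStmt.popTo, MachineStmt.ifSome, Turing.TM2.stepAux, h2]
  rfl

theorem stepAux_popTo_ctr_succ {c : Counter} (q r : MachineStmt B) (v : MachineState B)
    (inp out adj : List Bool) {f : Counter → ℕ} {k : ℕ} (hf : f c = k + 1) :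
    Turing.TM2.stepAux (MachineStmt.popTo (.ctr c) (MachineStmt.ifSome q r)) v
      (stackMap inp out adj f)
      = Turing.TM2.stepAux q (some true, v.2)
        (stackMap inp out adj (Function.update f c k)) := by
  have h2 : stackMap inp out adj f (.ctr c) = true :: List.replicate k true := by
    rw [← List.replicate_succ, ← hf]; rfl
  rw [← update_stackMap_ctr]
  simp only [MachineStmt.popTo, MachineStmt.ifSome, Turing.TM2.stepAux, h2]
  rfl

theorem stepAux_popTo_adj (q : MachineStmt B) (v : MachineState B)
    (inp out adj : List Bool) (f : Counter → ℕ) :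
    Turing.TM2.stepAux (MachineStmt.popTo .adj q) v (stackMap inp out adj f)
      = Turing.TM2.stepAux q (adj.head?, v.2) (stackMap inp out adj.tail f) := by
  rw [← update_stackMap_adj inp out adj adj.tail f]
  rfl

theorem stepAux_popBuffered_inp (q : MachineStmt B) (v : MachineState B)
    (inp out adj : List Bool) (f : Counter → ℕ) :
    Turing.TM2.stepAux (MachineStmt.popBuffered .inp q) v (stackMap inp out adj f)
      = Turing.TM2.stepAux q (inp.head?, inp.head?.elim v.2 v.2.push)
        (stackMap inp.tail out adj f) := by
  rw [← update_stackMap_inp inp out adj inp.tail f]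
  rfl

theorem stepAux_ifSome (q r : MachineStmt B) (v : MachineState B) (S : StackName → List Bool) :
    Turing.TM2.stepAux (MachineStmt.ifSome q r) v S
      = cond v.1.isSome (Turing.TM2.stepAux q v S) (Turing.TM2.stepAux r v S) := rfl

theorem stepAux_ifOne (q r : MachineStmt B) (v : MachineState B) (S : StackName → List Bool) :
    Turing.TM2.stepAux (MachineStmt.ifOne q r) v S
      = cond (v.1.getD false) (Turing.TM2.stepAux q v S) (Turing.TM2.stepAux r v S) := rfl

theorem stepAux_jump (l : Label) (v : MachineState B) (S : StackName → List Bool) :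
    Turing.TM2.stepAux (MachineStmt.jump l) v S = ⟨some l, v, S⟩ := rfl

theorem update_update_update_update (f : Counter → ℕ) (a b : Counter) (k x z y : ℕ) :
    Function.update (Function.update (Function.update (Function.update f a k) b x) a z) b y
      = Function.update (Function.update f a z) b y := by
  funext c
  by_cases h1 : c = b
  · subst h1; simp
  · by_cases h2 : c = a
    · subst h2; simp [Function.update_of_ne h1]
    · simp [Function.update_of_ne h1, Function.update_of_ne h2]

theorem leads_move (a b : Counter) (hab : a ≠ b) (ret : MainLabel) (inp out adj : List Bool)
    (f : Counter → ℕ) :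
    Leads B T (f a + 1) (.move a b ret) (stackMap inp out adj f) (.main ret)
      (stackMap inp out adj (Function.update (Function.update f a 0) b (f b + f a))) := by
  generalize hk : f a = k
  induction k generalizing f with
  | zero =>
    refine Leads.of_step fun v => ⟨(none, v.2), ?_⟩
    have h1 : Function.update (Function.update f a 0) b (f b + 0) = f := by
      rw [← hk, Function.update_eq_self, hk, add_zero, Function.update_eq_self]
    rw [h1]
    simp only [machineProgram, stepAux_popTo_ctr_zero _ _ _ _ _ _ hk, stepAux_jump]
  | succ k ih =>
    have h1 : Leads B T 1 (.move a b ret) (stackMap inp out adj f) (.move a b ret)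
        (stackMap inp out adj (Function.update (Function.update f a k) b (f b + 1))) := by
      refine Leads.of_step fun v => ⟨(some true, v.2), ?_⟩
      simp only [machineProgram, stepAux_popTo_ctr_succ _ _ _ _ _ _ hk, stepAux_jump, stepAux_incr,
        Function.update_of_ne hab.symm]
    have h2 := ih (Function.update (Function.update f a k) b (f b + 1))
      (by rw [Function.update_of_ne hab, Function.update_self])
    refine (h1.trans h2).congr (by omega) ?_
    rw [Function.update_self, update_update_update_update, Nat.add_assoc, Nat.add_comm 1]

/-- Writing a counter destroys it, so a copy is collected in `aux` and moved back. Hence `aux` must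
start empty, and each unit costs two steps. -/
theorem leads_emit (a : Counter) (ha : a ≠ .aux) (ret : MainLabel) (inp out adj : List Bool)
    (f : Counter → ℕ) (hf : f .aux = 0) :
    Leads B T (2 * f a + 2) (.emit a ret) (stackMap inp out adj f) (.main ret)
      (stackMap inp (List.replicate (f a) true ++ out) adj f) := by
  have key : ∀ (k : ℕ) (out : List Bool) (f : Counter → ℕ), f a = k →
      Leads B T (k + 1) (.emit a ret) (stackMap inp out adj f) (.move .aux a ret)
        (stackMap inp (List.replicate k true ++ out) adj
          (Function.update (Function.update f a 0) .aux (f .aux + k))) := by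
    intro k
    induction k with
    | zero =>
      intro out f hk
      refine Leads.of_step fun v => ⟨(none, v.2), ?_⟩
      have h1 : Function.update (Function.update f a 0) .aux (f .aux + 0) = f := by
        rw [← hk, Function.update_eq_self, hk, add_zero, Function.update_eq_self]
      rw [h1]
      simp only [machineProgram, stepAux_popTo_ctr_zero _ _ _ _ _ _ hk, stepAux_jump,
        List.replicate_zero, List.nil_append]
    | succ k ih =>
      intro out f hk
      have h1 : Leads B T 1 (.emit a ret) (stackMap inp out adj f) (.emit a ret)
          (stackMap inp (true :: out) adj
            (Function.update (Function.update f a k) .aux (f .aux + 1))) := by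
        refine Leads.of_step fun v => ⟨(some true, v.2), ?_⟩
        simp only [machineProgram, stepAux_popTo_ctr_succ _ _ _ _ _ _ hk, stepAux_jump,
          stepAux_incr, stepAux_write, Function.update_of_ne ha.symm, update_stackMap_out]
        rfl
      have h2 := ih (true :: out) (Function.update (Function.update f a k) .aux (f .aux + 1))
        (by rw [Function.update_of_ne ha, Function.update_self])
      refine (h1.trans h2).congr (by omega) ?_
      rw [Function.update_self, update_update_update_update, Nat.add_assoc, Nat.add_comm 1,
        List.replicate_succ', List.append_assoc]
      rfl
  have h := (key (f a) out f rfl).trans (leads_move .aux a ha.symm ret inp _ adj _)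
  refine h.congr (by simp [hf]; omega) ?_
  congr 1
  funext c
  by_cases h1 : c = a
  · subst h1; simp [Function.update_of_ne ha, hf]
  · rw [Function.update_of_ne h1]
    by_cases h2 : c = .aux
    · subst h2; simp [hf]
    · simp [Function.update_of_ne h1, Function.update_of_ne h2]

end runs

/-! ### Correctness of the machine -/

/-- A number is assembled from its end marker by batches of ones, so sums and successors of counters
are written without being computed. -/
theorem replicate_append_unaryCode (k m : ℕ) (l : List Bool) :
    List.replicate k true ++ (unaryCode m ++ l) = unaryCode (k + m) ++ l := by
  rw [unaryCode, unaryCode, List.replicate_add]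
  simp only [List.append_assoc]

/-- The code of the gate for an edge. -/
def edgeWord (i j : ℕ) : List Bool :=
  unaryCode 6 ++ unaryCode 0 ++ unaryCode (j + 1) ++ unaryCode (i + 1)

/-- The code of the gates for a vertex, without those for its edges. -/
def vertexWord (i : ℕ) : List Bool :=
  (unaryCode 2 ++ unaryCode (i + 1)) ++ ((unaryCode 1 ++ unaryCode 0) ++
    ((unaryCode 5 ++ unaryCode 0 ++ unaryCode (i + 1)) ++ (unaryCode 1 ++ unaryCode 0)))

/-- The code of the gates for the edges from `i` to vertices below `k`. -/
def edgesWord (A : ℕ → ℕ → Bool) (i k : ℕ) : List Bool :=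
  (List.range k).flatMap fun j => if A i j then edgeWord i j else []

/-- The code of the circuit of a graph. -/
def circuitWord (A : ℕ → ℕ → Bool) (n : ℕ) : List Bool :=
  (unaryCode 2 ++ unaryCode 0) ++
    ((List.range n).flatMap (fun i => vertexWord i ++ edgesWord A i i) ++
      (unaryCode 2 ++ unaryCode 0 ++ (unaryCode 3 ++ unaryCode 0) ++ unaryCode 0))

/-- The first `k` rows of an adjacency matrix of size `n`. -/
def rowsWord (A : ℕ → ℕ → Bool) (n k : ℕ) : List Bool :=
  (List.range k).flatMap fun i => (List.range n).map (A i)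

section runs

variable {B : ℕ} {T : List Bool → Option Bool}

/-- The invariant is that `k` columns remain and `t` are done. No single counter stores `i` during
the loop; it is recovered as the sum of `lo` and `tmp`. -/
theorem leads_cols (c : Bool) (A : ℕ → ℕ → Bool) (i hi : ℕ) (inp rest : List Bool) :
    ∀ (k t : ℕ) (out : List Bool), k + t = i →
      Leads B T ((4 * i + 12) * k + (i + 2)) (.main (.cols c))
        (stackMap inp out (((List.range k).map (A i)).reverse ++ rest) (counters k hi t 0))
        (.main (.vertexFst c))
        (stackMap inp (edgesWord A i k ++ out) rest (counters i hi 0 0)) := by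
  intro k
  induction k with
  | zero =>
    intro t out hk
    have h1 : Leads B T 1 (.main (.cols c)) (stackMap inp out rest (counters 0 hi t 0))
        (.move .tmp .lo (.vertexFst c)) (stackMap inp out rest (counters 0 hi t 0)) := by
      refine Leads.of_step fun v => ⟨(none, v.2), ?_⟩
      simp only [machineProgram]
      rw [stepAux_popTo_ctr_zero _ _ _ _ _ _ rfl, stepAux_jump]
    have h2 := leads_move (B := B) (T := T) .tmp .lo (by decide) (.vertexFst c) inp out rest
      (counters 0 hi t 0)
    refine (h1.trans h2).congr (by simp only [counters]; omega) ?_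
    simp only [update_counters_tmp, update_counters_lo, counters, zero_add, edgesWord]
    rw [← hk, zero_add]
    rfl
  | succ k ih =>
    intro t out hk
    have hadj : ((List.range (k + 1)).map (A i)).reverse ++ rest
        = A i k :: (((List.range k).map (A i)).reverse ++ rest) := by
      rw [List.range_succ]; simp
    rw [hadj]
    set adj := ((List.range k).map (A i)).reverse ++ rest with hadj'
    have hword : edgesWord A i (k + 1) = edgesWord A i k ++ if A i k then edgeWord i k else [] := by
      rw [edgesWord, List.range_succ, List.flatMap_append, List.flatMap_singleton]; rfl
    cases hA : A i k
    · have h1 : Leads B T 1 (.main (.cols c))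
          (stackMap inp out (false :: adj) (counters (k + 1) hi t 0)) (.main (.cols c))
          (stackMap inp out adj (counters k hi (t + 1) 0)) := by
        refine Leads.of_step fun v => ⟨(some false, v.2), ?_⟩
        simp only [machineProgram]
        rw [stepAux_popTo_ctr_succ (k := k) _ _ _ _ _ _ rfl, stepAux_incr, stepAux_popTo_adj,
          stepAux_ifOne, stepAux_jump, update_counters_lo, update_counters_tmp]
        rfl
      refine (h1.trans (ih (t + 1) out (by omega))).congr (by ring_nf; omega) ?_
      rw [hword, hA]; simp
    · have h1 : Leads B T 1 (.main (.cols c))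
          (stackMap inp out (true :: adj) (counters (k + 1) hi t 0)) (.emit .lo (.edgeFst c))
          (stackMap inp (unaryCode 1 ++ out) adj (counters k hi (t + 1) 0)) := by
        refine Leads.of_step fun v => ⟨(some true, v.2), ?_⟩
        simp only [machineProgram]
        rw [stepAux_popTo_ctr_succ (k := k) _ _ _ _ _ _ rfl, stepAux_incr, stepAux_popTo_adj,
          stepAux_ifOne, stepAux_write, stepAux_jump, update_counters_lo, update_counters_tmp,
          update_stackMap_out]
        rfl
      have h2 := leads_emit (B := B) (T := T) .lo (by decide) (.edgeFst c) inp
        (unaryCode 1 ++ out) adj (counters k hi (t + 1) 0) rfl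
      have h3 : ∀ S, Leads B T 1 (.main (.edgeFst c)) S (.emit .tmp (.edgeSnd c)) S :=
        fun S => Leads.of_step fun v => ⟨v, rfl⟩
      have h4 := leads_emit (B := B) (T := T) .tmp (by decide) (.edgeSnd c) inp
        (List.replicate k true ++ (unaryCode 1 ++ out)) adj (counters k hi (t + 1) 0) rfl
      have h5 : ∀ out f, Leads B T 1 (.main (.edgeSnd c)) (stackMap inp out adj f)
          (.emit .lo (.edgeEnd c)) (stackMap inp (unaryCode 1 ++ out) adj f) := by
        refine fun out f => Leads.of_step fun v => ⟨v, ?_⟩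
        simp only [machineProgram]
        rw [stepAux_write, stepAux_jump, update_stackMap_out]
        rfl
      have h6 := fun out => leads_emit (B := B) (T := T) .lo (by decide) (.edgeEnd c) inp
        out adj (counters k hi (t + 1) 0) rfl
      have h7 : ∀ out f, Leads B T 1 (.main (.edgeEnd c)) (stackMap inp out adj f)
          (.main (.cols c)) (stackMap inp (unaryCode 6 ++ unaryCode 0 ++ out) adj f) := by
        refine fun out f => Leads.of_step fun v => ⟨v, ?_⟩
        simp only [machineProgram]
        rw [stepAux_write, stepAux_jump, update_stackMap_out]
        rfl
      refine ((((((((h1.trans h2).trans (h3 _)).trans h4).trans (h5 _ _)).trans (h6 _)).trans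
        (h7 _ _)).trans (ih (t + 1) _ (by omega)))).congr ?_ ?_
      · simp only [counters]
        -- One edge costs 4k + 2t + 12 steps, at most 4i + 12 because k + 1 + t = i.
        have : (4 * i + 12) * (k + 1) = (4 * i + 12) * k + (4 * i + 12) := by ring
        omega
      · rw [hword, hA, if_pos rfl, edgeWord]
        simp only [counters, replicate_append_unaryCode, List.append_assoc]
        rw [show t + 1 + (k + 1) = i + 1 by omega]

/-- The circuit creates an edge at its larger end, so the columns from the diagonal on are
discarded; `tmp` keeps their number so that `hi` can be restored. -/
theorem leads_skip (c : Bool) (lo : ℕ) (inp out rest : List Bool) :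
    ∀ (l : List Bool) (t : ℕ),
      Leads B T (l.length + 1) (.main (.skip c))
        (stackMap inp out (l ++ rest) (counters lo l.length t 0))
        (.move .tmp .hi (.cols c))
        (stackMap inp out rest (counters lo 0 (t + l.length) 0)) := by
  intro l
  induction l with
  | nil =>
    refine fun t => Leads.of_step fun v => ⟨(none, v.2), ?_⟩
    simp only [machineProgram]
    rw [stepAux_popTo_ctr_zero _ _ _ _ _ _ rfl, stepAux_jump]
    rfl
  | cons b l ih =>
    intro t
    have h1 : Leads B T 1 (.main (.skip c))
        (stackMap inp out (b :: (l ++ rest)) (counters lo (l.length + 1) t 0)) (.main (.skip c))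
        (stackMap inp out (l ++ rest) (counters lo l.length (t + 1) 0)) := by
      refine Leads.of_step fun v => ⟨(some b, v.2), ?_⟩
      simp only [machineProgram]
      rw [stepAux_popTo_ctr_succ (k := l.length) _ _ _ _ _ _ rfl, stepAux_incr, stepAux_popTo_adj,
        stepAux_jump, update_counters_hi, update_counters_tmp]
      rfl
    refine (h1.trans (ih (t + 1))).congr (by simp; omega) ?_
    rw [List.length_cons]
    congr 2
    omega

theorem leads_vertex (c : Bool) (i hi : ℕ) (inp out adj : List Bool) :
    Leads B T (4 * i + 7) (.main (.vertexFst c)) (stackMap inp out adj (counters i hi 0 0))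
      (.main (.row c)) (stackMap inp (vertexWord i ++ out) adj (counters i hi 0 0)) := by
  have h1 : ∀ out f, Leads B T 1 (.main (.vertexFst c)) (stackMap inp out adj f)
      (.emit .lo (.vertexSnd c))
      (stackMap inp (unaryCode 1 ++ (unaryCode 1 ++ unaryCode 0) ++ out) adj f) := by
    refine fun out f => Leads.of_step fun v => ⟨v, ?_⟩
    simp only [machineProgram]
    rw [stepAux_write, stepAux_jump, update_stackMap_out]
    rfl
  have h3 : ∀ out f, Leads B T 1 (.main (.vertexSnd c)) (stackMap inp out adj f)
      (.emit .lo (.vertexEnd c))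
      (stackMap inp (unaryCode 1 ++ (unaryCode 1 ++ unaryCode 0) ++ (unaryCode 5 ++ unaryCode 0)
        ++ out) adj f) := by
    refine fun out f => Leads.of_step fun v => ⟨v, ?_⟩
    simp only [machineProgram]
    rw [stepAux_write, stepAux_jump, update_stackMap_out]
    rfl
  have h5 : ∀ out f, Leads B T 1 (.main (.vertexEnd c)) (stackMap inp out adj f)
      (.main (.row c)) (stackMap inp (unaryCode 2 ++ out) adj f) := by
    refine fun out f => Leads.of_step fun v => ⟨v, ?_⟩
    simp only [machineProgram]
    rw [stepAux_write, stepAux_jump, update_stackMap_out]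
    rfl
  have h2 := fun ret out => leads_emit (B := B) (T := T) .lo (by decide) ret inp
    out adj (counters i hi 0 0) rfl
  refine (((((h1 _ _).trans (h2 _ _)).trans (h3 _ _)).trans (h2 _ _)).trans (h5 _ _)).congr ?_ ?_
  · simp only [counters]; omega
  · simp only [vertexWord, counters, replicate_append_unaryCode, List.append_assoc]

theorem leads_row (c : Bool) (A : ℕ → ℕ → Bool) (n i h : ℕ) (hn : i + 1 + h = n)
    (inp out rest : List Bool) :
    Leads B T (4 * n * n + 19 * n + 14) (.main (.row c))
      (stackMap inp out (((List.range n).map (A i)).reverse ++ rest) (counters (i + 1) h 0 0))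
      (.main (.row c))
      (stackMap inp (vertexWord i ++ edgesWord A i i ++ out) rest (counters i (h + 1) 0 0)) := by
  -- Reversed, a row begins with the `h + 1` columns at or beyond the diagonal, which are to be
  -- skipped.
  have hsplit : ((List.range n).map (A i)).reverse ++ rest
      = (((List.range (h + 1)).map fun j => A i (i + j)).reverse)
        ++ (((List.range i).map (A i)).reverse ++ rest) := by
    rw [show n = i + (h + 1) by omega, List.range_add]
    simp [Function.comp_def]
  rw [hsplit]
  set l := ((List.range (h + 1)).map fun j => A i (i + j)).reverse with hl
  have hlen : l.length = h + 1 := by simp [hl]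
  have h1 : ∀ adj, Leads B T 1 (.main (.row c)) (stackMap inp out adj (counters (i + 1) h 0 0))
      (.main (.skip c)) (stackMap inp out adj (counters i (h + 1) 0 0)) := by
    refine fun adj => Leads.of_step fun v => ⟨(some true, v.2), ?_⟩
    simp only [machineProgram]
    rw [stepAux_popTo_ctr_succ (k := i) _ _ _ _ _ _ rfl, stepAux_incr, stepAux_jump,
      update_counters_lo, update_counters_hi]
    rfl
  have h2 := leads_skip (B := B) (T := T) c i inp out (((List.range i).map (A i)).reverse ++ rest) l 0
  rw [hlen] at h2
  have h3 := leads_move (B := B) (T := T) .tmp .hi (by decide) (.cols c) inp out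
    (((List.range i).map (A i)).reverse ++ rest) (counters i 0 (0 + (h + 1)) 0)
  simp only [update_counters_tmp, update_counters_hi, counters, zero_add] at h2 h3
  have h4 := leads_cols (B := B) (T := T) c A i (h + 1) inp rest i 0 out (by omega)
  have h5 := leads_vertex (B := B) (T := T) c i (h + 1) inp (edgesWord A i i ++ out) rest
  refine (((((h1 _).trans h2).trans h3).trans h4).trans h5).congr ?_ ?_
  · have hi : i ≤ n := by omega
    have : (4 * i + 12) * i ≤ (4 * n + 12) * n := by gcongr
    nlinarith
  · rw [List.append_assoc]

theorem leads_rows (c : Bool) (A : ℕ → ℕ → Bool) (n : ℕ) (inp rest : List Bool) :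
    ∀ (i h : ℕ) (out : List Bool), i + h = n →
    Leads B T (i * (4 * n * n + 19 * n + 14)) (.main (.row c))
      (stackMap inp out ((rowsWord A n i).reverse ++ rest) (counters i h 0 0))
      (.main (.row c))
      (stackMap inp ((List.range i).flatMap (fun i => vertexWord i ++ edgesWord A i i) ++ out) rest
        (counters 0 n 0 0)) := by
  intro i
  induction i with
  | zero =>
    intro h out hn
    rw [zero_add] at hn
    subst hn
    exact fun v => ⟨v, 0, by omega, rfl⟩
  | succ i ih =>
    intro h out hn
    have hrows : (rowsWord A n (i + 1)).reverse ++ rest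
        = ((List.range n).map (A i)).reverse ++ ((rowsWord A n i).reverse ++ rest) := by
      rw [rowsWord, List.range_succ]
      simp [rowsWord]
    rw [hrows]
    have h1 := leads_row (B := B) (T := T) c A n i h hn inp out ((rowsWord A n i).reverse ++ rest)
    have h2 := ih (h + 1) (vertexWord i ++ edgesWord A i i ++ out) (by omega)
    refine (h1.trans h2).congr (by rw [add_mul]; omega) ?_
    simp only [List.range_succ, List.flatMap_append, List.flatMap_singleton, List.append_assoc]

/-- The closing move resets `lo` to `n`, so the same code can run for the other circuit or proceed
to the qubit count. -/
theorem leads_circuit (c : Bool) (A : ℕ → ℕ → Bool) (n : ℕ) (inp out rest : List Bool) :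
    Leads B T (n * (4 * n * n + 19 * n + 14) + (n + 3)) (.main (.circuit c))
      (stackMap inp out ((rowsWord A n n).reverse ++ rest) (counters n 0 0 0))
      (.main (if c then .circuit false else .finish))
      (stackMap inp (circuitWord A n ++ out) rest (counters n 0 0 0)) := by
  have h1 : ∀ out adj f, Leads B T 1 (.main (.circuit c)) (stackMap inp out adj f)
      (.main (.row c))
      (stackMap inp (unaryCode 2 ++ unaryCode 0 ++ (unaryCode 3 ++ unaryCode 0) ++ unaryCode 0
        ++ out) adj f) := by
    refine fun out adj f => Leads.of_step fun v => ⟨v, ?_⟩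
    simp only [machineProgram]
    rw [stepAux_write, stepAux_jump, update_stackMap_out]
    rfl
  have h2 := fun out => leads_rows (B := B) (T := T) c A n inp rest n 0 out (by omega)
  have h3 : ∀ out adj h, Leads B T 1 (.main (.row c)) (stackMap inp out adj (counters 0 h 0 0))
      (.move .hi .lo (if c then .circuit false else .finish))
      (stackMap inp (unaryCode 2 ++ unaryCode 0 ++ out) adj (counters 0 h 0 0)) := by
    refine fun out adj h => Leads.of_step fun v => ⟨(none, v.2), ?_⟩
    simp only [machineProgram]
    rw [stepAux_popTo_ctr_zero _ _ _ _ _ _ rfl, stepAux_write, stepAux_jump, update_stackMap_out]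
    rfl
  have h4 := fun out => leads_move (B := B) (T := T) .hi .lo (by decide)
    (if c then .circuit false else .finish) inp out rest (counters 0 n 0 0)
  simp only [update_counters_hi, update_counters_lo, counters, zero_add] at h4
  refine ((((h1 _ _ _).trans (h2 _)).trans (h3 _ _ _)).trans (h4 _)).congr (by omega) ?_
  simp only [circuitWord, List.append_assoc]

theorem leads_drain (inp adj : List Bool) : ∀ (k : ℕ) (out : List Bool),
    Leads B T (k + 1) (.main .drain) (stackMap inp out adj (counters k 0 0 0))
      (.main .clear) (stackMap inp (List.replicate k true ++ out) adj (counters 0 0 0 0)) := by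
  intro k
  induction k with
  | zero =>
    refine fun out => Leads.of_step fun v => ⟨(none, v.2), ?_⟩
    simp only [machineProgram]
    rw [stepAux_popTo_ctr_zero _ _ _ _ _ _ rfl, stepAux_jump]
    rfl
  | succ k ih =>
    intro out
    have h1 : Leads B T 1 (.main .drain) (stackMap inp out adj (counters (k + 1) 0 0 0))
        (.main .drain) (stackMap inp (true :: out) adj (counters k 0 0 0)) := by
      refine Leads.of_step fun v => ⟨(some true, v.2), ?_⟩
      simp only [machineProgram]
      rw [stepAux_popTo_ctr_succ (k := k) _ _ _ _ _ _ rfl, stepAux_write, stepAux_jump,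
        update_stackMap_out, update_counters_lo]
      rfl
    refine (h1.trans (ih _)).congr (by omega) ?_
    rw [List.replicate_succ', List.append_assoc]
    rfl

theorem leads_finish (n : ℕ) (inp out adj : List Bool) :
    Leads B T (n + 2) (.main .finish) (stackMap inp out adj (counters n 0 0 0))
      (.main .clear) (stackMap inp (unaryCode (n + 1) ++ out) adj (counters 0 0 0 0)) := by
  have h1 : Leads B T 1 (.main .finish) (stackMap inp out adj (counters n 0 0 0))
      (.main .drain) (stackMap inp (unaryCode 1 ++ out) adj (counters n 0 0 0)) := by
    refine Leads.of_step fun v => ⟨v, ?_⟩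
    simp only [machineProgram]
    rw [stepAux_write, stepAux_jump, update_stackMap_out]
    rfl
  refine (h1.trans (leads_drain inp adj n _)).congr (by omega) ?_
  rw [replicate_append_unaryCode]

/-- The configuration in which the machine halts. -/
def haltCfg (B : ℕ) (out : List Bool) : MachineCfg B :=
  ⟨none, (none, Buffer.ofList B []), stackMap [] out [] (counters 0 0 0 0)⟩

theorem runsIn_clear (out : List Bool) : ∀ (adj : List Bool) (v : MachineState B),
    RunsIn T (adj.length + 1)
      ⟨some (.main .clear), v, stackMap [] out adj (counters 0 0 0 0)⟩ (haltCfg B out) := by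
  intro adj
  induction adj with
  | nil =>
    refine fun v => RunsIn.of_step ?_
    simp only [machineProgram]
    rw [stepAux_popTo_adj, stepAux_ifSome]
    rfl
  | cons b adj ih =>
    intro v
    have h1 : RunsIn T 1
        ⟨some (.main .clear), v, stackMap [] out (b :: adj) (counters 0 0 0 0)⟩
        ⟨some (.main .clear), (some b, v.2), stackMap [] out adj (counters 0 0 0 0)⟩ := by
      refine RunsIn.of_step ?_
      simp only [machineProgram]
      rw [stepAux_popTo_adj, stepAux_ifSome]
      rfl
    exact (h1.trans (ih _)).mono (by simp; omega)

/-- Until the dispatch the internal state matters, so `RunsIn` with an explicit buffer replaces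
`Leads`. The counter and buffer are generalized for the induction. -/
theorem runsIn_readSize (bits : List Bool) : ∀ (n m : ℕ) (o : Option Bool) (pre : List Bool),
    RunsIn T (n + 1)
      ⟨some (.main .readSize), (o, Buffer.ofList B pre),
        stackMap (unaryCode n ++ bits) [] [] (counters m 0 0 0)⟩
      ⟨some (.main .readBits), (some false, Buffer.ofList B ((unaryCode n).reverse ++ pre)),
        stackMap bits [] [] (counters (m + n) 0 0 0)⟩ := by
  intro n
  induction n with
  | zero =>
    refine fun m o pre => RunsIn.of_step ?_
    simp only [machineProgram]
    rw [stepAux_popBuffered_inp, stepAux_ifOne]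
    change Turing.TM2.Cfg.mk _ (some false, (Buffer.ofList B pre).push false) _ = _
    rw [Buffer.push_ofList]
    rfl
  | succ n ih =>
    intro m o pre
    have h1 : RunsIn T 1
        ⟨some (.main .readSize), (o, Buffer.ofList B pre),
          stackMap (unaryCode (n + 1) ++ bits) [] [] (counters m 0 0 0)⟩
        ⟨some (.main .readSize), (some true, Buffer.ofList B (true :: pre)),
          stackMap (unaryCode n ++ bits) [] [] (counters (m + 1) 0 0 0)⟩ := by
      refine RunsIn.of_step ?_
      simp only [machineProgram]
      rw [stepAux_popBuffered_inp, stepAux_ifOne, stepAux_incr, stepAux_jump, update_counters_lo]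
      change Turing.TM2.Cfg.mk _ (some true, (Buffer.ofList B pre).push true) _ = _
      rw [Buffer.push_ofList]
      rfl
    have h2 := h1.trans (ih (m + 1) (some true) (true :: pre))
    have h3 : (unaryCode (n + 1)).reverse ++ pre = (unaryCode n).reverse ++ true :: pre := by
      rw [unaryCode, unaryCode, List.reverse_append, List.reverse_append, List.reverse_replicate,
        List.reverse_replicate, List.replicate_succ']
      simp only [List.append_assoc, List.singleton_append]
    rw [h3, show m + (n + 1) = m + 1 + n by omega]
    exact h2.mono (by omega)

theorem runsIn_readBits (f : Counter → ℕ) :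
    ∀ (bits adj : List Bool) (o : Option Bool) (pre : List Bool),
    RunsIn T (bits.length + 1)
      ⟨some (.main .readBits), (o, Buffer.ofList B pre), stackMap bits [] adj f⟩
      ⟨some (.main .dispatch), (none, Buffer.ofList B (bits.reverse ++ pre)),
        stackMap [] [] (bits.reverse ++ adj) f⟩ := by
  intro bits
  induction bits with
  | nil =>
    refine fun adj o pre => RunsIn.of_step ?_
    simp only [machineProgram]
    rw [stepAux_popBuffered_inp, stepAux_ifSome]
    rfl
  | cons b bits ih =>
    intro adj o pre
    have h1 : RunsIn T 1
        ⟨some (.main .readBits), (o, Buffer.ofList B pre), stackMap (b :: bits) [] adj f⟩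
        ⟨some (.main .readBits), (some b, Buffer.ofList B (b :: pre)),
          stackMap bits [] (b :: adj) f⟩ := by
      refine RunsIn.of_step ?_
      simp only [machineProgram]
      rw [stepAux_popBuffered_inp, stepAux_ifSome, ← update_stackMap_adj bits [] adj (b :: adj) f]
      change Turing.TM2.Cfg.mk _ (some b, (Buffer.ofList B pre).push b) _ = _
      rw [Buffer.push_ofList]
      rfl
    have h2 := h1.trans (ih (b :: adj) (some b) (b :: pre))
    simp only [List.reverse_cons, List.append_assoc, List.singleton_append]
    exact h2.mono (by simp; omega)

/-- The answer for a buffered input, given by the program `T` for reversed inputs. -/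
def bufferedAnswer (B : ℕ) (T : List Bool → Option Bool) (l : List Bool) : Option Bool :=
  (Buffer.ofList B l.reverse).bind fun l => T l.1

/-- The output of the machine. -/
def machineOutput (B : ℕ) (T : List Bool → Option Bool) (A₁ A₂ : ℕ → ℕ → Bool) (n : ℕ) : List Bool :=
  unaryCode (n + 1) ++
    match bufferedAnswer B T (unaryCode n ++ (rowsWord A₁ n n ++ rowsWord A₂ n n)) with
    | some true => encodeCircuit (m := 1) [] ++ encodeCircuit (m := 1) []
    | some false => encodeCircuit (m := 1) [] ++ encodeCircuit (magicCircuit 0)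
    | none => circuitWord A₁ n ++ circuitWord A₂ n

/-- A bound on the number of steps of the machine on inputs of length `N`. -/
def machineTime (N : ℕ) : ℕ := 2 * (N * (4 * N * N + 19 * N + 14)) + 7 * N + 20

theorem runsIn_machine (A₁ A₂ : ℕ → ℕ → Bool) (n : ℕ) :
    RunsIn T (machineTime (unaryCode n ++ (rowsWord A₁ n n ++ rowsWord A₂ n n)).length)
      ⟨some (.main .readSize), (none, Buffer.ofList B []),
        stackMap (unaryCode n ++ (rowsWord A₁ n n ++ rowsWord A₂ n n)) [] [] (counters 0 0 0 0)⟩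
      (haltCfg B (machineOutput B T A₁ A₂ n)) := by
  set bits := rowsWord A₁ n n ++ rowsWord A₂ n n with hbits
  set N := (unaryCode n ++ bits).length with hN
  have hnN : n + 1 + bits.length = N := by simp [hN, unaryCode]; omega
  have h1 := (runsIn_readSize (B := B) (T := T) bits n 0 none []).trans
    (runsIn_readBits (counters (0 + n) 0 0 0) bits [] (some false) _)
  rw [List.append_nil, List.append_nil, zero_add, ← List.reverse_append] at h1
  have hfin : ∀ (out adj : List Bool) (v : MachineState B),
      RunsIn T (n + 2 + (adj.length + 1))
        ⟨some (.main .finish), v, stackMap [] out adj (counters n 0 0 0)⟩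
        (haltCfg B (unaryCode (n + 1) ++ out)) := by
    intro out adj v
    obtain ⟨v', h⟩ := leads_finish (B := B) (T := T) n [] out adj v
    exact h.trans (runsIn_clear _ adj v')
  have hdisp : ∀ (w : List Bool), (Turing.TM2.stepAux (machineProgram T (.main .dispatch))
      (none, Buffer.ofList B (unaryCode n ++ bits).reverse)
      (stackMap [] [] bits.reverse (counters n 0 0 0))
      = ⟨some (.main .finish), (none, Buffer.ofList B (unaryCode n ++ bits).reverse),
        stackMap [] w bits.reverse (counters n 0 0 0)⟩) →
      RunsIn T (machineTime N)
        ⟨some (.main .readSize), (none, Buffer.ofList B []),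
          stackMap (unaryCode n ++ bits) [] [] (counters 0 0 0 0)⟩
        (haltCfg B (unaryCode (n + 1) ++ w)) := by
    intro w hw
    refine ((h1.trans (RunsIn.of_step hw)).trans (hfin w _ _)).mono ?_
    rw [machineTime, List.length_reverse]
    omega
  rw [machineOutput, ← hbits]
  rcases hans : bufferedAnswer B T (unaryCode n ++ bits) with _ | _ | _
  · have h2 : RunsIn T 1
        ⟨some (.main .dispatch), (none, Buffer.ofList B (unaryCode n ++ bits).reverse),
          stackMap [] [] bits.reverse (counters n 0 0 0)⟩
        ⟨some (.main (.circuit true)), (none, Buffer.ofList B (unaryCode n ++ bits).reverse),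
          stackMap [] [] bits.reverse (counters n 0 0 0)⟩ := by
      refine RunsIn.of_step ?_
      rw [bufferedAnswer] at hans
      simp only [machineProgram, Turing.TM2.stepAux, hans]
      rfl
    -- The second graph comes first: its bits were read last and lie on top, and the output is built
    -- from its end.
    obtain ⟨v, h3⟩ := leads_circuit (B := B) (T := T) true A₂ n [] [] (rowsWord A₁ n n).reverse
      (none, Buffer.ofList B (unaryCode n ++ bits).reverse)
    rw [← List.reverse_append, ← hbits] at h3
    obtain ⟨v', h4⟩ := leads_circuit (B := B) (T := T) false A₁ n [] (circuitWord A₂ n ++ []) [] v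
    rw [List.append_nil, List.append_nil] at h4
    rw [List.append_nil] at h3
    refine ((((h1.trans h2).trans h3).trans h4).trans (hfin _ [] v')).mono ?_
    have hle : n * (4 * n * n + 19 * n + 14) ≤ N * (4 * N * N + 19 * N + 14) := by
      have : n ≤ N := by omega
      gcongr
    rw [machineTime, List.length_nil]
    omega
  · apply hdisp
    rw [bufferedAnswer] at hans
    simp only [machineProgram, Turing.TM2.stepAux, hans]
    rw [show ((some false == some true) = false) from rfl, show ((some false == some false) = true) from rfl]
    simp only [cond_false, cond_true]
    rw [stepAux_write, stepAux_jump, update_stackMap_out]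
    simp [stackMap]
  · apply hdisp
    rw [bufferedAnswer] at hans
    simp only [machineProgram, Turing.TM2.stepAux, hans]
    rw [show ((some true == some true) = true) from rfl]
    simp only [cond_true]
    rw [stepAux_write, stepAux_jump, update_stackMap_out]
    simp [stackMap]

end runs

/-! ### The reduction is computable in polynomial time -/

open Classical in
/-- The entries of the adjacency matrix of a graph, indexed by natural numbers. -/
noncomputable def adjBit {n : ℕ} (G : SimpleGraph (Fin n)) (i j : ℕ) : Bool :=
  decide (∃ (hi : i < n) (hj : j < n), G.Adj ⟨i, hi⟩ ⟨j, hj⟩)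

theorem adjBit_coe {n : ℕ} (G : SimpleGraph (Fin n)) (i j : Fin n) [Decidable (G.Adj i j)] :
    adjBit G i j = decide (G.Adj i j) := by
  rw [adjBit, decide_eq_decide]
  exact ⟨fun ⟨_, _, h⟩ => h, fun h => ⟨i.isLt, j.isLt, h⟩⟩

theorem flatMap_range_eq {α : Type*} (n : ℕ) (f : ℕ → List α) :
    (List.range n).flatMap f = (List.finRange n).flatMap fun i : Fin n => f i.val := by
  rw [← List.map_coe_finRange_eq_range, List.flatMap_map]

theorem encodeGraph_eq_rowsWord {n : ℕ} (G : SimpleGraph (Fin n)) :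
    encodeGraph G = rowsWord (adjBit G) n n := by
  classical
  rw [rowsWord, flatMap_range_eq, encodeGraph]
  congr 1
  funext i
  rw [← List.map_coe_finRange_eq_range, List.map_map]
  congr 1
  funext j
  simp only [Function.comp_apply, adjBit_coe]

theorem encodeGraphPair_eq (p : GraphPair) :
    encodeGraphPair p = unaryCode p.1 ++
      (rowsWord (adjBit p.2.1) p.1 p.1 ++ rowsWord (adjBit p.2.2) p.1 p.1) := by
  rw [encodeGraphPair, encodeGraph_eq_rowsWord, encodeGraph_eq_rowsWord, List.append_assoc]

theorem edgesWord_eq_flatMap {n : ℕ} (G : SimpleGraph (Fin n)) (i : Fin n) :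
    edgesWord (adjBit G) i i
      = (List.finRange n).flatMap fun j => (edgeGates G i j).flatMap encodeGate := by
  classical
  -- Extending the range from `i` to `n` only adds empty words, and matches the loop over all
  -- vertices in the circuit.
  have h1 : edgesWord (adjBit G) i i = (List.range n).flatMap fun j : ℕ =>
      if j < i.val ∧ adjBit G i j then edgeWord i j else [] := by
    obtain ⟨d, hd⟩ := Nat.exists_eq_add_of_lt i.isLt
    have h2 : ((List.range (d + 1)).map (i.val + ·)).flatMap (fun j : ℕ =>
        if j < i.val ∧ adjBit G i j then edgeWord i j else []) = [] := by
      simp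
    have h3 : List.range n = List.range i ++ (List.range (d + 1)).map (i.val + ·) := by
      rw [← List.range_add, ← add_assoc, ← hd]
    rw [h3, List.flatMap_append, h2, List.append_nil]
    rw [edgesWord, List.flatMap, List.flatMap]
    congr 1
    refine List.map_congr_left fun j hj => ?_
    simp [List.mem_range.1 hj]
  rw [h1, flatMap_range_eq]
  congr 1
  funext j
  rw [adjBit_coe, edgeGates]
  by_cases h : j < i ∧ G.Adj i j
  · rw [dif_pos h, if_pos (by simpa using h)]
    simp [encodeGate, edgeWord]
  · rw [dif_neg h, if_neg (by simpa using h)]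
    rfl

theorem encodeCircuit_graphCircuit {n : ℕ} (G : SimpleGraph (Fin n)) :
    encodeCircuit (graphCircuit G) = circuitWord (adjBit G) n := by
  have h1 : ((List.finRange n).flatMap (vertexGates G)).flatMap encodeGate
      = (List.range n).flatMap fun i => vertexWord i ++ edgesWord (adjBit G) i i := by
    rw [flatMap_range_eq, List.flatMap_assoc]
    congr 1
    funext i
    rw [edgesWord_eq_flatMap, vertexGates, List.flatMap_append, List.flatMap_assoc]
    simp [vertexWord, encodeGate]
  rw [encodeCircuit, graphCircuit, List.flatMap_append, List.flatMap_append, h1, circuitWord]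
  simp [encodeGate]

/-! ### Unique decoding of inputs and the table of small cases -/

theorem unaryCode_append_inj {m n : ℕ} {l l' : List Bool}
    (h : unaryCode m ++ l = unaryCode n ++ l') : m = n ∧ l = l' := by
  induction m generalizing n with
  | zero => cases n <;> simp_all [unaryCode, List.replicate_succ]
  | succ m ih =>
    cases n with
    | zero => simp [unaryCode, List.replicate_succ] at h
    | succ n =>
      have := ih (n := n) (by simpa [unaryCode, List.replicate_succ] using h)
      exact ⟨congrArg _ this.1, this.2⟩

theorem length_rowsWord (A : ℕ → ℕ → Bool) (n k : ℕ) : (rowsWord A n k).length = k * n := by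
  simp [rowsWord, List.length_flatMap]

theorem rowsWord_inj {A A' : ℕ → ℕ → Bool} {n k : ℕ} (h : rowsWord A n k = rowsWord A' n k) :
    ∀ i < k, ∀ j < n, A i j = A' i j := by
  induction k with
  | zero => simp
  | succ k ih =>
    have hs : ∀ A, rowsWord A n (k + 1) = rowsWord A n k ++ (List.range n).map (A k) := by
      intro A
      rw [rowsWord, List.range_succ, List.flatMap_append, List.flatMap_singleton, rowsWord]
    rw [hs, hs] at h
    obtain ⟨h1, h2⟩ := List.append_inj h (by rw [length_rowsWord, length_rowsWord])
    intro i hi j hj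
    rcases Nat.lt_succ_iff_lt_or_eq.1 hi with hi | rfl
    · exact ih h1 i hi j hj
    · exact List.map_inj_left.1 h2 j (List.mem_range.2 hj)

theorem eq_of_rowsWord_eq {n : ℕ} {G G' : SimpleGraph (Fin n)}
    (h : rowsWord (adjBit G) n n = rowsWord (adjBit G') n n) : G = G' := by
  classical
  ext i j
  have := rowsWord_inj h i i.isLt j j.isLt
  rwa [adjBit_coe, adjBit_coe, decide_eq_decide] at this

/-- The size is self-delimiting and fixes the lengths of both matrices. Injectivity makes a table
indexed by codes unambiguous. -/
theorem encodeGraphPair_injective : Function.Injective encodeGraphPair := by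
  rintro ⟨n, G₁, G₂⟩ ⟨n', G₁', G₂'⟩ h
  rw [encodeGraphPair_eq, encodeGraphPair_eq] at h
  obtain ⟨hn, h⟩ := unaryCode_append_inj h
  dsimp only at hn h
  subst hn
  obtain ⟨h1, h2⟩ := List.append_inj h (by rw [length_rowsWord, length_rowsWord])
  rw [eq_of_rowsWord_eq h1, eq_of_rowsWord_eq h2]

open Classical in
/-- The table of answers for small graphs, given on reversed codes. -/
noncomputable def answerTable (l : List Bool) : Option Bool :=
  if ∃ p : GraphPair, p.1 < 1000 ∧ (encodeGraphPair p).reverse = l then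
    some (decide (∃ p : GraphPair, (encodeGraphPair p).reverse = l ∧ Nonempty (p.2.1 ≃g p.2.2)))
  else none

-- By injectivity the entry at the code of `p` concerns `p` alone. Overflow is harmless: for n <
-- 1000 the length n + 1 + 2n² is below 2000000, and longer inputs need no table entry.
open Classical in
theorem bufferedAnswer_encodeGraphPair {B : ℕ} (hB : 2000000 ≤ B) (p : GraphPair) :
    bufferedAnswer B answerTable (encodeGraphPair p)
      = if p.1 < 1000 then some (decide (Nonempty (p.2.1 ≃g p.2.2))) else none := by
  have hinj : ∀ q : GraphPair, (encodeGraphPair q).reverse = (encodeGraphPair p).reverse ↔ q = p :=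
    fun q => List.reverse_inj.trans encodeGraphPair_injective.eq_iff
  have hT : answerTable (encodeGraphPair p).reverse
      = if p.1 < 1000 then some (decide (Nonempty (p.2.1 ≃g p.2.2))) else none := by
    simp only [answerTable, hinj, exists_eq_right, exists_eq_left]
  by_cases hl : (encodeGraphPair p).reverse.length ≤ B
  · rw [bufferedAnswer, Buffer.ofList, dif_pos hl, Option.bind_some, hT]
  · rw [bufferedAnswer, Buffer.ofList, dif_neg hl, Option.bind_none, if_neg]
    intro hp
    apply hl
    rw [List.length_reverse, encodeGraphPair_eq]
    simp only [List.length_append, length_rowsWord, unaryCode, List.length_replicate,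
      List.length_singleton]
    have : p.1 * p.1 ≤ 1000 * 999 := Nat.mul_le_mul hp.le (by omega)
    omega

theorem machineOutput_eq {B : ℕ} (hB : 2000000 ≤ B) (p : GraphPair) :
    machineOutput B answerTable (adjBit p.2.1) (adjBit p.2.2) p.1
      = encodeCircuitPair (graphReduction p) := by
  classical
  rw [machineOutput, ← encodeGraphPair_eq, bufferedAnswer_encodeGraphPair hB, graphReduction]
  by_cases hp : p.1 < 1000
  · rw [if_pos hp, if_pos hp]
    by_cases hiso : Nonempty (p.2.1 ≃g p.2.2)
    · simp only [hiso, decide_true, if_true, encodeCircuitPair, List.append_assoc]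
      rfl
    · simp only [hiso, decide_false, if_false, encodeCircuitPair, List.append_assoc]
      simp [encodeCircuit, magicCircuit, encodeGate]
  · rw [if_neg hp, if_neg hp]
    simp only [encodeCircuitPair, encodeCircuit_graphCircuit, List.append_assoc]

/-! ### The machine as a polynomial-time witness -/

/-- The machine that computes the reduction. -/
noncomputable def reductionMachine (B : ℕ) : Turing.FinTM2 where
  K := StackName
  k₀ := .inp
  k₁ := .out
  Γ := fun _ => Bool
  Λ := Label
  main := .main .readSize
  σ := MachineState B
  initialState := (none, Buffer.ofList B [])
  m := machineProgram answerTable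

theorem initList_reductionMachine (B : ℕ) (l : List Bool) :
    Turing.initList (reductionMachine B) l
      = (⟨some (.main .readSize), (none, Buffer.ofList B []),
        stackMap l [] [] (counters 0 0 0 0)⟩ : MachineCfg B) := by
  have h : (Turing.initList (reductionMachine B) l).stk = stackMap l [] [] (counters 0 0 0 0) := by
    funext (k : StackName)
    rcases k with _ | _ | _ | c
    · rfl
    · rfl
    · rfl
    · cases c <;> rfl
  exact congrArg (fun S => (⟨some (.main .readSize), (none, Buffer.ofList B []), S⟩ : MachineCfg B)) h

theorem haltList_reductionMachine (B : ℕ) (l : List Bool) :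
    Turing.haltList (reductionMachine B) l = haltCfg B l := by
  have h : (Turing.haltList (reductionMachine B) l).stk = stackMap [] l [] (counters 0 0 0 0) := by
    funext (k : StackName)
    rcases k with _ | _ | _ | c
    · rfl
    · rfl
    · rfl
    · cases c <;> rfl
  exact congrArg (fun S => (⟨none, (none, Buffer.ofList B []), S⟩ : MachineCfg B)) h

open Polynomial in
/-- A polynomial that bounds the number of steps of the machine. -/
noncomputable def machineTimePoly : ℕ[X] := 2 * (X * (4 * X * X + 19 * X + 14)) + 7 * X + 20

theorem eval_machineTimePoly (N : ℕ) : machineTimePoly.eval N = machineTime N := by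
  simp [machineTimePoly, machineTime]

theorem polyTime_graphReduction :
    Nonempty (Turing.TM2ComputableInPolyTime encodeGraphPair encodeCircuitPair graphReduction) := by
  -- Only the lower bound on the buffer size matters, so its value is forgotten.
  obtain ⟨B, hB⟩ : ∃ B, 2000000 ≤ B := ⟨_, le_rfl⟩
  have hrun : ∀ p : GraphPair, ∃ k ≤ machineTime (encodeGraphPair p).length,
      (flip bind (reductionMachine B).step)^[k]
        (some (Turing.initList (reductionMachine B) (encodeGraphPair p)))
        = some (Turing.haltList (reductionMachine B) (encodeCircuitPair (graphReduction p))) := by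
    intro p
    have h := runsIn_machine (B := B) (T := answerTable) (adjBit p.2.1) (adjBit p.2.2) p.1
    rw [← encodeGraphPair_eq, machineOutput_eq hB] at h
    rw [initList_reductionMachine, haltList_reductionMachine]
    exact h
  choose k hk hrun using hrun
  refine ⟨{
    tm := reductionMachine B
    inputAlphabet := Equiv.refl Bool
    outputAlphabet := Equiv.refl Bool
    time := machineTimePoly
    outputsFun := fun p => ⟨⟨k p, ?_⟩, ?_⟩ }⟩
  · have h1 : ∀ l : List Bool, List.map (Equiv.refl Bool).invFun l = l := fun l => List.map_id l
    exact (h1 (encodeGraphPair p)).symm ▸ (h1 (encodeCircuitPair (graphReduction p))).symm ▸ hrun p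
  · rw [eval_machineTimePoly]
    exact hk p

/-! ### Assembly of the theorem -/

theorem mainTheorem6 :
    (∃ n₀ : ℕ,
      -- the reduction, total on all pairs of graphs, with the stated states for large `n`
      (∃ f : GraphPair → CircuitPair,
        IsPolyTimeReduction encodeGraphPair encodeCircuitPair
          graphIsomorphism (cliffordPSGI 0.99999 1) f ∧
        (∀ p : GraphPair, (f p).1 = p.1 + 1) ∧
        (∀ n : ℕ, n₀ ≤ n → ∀ G₁ G₂ : SimpleGraph (Fin n),
          ∃ C₁ C₂ : Circuit (n + 1), f ⟨n, G₁, G₂⟩ = ⟨n + 1, C₁, C₂⟩ ∧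
            C₁.state = controlledGraphState G₁ ∧ C₂.state = controlledGraphState G₂)) ∧
      -- a Clifford with high overlap permutes the qubits and fixes the control qubit
      (∀ n : ℕ, n₀ ≤ n → ∀ G₁ G₂ : SimpleGraph (Fin n), ∀ U ∈ cliffordGroup (n + 1),
        0.99999 ≤ ‖overlap (controlledGraphState G₁) U (controlledGraphState G₂)‖ →
          ∃ σ : Equiv.Perm (Fin (n + 1)), σ 0 = 0 ∧
            ∃ c : ℂ, ‖c‖ = 1 ∧ (U : QMatrix (n + 1)) = c • qubitPerm σ) ∧
      -- and exists only if the graphs are isomorphic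
      (∀ n : ℕ, n₀ ≤ n → ∀ G₁ G₂ : SimpleGraph (Fin n),
        (∃ U ∈ cliffordGroup (n + 1),
          0.99999 ≤ ‖overlap (controlledGraphState G₁) U (controlledGraphState G₂)‖) →
          Nonempty (G₁ ≃g G₂))) ∧
    -- for isomorphic graphs, a permutation of the target qubits relates the two states exactly
    (∀ (n : ℕ) (G₁ G₂ : SimpleGraph (Fin n)), Nonempty (G₁ ≃g G₂) →
      ∃ U ∈ cliffordGroup (n + 1), ∃ σ : Equiv.Perm (Fin (n + 1)), σ 0 = 0 ∧
        (U : QMatrix (n + 1)) = qubitPerm σ ∧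
        (U : QMatrix (n + 1)) *ᵥ controlledGraphState G₂ = controlledGraphState G₁) ∧
    -- a Clifford that nearly fixes `|R^n⟩` permutes the qubits
    (∀ n : ℕ, ∀ U ∈ cliffordGroup n, 0.9999 ≤ ‖overlap (ketRpow n) U (ketRpow n)‖ ^ 2 →
      ∃ σ : Equiv.Perm (Fin n), ∃ c : ℂ, ‖c‖ = 1 ∧ (U : QMatrix n) = c • qubitPerm σ) := by
  refine ⟨⟨1000, ⟨graphReduction, ⟨polyTime_graphReduction, fun p => graphReduction_yes p,
    fun p => graphReduction_no p⟩, fun p => ?_, fun n hn G₁ G₂ => ?_⟩, fun n hn G₁ G₂ U hU h =>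
      (clifford_rigidity hn hU h).1, fun n hn G₁ G₂ ⟨U, hU, h⟩ => (clifford_rigidity hn hU h).2⟩,
    fun n G₁ G₂ ⟨e⟩ => exists_qubitPerm_of_iso e, fun n U hU h => clifford_eq_qubitPerm hU h⟩
  · rw [graphReduction]
    split_ifs <;> rfl
  · exact ⟨graphCircuit G₁, graphCircuit G₂, if_neg (not_lt.2 hn), state_graphCircuit G₁,
      state_graphCircuit G₂⟩
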